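/- All graphs are finite, undirected and loopless and may have multiple edges; the edge-degree of a vertex is the number of edges incident to it, counted with multiplicity, and graphs are considered up to isomorphism. A line is a simple arc in $\mathbb{R}^2$ (a homeomorphic image of $[0,1]$). A finite collection $\mathcal{L}$ of distinct lines is normal if no point belongs to more than two of them; its intersection graph $G_{\mathcal{L}}$ has vertex set $\mathcal{L}$, and distinct lines $L,L'$ are joined by exactly $|L\cap L'|$ edges. Let $\mathcal{S}_d$ be the class of all graphs $G_{\mathcal{L}}$, with $\mathcal{L}$ normal, in which every vertex has edge-degree at most $d$. Let $\mathcal{P}$ be the class of planar graphs. For a graph $G$ and a collection $\mathcal{C}$ of distinct vertex sets of $G$, each inducing a (nonempty) connected subgraph, the intersection graph $I_G(\mathcal{C})$ has vertex set $\mathcal{C}$, and distinct sets $C,C'$ are joined by exactly $|C\cap C'|$ edges. Let $\mathsf{inter}_d(\mathcal{P})$ be the class of all graphs $I_G(\mathcal{C})$, with $G\in\mathcal{P}$, in which every vertex has edge-degree at most $d$. Lemma. There is a constant $c$ such that for every $d\in\mathbb{N}$ the following hold. (1) $\mathcal{S}_d\subseteq\mathsf{inter}_d(\mathcal{P})$ (as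 graphs with multiple edges). (2) There is $d'\le c\,d^2$ such that $\mathsf{inter}_d(\mathcal{P})\subseteq\mathcal{S}_{d'}$ up to edge multiplicities, that is, every $H\in\mathsf{inter}_d(\mathcal{P})$ has the same underlying simple graph as some $H'\in\mathcal{S}_{d'}$. -/

import Mathlib

/-- A finite, undirected, loopless graph in which multiple edges are allowed, given by its
vertex set and the multiplicity of every (unordered) pair of vertices. -/
structure Multigraph : Type 1 where
  V : Type
  [fintypeV : Fintype V]
  mult : V → V → ℕ
  mult_symm : ∀ u v, mult u v = mult v u
  loopless : ∀ v, mult v v = 0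

attribute [instance] Multigraph.fintypeV

namespace Multigraph

/-- The number of edges incident to `v`, counted with multiplicity. -/
def edgeDegree (G : Multigraph) (v : G.V) : ℕ := ∑ w, G.mult v w

/-- The underlying simple graph, obtained by forgetting multiplicities. -/
def toSimpleGraph (G : Multigraph) : SimpleGraph G.V where
  Adj u v := G.mult u v ≠ 0
  symm := ⟨fun u v h => by rwa [G.mult_symm v u]⟩
  loopless := ⟨fun v h => h (G.loopless v)⟩

/-- `S` is a connected set of `G`: the induced subgraph `G[S]` is connected
(in particular nonempty). -/
def IsConnectedSet (G : Multigraph) (S : Set G.V) : Prop :=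
  (G.toSimpleGraph.induce S).Connected

end Multigraph

/-- The Euclidean plane. -/
abbrev Plane : Type := EuclideanSpace ℝ (Fin 2)

/-- `A` is a simple arc in the plane, i.e. a homeomorphic image of `[0, 1]`, with ends `p, q`. -/
def IsArcBetween (A : Set Plane) (p q : Plane) : Prop :=
  ∃ f : unitInterval → Plane,
    Continuous f ∧ Function.Injective f ∧ Set.range f = A ∧ f 0 = p ∧ f 1 = q

/-- A line (string) in the plane: a simple arc. -/
def IsLine (A : Set Plane) : Prop := ∃ p q, IsArcBetween A p q

/-- A drawing of a multigraph in the plane without crossings: vertices are distinct points, and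
the edges joining `u` and `v` (indexed by `k < G.mult u v`) are simple arcs with ends `u` and `v`
that contain no other vertex; distinct edges have no common point other than vertices. -/
structure PlaneDrawing (G : Multigraph) where
  point : G.V → Plane
  arc : G.V → G.V → ℕ → Set Plane
  point_injective : Function.Injective point
  arc_symm : ∀ u v k, arc u v k = arc v u k
  isArcBetween : ∀ u v k, k < G.mult u v → IsArcBetween (arc u v k) (point u) (point v)
  eq_end_of_mem : ∀ u v k w, k < G.mult u v → point w ∈ arc u v k → w = u ∨ w = v
  mem_range_of_mem : ∀ u v k u' v' k', k < G.mult u v → k' < G.mult u' v' →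
    (s(u, v), k) ≠ (s(u', v'), k') →
    ∀ x ∈ arc u v k, x ∈ arc u' v' k' → x ∈ Set.range point

/-- The class `𝒫` of planar graphs. -/
def PlanarGraphs : Set Multigraph := {G | Nonempty (PlaneDrawing G)}

/-- A collection of lines is normal if no point belongs to more than two of them. -/
def IsNormal {ι : Type} (L : ι → Set Plane) : Prop := ∀ x : Plane, {i | x ∈ L i}.encard ≤ 2

/-- `H` is (up to isomorphism) the intersection graph of the collection of pairwise distinct
lines `L`: the vertices of `H` correspond to the lines, and the multiplicity of an edge is the
number of common points of its two lines (in particular this number is finite). -/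
def IsLineIntersectionGraph (H : Multigraph) (L : H.V → Set Plane) : Prop :=
  Function.Injective L ∧ ∀ i j, i ≠ j → (L i ∩ L j).encard = (H.mult i j : ℕ∞)

/-- The class `𝒮_d` of string graphs with edge-degree bounded by `d`. -/
def StringGraphs (d : ℕ) : Set Multigraph :=
  {H | (∃ L : H.V → Set Plane,
      (∀ i, IsLine (L i)) ∧ IsNormal L ∧ IsLineIntersectionGraph H L) ∧
    ∀ v, H.edgeDegree v ≤ d}

/-- `H` is (up to isomorphism) the intersection graph `I_G(𝒞)` of the collection `𝒞` of pairwise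
distinct vertex sets of `G`, indexed by the vertices of `H`: the multiplicity of an edge is the
number of common vertices of its two sets. -/
def IsSetIntersectionGraph (H G : Multigraph) (C : H.V → Set G.V) : Prop :=
  Function.Injective C ∧ ∀ i j, i ≠ j → H.mult i j = (C i ∩ C j).ncard

/-- The class `inter(𝒢)` of intersection graphs of connected vertex sets of graphs in `𝒢`. -/
def IntersectionGraphs (𝒢 : Set Multigraph) : Set Multigraph :=
  {H | ∃ G ∈ 𝒢, ∃ C : H.V → Set G.V,
    (∀ i, G.IsConnectedSet (C i)) ∧ IsSetIntersectionGraph H G C}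

/-- The class `inter_d(𝒢)` of the graphs in `inter(𝒢)` of edge-degree at most `d`. -/
def BoundedIntersectionGraphs (d : ℕ) (𝒢 : Set Multigraph) : Set Multigraph :=
  {H | H ∈ IntersectionGraphs 𝒢 ∧ ∀ v, H.edgeDegree v ≤ d}

/-- The graphs that agree with a member of `𝒢` up to isomorphism and up to the (positive)
multiplicities of their edges. -/
def UpToMultiplicity (𝒢 : Set Multigraph) : Set Multigraph :=
  {H | ∃ H' ∈ 𝒢, Nonempty (H.toSimpleGraph ≃g H'.toSimpleGraph)}

/-! For (1), cut the lines at the set `X` of all their common points together with one private point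
on each line. The pieces between consecutive points of `X` form a plane graph on `X`. The points of
`X` on one line induce a connected set, and two such sets share exactly the common points of their
lines. The private points make the sets nonempty and distinct.

For (2), let `C i` be connected sets in a plane graph `G`. At most `d` vertices of `C i` lie in
other sets, and adding paths one at a time gives a subtree of `G` in `C i` through all of them, of
maximum degree at most `2 * d` (`exists_grows_of_connected`). Redraw `G` with polygonal edges and,
at every vertex `v` and for every index `i`, add a whisker labelled `i`, a short path leaving `v`
(`exists_network`). The tree of `i` together with the whiskers labelled `i` at its vertices is a
tree of the new drawing (`Network.exists_lift`).

The line `A i` runs closely around this tree (`exists_contours`). It avoids the tree and crosses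
every other edge once near each end that the tree contains. It is built by adding leaf edges: where
it crosses the new edge, a short straight piece is replaced by three sides of a thin rectangle
around the rest of the edge (`IsContour.exists_step`). A contour drawn later meets an earlier one at
most twice for each crossing of the earlier one with an edge of the later tree.

Such crossings occur only at vertices common to the two trees, where at most `2 * d` tree edges and
one whisker leave. So `A i` and `A j` have at most `2 * (2 * d + 1)` common points per vertex of `C
i ∩ C j`, and summing over `j` gives `2 * (2 * d + 1) * d`. Conversely, at a vertex common to both
trees the whisker labelled `j` leaves the tree of `i`, and vice versa; whichever contour comes
second follows its whisker across the first, so the two lines do meet. -/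

section StringGraphs

open Set Filter Topology

/-! ### Arcs: subarcs, concatenation, and replacement of a short straight piece. -/

theorem IsArcBetween.exists_real {A : Set Plane} {p q : Plane} (h : IsArcBetween A p q) :
    ∃ g : ℝ → Plane, Continuous g ∧ InjOn g (Icc 0 1) ∧ g '' Icc 0 1 = A ∧ g 0 = p ∧ g 1 = q := by
  obtain ⟨f, hc, hi, hr, h0, h1⟩ := h
  refine ⟨IccExtend zero_le_one f, hc.Icc_extend', ?_, ?_, ?_, ?_⟩
  · intro s hs t ht hst
    rw [IccExtend_of_mem _ _ hs, IccExtend_of_mem _ _ ht] at hst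
    exact congrArg Subtype.val (hi hst)
  · rw [← hr, ← IccExtend_range zero_le_one f]
    refine Subset.antisymm (image_subset_range _ _) ?_
    rw [IccExtend_range]
    rintro _ ⟨t, rfl⟩
    exact ⟨t, t.2, IccExtend_val _ _ _⟩
  · rw [← h0]; exact IccExtend_left zero_le_one f
  · rw [← h1]; exact IccExtend_right zero_le_one f

theorem isArcBetween_image_Icc {g : ℝ → Plane} {a b : ℝ} (hab : a < b)
    (hc : ContinuousOn g (Icc a b)) (hi : InjOn g (Icc a b)) :
    IsArcBetween (g '' Icc a b) (g a) (g b) := by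
  have hm : MapsTo (fun t : ℝ => a + t * (b - a)) (Icc 0 1) (Icc a b) := by
    intro t ht
    simp only [mem_Icc] at ht ⊢
    constructor <;> nlinarith
  refine ⟨fun t => g (a + t * (b - a)), ?_, ?_, ?_, by simp, by simp⟩
  · have : ContinuousOn (fun t : ℝ => g (a + t * (b - a))) (Icc 0 1) :=
      hc.comp (by fun_prop) hm
    exact this.domRestrict
  · intro s t hst
    have := hi (hm s.2) (hm t.2) hst
    apply Subtype.ext
    have hne : b - a ≠ 0 := by linarith
    have h2 : (s : ℝ) * (b - a) = t * (b - a) := by linarith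
    exact mul_right_cancel₀ hne h2
  · ext y
    constructor
    · rintro ⟨t, rfl⟩
      exact ⟨_, hm t.2, rfl⟩
    · rintro ⟨s, hs, rfl⟩
      have hne : b - a ≠ 0 := by linarith
      refine ⟨⟨(s - a) / (b - a), ?_, ?_⟩, ?_⟩
      · exact div_nonneg (by linarith [hs.1]) (by linarith)
      · rw [div_le_one (by linarith)]; linarith [hs.2]
      · simp only
        congr 1
        field_simp
        ring

theorem IsArcBetween.symm {A : Set Plane} {p q : Plane} (h : IsArcBetween A p q) :
    IsArcBetween A q p := by
  obtain ⟨f, hc, hi, hr, h0, h1⟩ := h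
  refine ⟨fun t => f (unitInterval.symm t), by fun_prop, ?_, ?_, by simpa using h1, by simpa using h0⟩
  · intro s t hst
    exact unitInterval.symm_bijective.injective (hi hst)
  · rw [← hr]
    exact unitInterval.symm_bijective.surjective.range_comp f

theorem IsArcBetween.isCompact {A : Set Plane} {p q : Plane} (h : IsArcBetween A p q) :
    IsCompact A := by
  obtain ⟨f, hc, -, rfl, -⟩ := h
  exact isCompact_range hc

theorem IsArcBetween.left_mem {A : Set Plane} {p q : Plane} (h : IsArcBetween A p q) : p ∈ A := by
  obtain ⟨f, hc, -, rfl, rfl, -⟩ := h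
  exact mem_range_self _

theorem IsArcBetween.trans {A B : Set Plane} {p q r : Plane} (hA : IsArcBetween A p q)
    (hB : IsArcBetween B q r) (hAB : A ∩ B ⊆ {q}) : IsArcBetween (A ∪ B) p r := by
  obtain ⟨g, gc, gi, rfl, rfl, gq⟩ := hA.exists_real
  obtain ⟨k, kc, ki, rfl, kq, rfl⟩ := hB.exists_real
  set f : ℝ → Plane := fun t => if t ≤ 1 then g t else k (t - 1) with hf
  have hcont : Continuous f := by
    refine Continuous.if_le gc (by fun_prop) continuous_id continuous_const ?_
    rintro t rfl
    simp [gq, kq]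
  have hinj : InjOn f (Icc 0 2) := by
    have key : ∀ s ∈ Icc (0 : ℝ) 2, ∀ t ∈ Icc (0 : ℝ) 2, s ≤ 1 → 1 < t → f s ≠ f t := by
      intro s hs t ht h1 h2 h
      have ht' : t - 1 ∈ Icc (0 : ℝ) 1 := ⟨by linarith, by linarith [ht.2]⟩
      simp only [hf, h1, if_true, not_le.2 h2, if_false] at h
      have : k (t - 1) = q := hAB ⟨⟨s, ⟨hs.1, h1⟩, h⟩, ⟨t - 1, ht', rfl⟩⟩
      rw [← kq] at this
      have := ki ht' (by simp) this
      linarith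
    intro s hs t ht h
    rcases le_or_gt s 1 with h1 | h1 <;> rcases le_or_gt t 1 with h2 | h2
    · simp only [hf, h1, h2, if_true] at h
      exact gi ⟨hs.1, h1⟩ ⟨ht.1, h2⟩ h
    · exact absurd h (key s hs t ht h1 h2)
    · exact absurd h.symm (key t ht s hs h2 h1)
    · simp only [hf, not_le.2 h1, not_le.2 h2, if_false] at h
      have := ki ⟨by linarith, by linarith [hs.2]⟩ ⟨by linarith, by linarith [ht.2]⟩ h
      linarith
  have himg : f '' Icc 0 2 = g '' Icc 0 1 ∪ k '' Icc 0 1 := by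
    ext y
    constructor
    · rintro ⟨t, ht, rfl⟩
      rcases le_or_gt t 1 with h1 | h1
      · left; exact ⟨t, ⟨ht.1, h1⟩, by simp [hf, h1]⟩
      · right; exact ⟨t - 1, ⟨by linarith, by linarith [ht.2]⟩, by simp [hf, not_le.2 h1]⟩
    · rintro (⟨t, ht, rfl⟩ | ⟨t, ht, rfl⟩)
      · exact ⟨t, ⟨ht.1, by linarith [ht.2]⟩, by simp [hf, ht.2]⟩
      · rcases ht.1.eq_or_lt with h0 | h0
        · exact ⟨1, by norm_num, by simp [hf, gq, ← h0, kq]⟩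
        · exact ⟨t + 1, ⟨by linarith, by linarith [ht.2]⟩, by simp [hf, h0]⟩
  have := isArcBetween_image_Icc (by norm_num : (0 : ℝ) < 2) hcont.continuousOn hinj
  rw [himg] at this
  have e0 : f 0 = g 0 := by simp [hf]
  have e2 : f 2 = k 1 := by norm_num [hf]
  rwa [e0, e2] at this

/-- Near `z`, the set `K` is the line through `z` with direction `u`. -/
def StraightAt (K : Set Plane) (z u : Plane) : Prop :=
  ∀ᶠ y in 𝓝 z, (y ∈ K ↔ ∃ τ : ℝ, y = z + τ • u)

theorem isArcBetween_image_unitInterval {f : unitInterval → Plane} (fc : Continuous f)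
    (fi : Function.Injective f) {s t : unitInterval} (hst : s < t) :
    IsArcBetween (f '' Icc s t) (f s) (f t) := by
  have h := isArcBetween_image_Icc (g := IccExtend zero_le_one f) (a := s) (b := t) hst
    fc.Icc_extend'.continuousOn (by
      intro x hx y hy hxy
      have hx' : x ∈ Icc (0 : ℝ) 1 := ⟨s.2.1.trans hx.1, hx.2.trans t.2.2⟩
      have hy' : y ∈ Icc (0 : ℝ) 1 := ⟨s.2.1.trans hy.1, hy.2.trans t.2.2⟩
      rw [IccExtend_of_mem _ _ hx', IccExtend_of_mem _ _ hy'] at hxy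
      exact congrArg Subtype.val (fi hxy))
  rw [IccExtend_val, IccExtend_val] at h
  convert h using 1
  ext y
  constructor
  · rintro ⟨x, hx, rfl⟩
    exact ⟨x, hx, IccExtend_val _ _ _⟩
  · rintro ⟨x, hx, rfl⟩
    have hx' : x ∈ Icc (0 : ℝ) 1 := ⟨s.2.1.trans hx.1, hx.2.trans t.2.2⟩
    exact ⟨⟨x, hx'⟩, hx, (IccExtend_of_mem _ _ hx').symm⟩

/-- The curve is cut at the parameters `k (-δ)` and `k δ`, and `B` is glued in between. The margin
`δ < δ₀` keeps both outer arcs nondegenerate. -/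
theorem isLine_replace_of_strictMonoOn {f : unitInterval → Plane} (fc : Continuous f)
    (fi : Function.Injective f) {k : ℝ → unitInterval} {δ₀ δ : ℝ} {p u : Plane}
    (kc : ContinuousOn k (Icc (-δ₀) δ₀)) (km : StrictMonoOn k (Icc (-δ₀) δ₀))
    (hk : ∀ τ ∈ Icc (-δ₀) δ₀, f (k τ) = p + τ • u) (hδ : 0 < δ) (hδ₀ : δ < δ₀) {B : Set Plane}
    (hB : IsArcBetween B (p - δ • u) (p + δ • u))
    (hAB : range f ∩ B ⊆ {p - δ • u, p + δ • u}) :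
    IsLine ((range f \ {z | ∃ τ : ℝ, |τ| < δ ∧ z = p + τ • u}) ∪ B) := by
  have m1 : -δ₀ ∈ Icc (-δ₀) δ₀ := ⟨le_rfl, by linarith⟩
  have m2 : -δ ∈ Icc (-δ₀) δ₀ := ⟨by linarith, by linarith⟩
  have m3 : δ ∈ Icc (-δ₀) δ₀ := ⟨by linarith, by linarith⟩
  have m4 : δ₀ ∈ Icc (-δ₀) δ₀ := ⟨by linarith, by linarith⟩
  have l1 : k (-δ₀) < k (-δ) := km m1 m2 (by linarith)
  have l2 : k (-δ) < k δ := km m2 m3 (by linarith)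
  have l3 : k δ < k δ₀ := km m3 m4 (by linarith)
  have e2 : f (k (-δ)) = p - δ • u := by rw [hk _ m2, neg_smul, sub_eq_add_neg]
  have e3 : f (k δ) = p + δ • u := hk _ m3
  have a1 := isArcBetween_image_unitInterval fc fi ((unitInterval.nonneg' (t := k (-δ₀))).trans_lt l1)
  have a2 := isArcBetween_image_unitInterval fc fi (l3.trans_le (unitInterval.le_one' (t := k δ₀)))
  rw [e2] at a1
  rw [e3] at a2
  have hdisj : ∀ z ∈ f '' Icc 0 (k (-δ)), z ∉ f '' Icc (k δ) 1 := by
    rintro _ ⟨s, hs, rfl⟩ ⟨t, ht, h⟩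
    have := fi h
    subst this
    exact absurd (ht.1.trans hs.2) (not_le.2 l2)
  have b1 := a1.trans hB (by
    rintro z ⟨hz1, hz2⟩
    have hz1' := image_subset_range _ _ hz1
    rcases hAB ⟨hz1', hz2⟩ with h | h
    · exact h
    · rw [mem_singleton_iff] at h
      exact absurd (h ▸ a2.left_mem) (hdisj z hz1))
  have b2 := b1.trans a2 (by
    rintro z ⟨hz1 | hz1, hz2⟩
    · exact absurd hz2 (hdisj z hz1)
    · have hz2' := image_subset_range _ _ hz2
      rcases hAB ⟨hz2', hz1⟩ with h | h
      · exact absurd hz2 (hdisj z (h ▸ a1.symm.left_mem))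
      · exact h)
  refine ⟨f 0, f 1, ?_⟩
  convert b2 using 1
  have key : range f \ {z | ∃ τ : ℝ, |τ| < δ ∧ z = p + τ • u} =
      f '' Icc 0 (k (-δ)) ∪ f '' Icc (k δ) 1 := by
    ext z
    constructor
    · rintro ⟨⟨t, rfl⟩, hz⟩
      rcases le_or_gt t (k (-δ)) with h1 | h1
      · left; exact ⟨t, ⟨unitInterval.nonneg', h1⟩, rfl⟩
      rcases le_or_gt (k δ) t with h2 | h2
      · right; exact ⟨t, ⟨h2, unitInterval.le_one'⟩, rfl⟩
      exfalso
      obtain ⟨τ, hτ, rfl⟩ := intermediate_value_Ioo (by linarith : -δ ≤ δ)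
        (kc.mono (Icc_subset_Icc (by linarith) hδ₀.le)) ⟨h1, h2⟩
      exact hz ⟨τ, abs_lt.2 hτ, hk _ ⟨by linarith [hτ.1], by linarith [hτ.2]⟩⟩
    · rintro (⟨t, ht, rfl⟩ | ⟨t, ht, rfl⟩)
      all_goals
        refine ⟨mem_range_self _, ?_⟩
        rintro ⟨τ, hτ, h⟩
        have hτ' := abs_lt.1 hτ
        have m5 : τ ∈ Icc (-δ₀) δ₀ := ⟨by linarith, by linarith⟩
        rw [← hk τ m5] at h
        have := fi h
        subst this
      · exact absurd ht.2 (not_le.2 (km m2 m5 hτ'.1))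
      · exact absurd ht.1 (not_le.2 (km m5 m3 hτ'.2))
  rw [key, union_right_comm]

theorem IsArcBetween.replace {A : Set Plane} {x y p u : Plane} (hA : IsArcBetween A x y)
    (hu : u ≠ 0) (hp : StraightAt A p u) :
    ∃ δ₀ > 0, ∀ δ, 0 < δ → δ < δ₀ → ∀ B, IsArcBetween B (p - δ • u) (p + δ • u) →
      A ∩ B ⊆ {p - δ • u, p + δ • u} →
      IsLine ((A \ {z | ∃ τ : ℝ, |τ| < δ ∧ z = p + τ • u}) ∪ B) := by
  obtain ⟨f, fc, fi, fr, -, -⟩ := hA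
  have hcont : Tendsto (fun τ : ℝ => p + τ • u) (𝓝 0) (𝓝 p) := by
    have : Continuous (fun τ : ℝ => p + τ • u) := by fun_prop
    simpa using this.tendsto 0
  obtain ⟨δ₁, hδ₁, h1⟩ := Metric.eventually_nhds_iff_ball.1 (hcont.eventually hp)
  have hmem : ∀ τ : ℝ, |τ| < δ₁ → p + τ • u ∈ A := fun τ hτ =>
    (h1 τ (by simpa using hτ)).2 ⟨τ, rfl⟩
  set δ₀ := δ₁ / 2 with hδ₀
  have hmem' : ∀ τ ∈ Icc (-δ₀) δ₀, ∃ t : unitInterval, f t = p + τ • u := by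
    intro τ hτ
    have := hmem τ (abs_lt.2 ⟨by linarith [hτ.1], by linarith [hτ.2]⟩)
    rw [← fr] at this
    exact this
  have hli : Function.Injective (fun τ : ℝ => p + τ • u) := by
    intro s t h
    simpa [hu] using h
  -- `k` inverts `f` along the straight piece. It is continuous because `f` is a closed embedding,
  -- and it is injective, hence strictly monotone.
  choose! k hk using hmem'
  have kc : ContinuousOn k (Icc (-δ₀) δ₀) := by
    rw [continuousOn_iff_continuous_domRestrict, (fc.isClosedEmbedding fi).isEmbedding.continuous_iff]
    have : (f ∘ (Icc (-δ₀) δ₀).domRestrict k) = fun τ : Icc (-δ₀) δ₀ => p + (τ : ℝ) • u := by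
      ext1 τ
      exact hk τ τ.2
    rw [this]
    fun_prop
  have ki : InjOn k (Icc (-δ₀) δ₀) := by
    intro s hs t ht h
    apply hli
    simp only
    rw [← hk s hs, ← hk t ht, h]
  have hδ₀pos : 0 < δ₀ := by positivity
  refine ⟨δ₀, hδ₀pos, ?_⟩
  clear_value δ₀
  clear hmem hli hcont h1 hp
  intro δ hδ hlt B hB hAB
  subst fr
  rcases kc.strictMonoOn_of_injOn_Icc' (by linarith) ki with km | km
  · exact isLine_replace_of_strictMonoOn fc fi kc km hk hδ hlt hB hAB
  -- If `k` decreases, reversing the direction `u` reduces to the increasing case.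
  · have hmaps : MapsTo (fun τ : ℝ => -τ) (Icc (-δ₀) δ₀) (Icc (-δ₀) δ₀) := fun τ hτ =>
      ⟨by linarith [hτ.2], by linarith [hτ.1]⟩
    have := isLine_replace_of_strictMonoOn (k := fun τ => k (-τ)) (u := -u) (p := p) (B := B)
      fc fi (kc.comp (by fun_prop) hmaps)
      (fun s hs t ht hst => km (hmaps ht) (hmaps hs) (by simpa using hst))
      (fun τ hτ => by rw [hk _ (hmaps hτ)]; simp) hδ hlt
      (by simpa [sub_eq_add_neg] using hB.symm)
      (by simpa [sub_eq_add_neg, pair_comm] using hAB)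
    convert this using 3
    ext z
    constructor
    · rintro ⟨τ, h1, rfl⟩; exact ⟨-τ, by simpa using h1, by simp⟩
    · rintro ⟨τ, h1, rfl⟩; exact ⟨-τ, by simpa using h1, by simp⟩

/-! ### Thin rectangles around a segment, in affine coordinates. -/

/-- The determinant of two vectors of the plane. -/
def det2 (a b : Plane) : ℝ := a 0 * b 1 - a 1 * b 0

/-- The point with coordinates `x` in the affine frame with origin `p` and axes `a`, `u`. -/
def frame (p a u : Plane) (x : ℝ × ℝ) : Plane := p + x.1 • a + x.2 • u

/-- The coordinates of `z` in the affine frame with origin `p` and axes `a`, `u`. -/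
noncomputable def coord (p a u z : Plane) : ℝ × ℝ :=
  (det2 (z - p) u / det2 a u, det2 a (z - p) / det2 a u)

theorem continuous_frame (p a u : Plane) : Continuous (frame p a u) := by
  unfold frame; fun_prop

theorem continuous_coord (p a u : Plane) : Continuous (coord p a u) := by
  unfold coord det2; fun_prop

theorem frame_coord {a u : Plane} (h : det2 a u ≠ 0) (p z : Plane) :
    frame p a u (coord p a u z) = z := by
  ext i
  simp only [frame, coord, PiLp.add_apply, PiLp.smul_apply, smul_eq_mul]
  rw [add_assoc, div_mul_eq_mul_div, div_mul_eq_mul_div, ← add_div, ← eq_sub_iff_add_eq',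
    div_eq_iff h]
  unfold det2
  fin_cases i <;> simp <;> ring

theorem coord_frame {a u : Plane} (h : det2 a u ≠ 0) (p : Plane) (x : ℝ × ℝ) :
    coord p a u (frame p a u x) = x := by
  ext <;> simp only [frame, coord] <;> rw [div_eq_iff h] <;> unfold det2 <;> simp <;> ring

theorem frame_injective {a u : Plane} (h : det2 a u ≠ 0) (p : Plane) :
    Function.Injective (frame p a u) :=
  Function.LeftInverse.injective (coord_frame h p)

theorem mem_segment_iff_frame {p a u z : Plane} :
    z ∈ segment ℝ p (p + a) ↔ ∃ s ∈ Icc (0 : ℝ) 1, z = frame p a u (s, 0) := by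
  rw [segment_eq_image']
  simp [frame, eq_comm]

/-- Three sides of a thin rectangle: all but the left one. -/
def rim (δ : ℝ) : Set (ℝ × ℝ) :=
  {x | (|x.2| = δ ∧ 0 ≤ x.1 ∧ x.1 ≤ 1 + δ ^ 2) ∨ (x.1 = 1 + δ ^ 2 ∧ |x.2| ≤ δ)}

/-- A thin rectangle about the segment from `(0, 0)` to `(1, 0)`. -/
def box (δ : ℝ) : Set (ℝ × ℝ) := {x | 0 ≤ x.1 ∧ x.1 ≤ 1 + δ ^ 2 ∧ |x.2| ≤ δ}

theorem rim_subset_box {δ : ℝ} : rim δ ⊆ box δ := by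
  rintro x (⟨h1, h2, h3⟩ | ⟨h1, h2⟩)
  · exact ⟨h2, h3, h1.le⟩
  · exact ⟨h1 ▸ by positivity, h1.le, h2⟩

theorem exists_dist_segment_lt {p a u : Plane} {ε : ℝ} (hε : 0 < ε) :
    ∀ᶠ δ in 𝓝[>] (0 : ℝ), ∀ z ∈ frame p a u '' box δ, ∃ y ∈ segment ℝ p (p + a), dist z y < ε := by
  have hc : Tendsto (fun δ : ℝ => δ ^ 2 * ‖a‖ + δ * ‖u‖) (𝓝[>] 0) (𝓝 0) := by
    have : Continuous (fun δ : ℝ => δ ^ 2 * ‖a‖ + δ * ‖u‖) := by fun_prop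
    simpa using (this.tendsto 0).mono_left nhdsWithin_le_nhds
  filter_upwards [hc.eventually (gt_mem_nhds hε), self_mem_nhdsWithin] with δ hδ hδ0
  rintro _ ⟨⟨s, t⟩, ⟨h1, h2, h3⟩, rfl⟩
  refine ⟨frame p a u (min s 1, 0), mem_segment_iff_frame.2 ⟨_, ⟨by simp at *; exact h1, by simp⟩, rfl⟩, ?_⟩
  have : frame p a u (s, t) - frame p a u (min s 1, 0) = (s - min s 1) • a + t • u := by
    simp only [frame]; module
  rw [dist_eq_norm, this]
  refine lt_of_le_of_lt (norm_add_le _ _) (lt_of_le_of_lt ?_ hδ)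
  rw [norm_smul, norm_smul, Real.norm_eq_abs, Real.norm_eq_abs]
  have : |s - min s 1| ≤ δ ^ 2 := by
    simp only at h1 h2
    rcases le_total s 1 with h | h
    · rw [min_eq_left h]; simp; positivity
    · rw [min_eq_right h, abs_of_nonneg (by linarith)]; linarith
  gcongr

theorem eventually_disjoint_box {p a u : Plane} {K : Set Plane} (hK : IsCompact K)
    (h : Disjoint K (segment ℝ p (p + a))) :
    ∀ᶠ δ in 𝓝[>] (0 : ℝ), Disjoint K (frame p a u '' box δ) := by
  have hseg : IsCompact (segment ℝ p (p + a)) := by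
    rw [segment_eq_image_lineMap]
    exact isCompact_Icc.image AffineMap.lineMap_continuous
  obtain ⟨ε, hε, hd⟩ := h.exists_thickenings hK hseg.isClosed
  filter_upwards [exists_dist_segment_lt (p := p) (a := a) (u := u) hε] with δ hδ
  rw [disjoint_left]
  intro z hz hz'
  obtain ⟨y, hy, hzy⟩ := hδ z hz'
  exact disjoint_left.1 hd (Metric.self_subset_thickening hε _ hz)
    (Metric.mem_thickening_iff.2 ⟨y, hy, hzy⟩)

theorem isArcBetween_rim {p a u : Plane} (hD : det2 a u ≠ 0) {δ : ℝ} (hδ : 0 < δ) :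
    IsArcBetween (frame p a u '' rim δ) (p - δ • u) (p + δ • u) := by
  have inj := frame_injective hD p
  have hpos : 0 < 1 + δ ^ 2 := by positivity
  have b1 := isArcBetween_image_Icc (g := fun s => frame p a u (s, -δ)) hpos
    ((continuous_frame p a u).comp (by fun_prop)).continuousOn
    (fun s _ t _ h => congrArg Prod.fst (inj h))
  have b2 := isArcBetween_image_Icc (g := fun t => frame p a u (1 + δ ^ 2, t))
    (by linarith : -δ < δ)
    ((continuous_frame p a u).comp (by fun_prop)).continuousOn
    (fun s _ t _ h => congrArg Prod.snd (inj h))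
  have b3 := (isArcBetween_image_Icc (g := fun s => frame p a u (s, δ)) hpos
    ((continuous_frame p a u).comp (by fun_prop)).continuousOn
    (fun s _ t _ h => congrArg Prod.fst (inj h))).symm
  have b := (b1.trans b2 (by
    rintro _ ⟨⟨s, hs, rfl⟩, ⟨t, ht, h⟩⟩
    have := inj h
    simp only [Prod.mk.injEq] at this
    simp [this.1])).trans b3 (by
    rintro _ ⟨⟨s, hs, rfl⟩ | ⟨s, hs, rfl⟩, ⟨t, ht, h⟩⟩
    · have := congrArg Prod.snd (inj h)
      simp only at this
      linarith
    · have := congrArg Prod.snd (inj h)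
      simp only at this
      simp [this])
  convert b using 1
  · ext z
    constructor
    · rintro ⟨⟨s, t⟩, (⟨h1, h2, h3⟩ | ⟨h1, h2⟩), rfl⟩
      · rcases (abs_eq hδ.le).1 h1 with h | h
        · right; exact ⟨s, ⟨h2, h3⟩, by simp only at h; simp [h]⟩
        · left; left; exact ⟨s, ⟨h2, h3⟩, by simp only at h; simp [h]⟩
      · left; right; exact ⟨t, abs_le.1 h2, by simp only at h1; simp [h1]⟩
    · rintro ((⟨s, hs, rfl⟩ | ⟨s, hs, rfl⟩) | ⟨s, hs, rfl⟩)
      · exact ⟨_, Or.inl ⟨by simp [abs_of_pos hδ], hs.1, hs.2⟩, rfl⟩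
      · exact ⟨(1 + δ ^ 2, s), Or.inr ⟨rfl, abs_le.2 hs⟩, rfl⟩
      · exact ⟨_, Or.inl ⟨by simp [abs_of_pos hδ], hs.1, hs.2⟩, rfl⟩
  · simp [frame, sub_eq_add_neg]
  · simp [frame]

theorem straightAt_of_coord {K : Set Plane} {p a u : Plane} (hD : det2 a u ≠ 0) {x : ℝ × ℝ}
    {v : ℝ × ℝ} (h : ∀ᶠ y in 𝓝 x, (frame p a u y ∈ K ↔ ∃ τ : ℝ, y = x + τ • v)) :
    StraightAt K (frame p a u x) (v.1 • a + v.2 • u) := by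
  have ht : Tendsto (coord p a u) (𝓝 (frame p a u x)) (𝓝 x) := by
    have := (continuous_coord p a u).tendsto (frame p a u x)
    rwa [coord_frame hD] at this
  filter_upwards [ht.eventually h] with y hy
  rw [frame_coord hD] at hy
  rw [hy]
  have key : ∀ τ : ℝ, frame p a u x + τ • (v.1 • a + v.2 • u) = frame p a u (x + τ • v) := by
    intro τ
    simp only [frame, Prod.fst_add, Prod.snd_add, Prod.smul_fst, Prod.smul_snd, smul_eq_mul]
    module
  constructor
  · rintro ⟨τ, h⟩
    refine ⟨τ, ?_⟩
    rw [key, ← h, frame_coord hD]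
  · rintro ⟨τ, h⟩
    refine ⟨τ, ?_⟩
    rw [h, key, coord_frame hD]

theorem straightAt_rim_right {p a u : Plane} (hD : det2 a u ≠ 0) {δ t : ℝ} (ht : |t| < δ) :
    StraightAt (frame p a u '' rim δ) (frame p a u (1 + δ ^ 2, t)) u := by
  have := straightAt_of_coord (p := p) (K := frame p a u '' rim δ) hD (x := (1 + δ ^ 2, t)) (v := (0, 1)) ?_
  · simpa using this
  have h1 : ∀ᶠ y : ℝ × ℝ in 𝓝 (1 + δ ^ 2, t), |y.2| < δ :=
    (by fun_prop : Continuous fun y : ℝ × ℝ => |y.2|).tendsto _ |>.eventually (gt_mem_nhds ht)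
  filter_upwards [h1] with y hy
  rw [(frame_injective hD p).mem_set_image]
  constructor
  · rintro (⟨h, -⟩ | ⟨h, -⟩)
    · exact absurd h hy.ne
    · exact ⟨y.2 - t, by ext <;> simp [h]⟩
  · rintro ⟨τ, rfl⟩
    exact Or.inr ⟨by simp, hy.le⟩

theorem straightAt_rim_side {p a u : Plane} (hD : det2 a u ≠ 0) {δ s t : ℝ} (hδ : 0 < δ)
    (ht : |t| = δ) (h0 : 0 < s) (h1 : s < 1 + δ ^ 2) :
    StraightAt (frame p a u '' rim δ) (frame p a u (s, t)) a := by
  have := straightAt_of_coord (p := p) (K := frame p a u '' rim δ) hD (x := (s, t)) (v := (1, 0)) ?_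
  · simpa using this
  have e1 : ∀ᶠ y : ℝ × ℝ in 𝓝 (s, t), y.1 < 1 + δ ^ 2 :=
    continuous_fst.tendsto (s, t) |>.eventually (gt_mem_nhds h1)
  have e2 : ∀ᶠ y : ℝ × ℝ in 𝓝 (s, t), 0 < y.1 :=
    continuous_fst.tendsto (s, t) |>.eventually (lt_mem_nhds h0)
  have e3 : ∀ᶠ y : ℝ × ℝ in 𝓝 (s, t), |y.2 - t| < δ := by
    have : Tendsto (fun y : ℝ × ℝ => |y.2 - t|) (𝓝 (s, t)) (𝓝 |t - t|) :=
      (by fun_prop : Continuous fun y : ℝ × ℝ => |y.2 - t|).tendsto _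
    rw [sub_self, abs_zero] at this
    exact this.eventually (gt_mem_nhds hδ)
  filter_upwards [e1, e2, e3] with y hy1 hy2 hy3
  rw [(frame_injective hD p).mem_set_image]
  constructor
  · rintro (⟨h, -⟩ | ⟨h, -⟩)
    · refine ⟨y.1 - s, ?_⟩
      have : y.2 = t := by
        have h3 := abs_lt.1 hy3
        rcases (abs_eq hδ.le).1 h with h | h <;> rcases (abs_eq hδ.le).1 ht with h' | h' <;>
          linarith
      ext <;> simp [this]
    · exact absurd h hy1.ne
  · rintro ⟨τ, rfl⟩
    exact Or.inl ⟨by simpa using ht, hy2.le, hy1.le⟩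

theorem eventually_mul_lt (c : ℝ) {ε : ℝ} (hε : 0 < ε) : ∀ᶠ δ in 𝓝[>] (0 : ℝ), δ * c < ε := by
  have : Tendsto (fun δ : ℝ => δ * c) (𝓝[>] 0) (𝓝 0) := by
    have : Continuous (fun δ : ℝ => δ * c) := by fun_prop
    simpa using (this.tendsto 0).mono_left nhdsWithin_le_nhds
  exact this.eventually (gt_mem_nhds hε)

theorem sub_smul_eq_frame (p a u : Plane) (δ : ℝ) : p - δ • u = frame p a u (0, -δ) := by
  simp [frame, sub_eq_add_neg]

theorem add_smul_eq_frame (p a u : Plane) (δ : ℝ) : p + δ • u = frame p a u (0, δ) := by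
  simp [frame]

/-- The rectangle is `δ` wide to each side but overshoots the end `p + a` only by `δ ^ 2`. So for
small `δ` a segment leaving `p + a` with a forward component (`0 < α`) exits through the short side,
at parameter `δ ^ 2 / α`, and any other one through a long side, at `δ / |β|`. Either way it avoids
the corners. The only excluded directions are zero and straight back along the segment. -/
theorem eventually_rim_inter_segment {p a u y : Plane} (hD : det2 a u ≠ 0) {α β : ℝ}
    (hy : y = p + a + (α • a + β • u)) (hαβ : β ≠ 0 ∨ 0 < α) {ε : ℝ} (hε : 0 < ε) :
    ∀ᶠ δ in 𝓝[>] (0 : ℝ), ∃ z, frame p a u '' rim δ ∩ segment ℝ (p + a) y = {z} ∧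
      dist z (p + a) < ε ∧ (∃ v, det2 v (y - (p + a)) ≠ 0 ∧ StraightAt (frame p a u '' rim δ) z v) ∧
      z ≠ p - δ • u ∧ z ≠ p + δ • u := by
  have inj := frame_injective hD p
  have hseg : ∀ τ : ℝ, p + a + τ • (y - (p + a)) = frame p a u (1 + τ * α, τ * β) := by
    intro τ; rw [hy]; simp only [frame]; module
  have hdist : ∀ τ : ℝ, 0 ≤ τ → dist (frame p a u (1 + τ * α, τ * β)) (p + a) =
      τ * ‖y - (p + a)‖ := by
    intro τ hτ
    rw [← hseg, dist_eq_norm, add_sub_cancel_left, norm_smul, Real.norm_of_nonneg hτ]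
  have hyv : y - (p + a) = α • a + β • u := by rw [hy]; simp
  rcases lt_or_ge 0 α with hα | hα
  · filter_upwards [self_mem_nhdsWithin, eventually_mul_lt |β| hα,
      eventually_mul_lt (‖y - (p + a)‖ / α) hε, eventually_mul_lt (1 / α) one_pos,
      eventually_mul_lt 1 one_pos] with δ hδ h1 h2 h3 h4
    rw [mem_Ioi] at hδ
    have hτ : 0 < δ ^ 2 / α := by positivity
    have e1 : 1 + δ ^ 2 / α * α = 1 + δ ^ 2 := by field_simp
    have e2 : |δ ^ 2 / α * β| < δ := by
      rw [abs_mul, abs_of_pos hτ, div_mul_eq_mul_div, div_lt_iff₀ hα]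
      nlinarith
    refine ⟨frame p a u (1 + δ ^ 2 / α * α, δ ^ 2 / α * β), ?_, ?_, ⟨u, ?_, ?_⟩, ?_, ?_⟩
    · rw [segment_eq_image']
      ext z
      constructor
      · rintro ⟨⟨x, hx, rfl⟩, ⟨τ, ⟨h0, -⟩, h⟩⟩
        simp only at h
        rw [hseg] at h
        have := inj h
        subst this
        have : τ = δ ^ 2 / α := by
          rcases hx with ⟨g1, -, g2⟩ | ⟨g1, -⟩
          · exfalso
            simp only at g1 g2
            have : τ ≤ δ ^ 2 / α := by rw [le_div_iff₀ hα]; linarith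
            have : |τ * β| ≤ |δ ^ 2 / α * β| := by
              rw [abs_mul, abs_mul, abs_of_nonneg h0, abs_of_pos hτ]; gcongr
            linarith
          · simp only at g1
            rw [eq_div_iff hα.ne']; linarith
        rw [this]; rfl
      · rintro rfl
        refine ⟨⟨_, Or.inr ⟨e1, e2.le⟩, rfl⟩, ⟨δ ^ 2 / α, ⟨hτ.le, ?_⟩, hseg _⟩⟩
        rw [mul_one_div] at h3
        have : δ ^ 2 / α = δ * (δ / α) := by ring
        rw [this]
        nlinarith [div_pos hδ hα]
    · rw [hdist _ hτ.le]
      have : δ ^ 2 / α * ‖y - (p + a)‖ = δ * (δ * (‖y - (p + a)‖ / α)) := by ring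
      rw [this]
      have : 0 ≤ δ * (‖y - (p + a)‖ / α) := by positivity
      nlinarith
    · rw [hyv]
      have : det2 u (α • a + β • u) = - (α * det2 a u) := by unfold det2; simp; ring
      rw [this]
      exact neg_ne_zero.2 (mul_ne_zero hα.ne' hD)
    · rw [e1]; exact straightAt_rim_right hD e2
    · rw [sub_smul_eq_frame p a u]
      intro h
      have := congrArg Prod.fst (inj h)
      simp only [e1] at this
      nlinarith
    · rw [add_smul_eq_frame p a u]
      intro h
      have := congrArg Prod.fst (inj h)
      simp only [e1] at this
      nlinarith
  · have hβ : β ≠ 0 := hαβ.resolve_right (not_lt.2 hα)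
    have hβ' : 0 < |β| := abs_pos.2 hβ
    filter_upwards [self_mem_nhdsWithin, eventually_mul_lt (|α| / |β|) one_pos,
      eventually_mul_lt (‖y - (p + a)‖ / |β|) hε, eventually_mul_lt (1 / |β|) one_pos]
      with δ hδ h1 h2 h3
    rw [mem_Ioi] at hδ
    have hτ : 0 < δ / |β| := by positivity
    have e2 : |δ / |β| * β| = δ := by
      rw [abs_mul, abs_of_pos hτ]; field_simp
    have e1 : 0 < 1 + δ / |β| * α := by
      have : δ / |β| * α = - (δ * (|α| / |β|)) := by rw [abs_of_nonpos hα]; ring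
      linarith
    have e3 : 1 + δ / |β| * α < 1 + δ ^ 2 := by
      have : δ / |β| * α ≤ 0 := mul_nonpos_of_nonneg_of_nonpos hτ.le hα
      have : 0 < δ ^ 2 := by positivity
      linarith
    refine ⟨frame p a u (1 + δ / |β| * α, δ / |β| * β), ?_, ?_, ⟨a, ?_, ?_⟩, ?_, ?_⟩
    · rw [segment_eq_image']
      ext z
      constructor
      · rintro ⟨⟨x, hx, rfl⟩, ⟨τ, ⟨h0, -⟩, h⟩⟩
        simp only at h
        rw [hseg] at h
        have := inj h
        subst this
        have : τ = δ / |β| := by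
          rcases hx with ⟨g1, -, g2⟩ | ⟨g1, -⟩
          · simp only at g1
            rw [abs_mul, abs_of_nonneg h0] at g1
            rw [eq_div_iff hβ'.ne']; exact g1
          · exfalso
            simp only at g1
            have : τ * α ≤ 0 := mul_nonpos_of_nonneg_of_nonpos h0 hα
            have : 0 < δ ^ 2 := by positivity
            linarith
        rw [this]; rfl
      · rintro rfl
        refine ⟨⟨_, Or.inl ⟨e2, e1.le, e3.le⟩, rfl⟩, ⟨δ / |β|, ⟨hτ.le, ?_⟩, hseg _⟩⟩
        rw [mul_one_div] at h3
        exact h3.le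
    · rw [hdist _ hτ.le]
      have : δ / |β| * ‖y - (p + a)‖ = δ * (‖y - (p + a)‖ / |β|) := by ring
      rwa [this]
    · rw [hyv]
      have : det2 a (α • a + β • u) = β * det2 a u := by unfold det2; simp; ring
      rw [this]
      exact mul_ne_zero hβ hD
    · exact straightAt_rim_side hD hδ e2 e1 e3
    · rw [sub_smul_eq_frame p a u]
      intro h
      have := congrArg Prod.fst (inj h)
      simp only at this
      linarith
    · rw [add_smul_eq_frame p a u]
      intro h
      have := congrArg Prod.fst (inj h)
      simp only at this
      linarith

/-- Near each crossing `B` is a straight line transversal to the segment, so it passes through each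
long side of a thin enough rectangle once, at `q δ z` and `q (-δ) z`. This is the source of the
factor 2. -/
theorem eventually_rim_inter_crossing {p a u : Plane} (hD : det2 a u ≠ 0) {B : Set Plane}
    (hB : IsCompact B) (hp : p ∉ B) (hw : p + a ∉ B) (hfin : (B ∩ segment ℝ p (p + a)).Finite)
    (hcr : ∀ z ∈ B ∩ segment ℝ p (p + a), ∃ v, det2 v a ≠ 0 ∧ StraightAt B z v) :
    ∀ᶠ δ in 𝓝[>] (0 : ℝ), (B ∩ frame p a u '' rim δ).Finite ∧
      (B ∩ frame p a u '' rim δ).ncard ≤ 2 * (B ∩ segment ℝ p (p + a)).ncard ∧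
      ((B ∩ segment ℝ p (p + a)).Nonempty → (B ∩ frame p a u '' rim δ).Nonempty) := by
  set Z := B ∩ segment ℝ p (p + a) with hZ
  have inj := frame_injective hD p
  have H : ∀ z ∈ Z, ∃ s α β : ℝ, 0 < s ∧ s < 1 ∧ β ≠ 0 ∧ z = frame p a u (s, 0) ∧
      StraightAt B z (α • a + β • u) := by
    intro z hz
    obtain ⟨s, hs, rfl⟩ := (mem_segment_iff_frame (u := u)).1 hz.2
    obtain ⟨v, hv, hst⟩ := hcr _ hz
    have hv0 : v = (coord 0 a u v).1 • a + (coord 0 a u v).2 • u := by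
      conv_lhs => rw [← frame_coord hD 0 v]
      simp [frame]
    refine ⟨s, (coord 0 a u v).1, (coord 0 a u v).2, ?_, ?_, ?_, rfl, by rwa [← hv0]⟩
    · refine hs.1.lt_of_ne ?_
      rintro rfl
      exact hp (by simpa [frame] using hz.1)
    · refine hs.2.lt_of_ne ?_
      rintro rfl
      exact hw (by simpa [frame] using hz.1)
    · intro h0
      rw [hv0, h0] at hv
      apply hv
      unfold det2; simp; ring
  choose! s α β hs0 hs1 hβ hzf hst using H
  have hN : ∀ z ∈ Z, ∃ N : Set Plane, IsOpen N ∧ z ∈ N ∧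
      ∀ y ∈ N, (y ∈ B ↔ ∃ τ : ℝ, y = z + τ • (α z • a + β z • u)) := by
    intro z hz
    obtain ⟨N, h1, h2, h3⟩ := eventually_nhds_iff.1 (hst z hz)
    exact ⟨N, h2, h3, h1⟩
  choose! N hNo hzN hNB using hN
  -- The rest of `B` has positive distance from the segment, so it stays outside thin rectangles.
  have hK : IsCompact (B \ ⋃ z ∈ Z, N z) :=
    hB.diff (isOpen_biUnion hNo)
  have hKd : Disjoint (B \ ⋃ z ∈ Z, N z) (segment ℝ p (p + a)) := by
    rw [disjoint_left]
    rintro y ⟨hy1, hy2⟩ hy3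
    exact hy2 (mem_biUnion (show y ∈ Z from ⟨hy1, hy3⟩) (hzN y ⟨hy1, hy3⟩))
  let q : ℝ → Plane → Plane := fun τ z => z + (τ / β z) • (α z • a + β z • u)
  have hq : ∀ τ, ∀ z ∈ Z, q τ z = frame p a u (s z + τ / β z * α z, τ) := by
    intro τ z hz
    have : (τ / β z) * β z = τ := div_mul_cancel₀ _ (hβ z hz)
    calc q τ z = frame p a u (s z, 0) + (τ / β z) • (α z • a + β z • u) := by
          rw [← hzf z hz]
      _ = frame p a u (s z + τ / β z * α z, (τ / β z) * β z) := by
          simp only [frame]; module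
      _ = _ := by rw [this]
  have ev1 : ∀ᶠ δ in 𝓝[>] (0 : ℝ), ∀ z ∈ Z, δ * (|α z| / |β z|) < 1 - s z :=
    (eventually_all_finite hfin).2 fun z hz => eventually_mul_lt _ (by linarith [hs1 z hz])
  have ev2 : ∀ᶠ δ in 𝓝[>] (0 : ℝ), ∀ z ∈ Z, δ * (|α z| / |β z|) < s z :=
    (eventually_all_finite hfin).2 fun z hz => eventually_mul_lt _ (hs0 z hz)
  have ev3 : ∀ᶠ δ in 𝓝[>] (0 : ℝ), ∀ z ∈ Z, q δ z ∈ N z := by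
    refine (eventually_all_finite hfin).2 fun z hz => ?_
    have hc : Continuous fun δ => q δ z := by
      simp only [q]; fun_prop
    have := (hc.tendsto 0).mono_left (nhdsWithin_le_nhds (s := Ioi 0))
    simp only [q, zero_div, zero_smul, add_zero] at this
    exact this.eventually ((hNo z hz).mem_nhds (hzN z hz))
  filter_upwards [self_mem_nhdsWithin, ev1, ev2, ev3, eventually_disjoint_box (u := u) hK hKd]
    with δ hδ h1 h2 h3 h4
  rw [mem_Ioi] at hδ
  have habs : ∀ τ : ℝ, |τ| ≤ δ → ∀ z ∈ Z, |τ / β z * α z| ≤ δ * (|α z| / |β z|) := by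
    intro τ hτ z hz
    rw [abs_mul, abs_div, div_mul_eq_mul_div, mul_div_assoc]
    gcongr
  have hsub : B ∩ frame p a u '' rim δ ⊆ q δ '' Z ∪ q (-δ) '' Z := by
    rintro _ ⟨hyB, x, hx, rfl⟩
    have : ∃ z ∈ Z, frame p a u x ∈ N z := by
      by_contra hcon
      push Not at hcon
      refine disjoint_left.1 h4 ⟨hyB, ?_⟩ ⟨x, rim_subset_box hx, rfl⟩
      simpa using hcon
    obtain ⟨z, hz, hyN⟩ := this
    obtain ⟨τ, hτ⟩ := (hNB z hz _ hyN).1 hyB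
    have e : z + τ • (α z • a + β z • u) = q (τ * β z) z := by
      simp only [q]; rw [mul_div_cancel_right₀ _ (hβ z hz)]
    rw [e] at hτ
    have hx' := hτ
    rw [hq _ z hz] at hx'
    have hx2 := inj hx'
    rcases hx with ⟨g, -, -⟩ | ⟨g, g'⟩
    · rw [hx2] at g
      rcases (abs_eq hδ.le).1 g with g | g <;> simp only at g
      · left; exact ⟨z, hz, by rw [hτ, g]⟩
      · right; exact ⟨z, hz, by rw [hτ, g]⟩
    -- The short side lies beyond the segment, while `B` near `z` stays within `δ * (|α z| / |β z|)
    -- < 1 - s z` of `z` in the first coordinate.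
    · exfalso
      rw [hx2] at g g'
      simp only at g g'
      have := (abs_le.1 (habs _ g' z hz)).2
      have := h1 z hz
      nlinarith
  have hf1 := hfin.image (q δ)
  have hf2 := hfin.image (q (-δ))
  refine ⟨(hf1.union hf2).subset hsub, ?_, ?_⟩
  · calc _ ≤ (q δ '' Z ∪ q (-δ) '' Z).ncard := ncard_le_ncard hsub (hf1.union hf2)
      _ ≤ (q δ '' Z).ncard + (q (-δ) '' Z).ncard := ncard_union_le _ _
      _ ≤ Z.ncard + Z.ncard := add_le_add (ncard_image_le hfin) (ncard_image_le hfin)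
      _ = 2 * Z.ncard := (two_mul _).symm
  · rintro ⟨z, hz⟩
    refine ⟨q δ z, (hNB z hz _ (h3 z hz)).2 ⟨_, rfl⟩, ?_⟩
    rw [hq _ z hz]
    have g := abs_le.1 (habs δ (abs_of_pos hδ).le z hz)
    refine ⟨_, Or.inl ⟨abs_of_pos hδ, ?_, ?_⟩, rfl⟩
    · linarith [h2 z hz, g.1]
    · simp only
      nlinarith [h1 z hz, g.2]

/-! ### Straight plane graphs and the contours of their subtrees. -/

/-- A graph on points of the plane is straight if the segments of distinct edges meet only in
common ends. -/
structure IsStraight (Γ : SimpleGraph Plane) : Prop where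
  finite_edgeSet : Γ.edgeSet.Finite
  inter : ∀ ⦃x y x' y' : Plane⦄, Γ.Adj x y → Γ.Adj x' y' → s(x, y) ≠ s(x', y') →
    ∀ z ∈ segment ℝ x y, z ∈ segment ℝ x' y' → (z = x ∨ z = y) ∧ (z = x' ∨ z = y')

/-- The segment joining an unordered pair of points. -/
def edgeSegment : Sym2 Plane → Set Plane := Sym2.lift ⟨segment ℝ, segment_symm ℝ⟩

@[simp] theorem edgeSegment_mk (x y : Plane) : edgeSegment s(x, y) = segment ℝ x y := rfl

/-- `B` avoids the vertices of `Γ` and crosses every edge finitely often, and straight. -/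
structure Transverse (Γ : SimpleGraph Plane) (B : Set Plane) : Prop where
  isCompact : IsCompact B
  notMem : ∀ ⦃x y⦄, Γ.Adj x y → x ∉ B
  finite : ∀ ⦃x y⦄, Γ.Adj x y → (B ∩ segment ℝ x y).Finite
  straight : ∀ ⦃x y⦄, Γ.Adj x y → ∀ z ∈ B ∩ segment ℝ x y,
    ∃ v, det2 v (y - x) ≠ 0 ∧ StraightAt B z v

/-- `T` is the edge set of a subtree with vertex set `S`. -/
inductive Grows {α : Type*} [DecidableEq α] (G : SimpleGraph α) : Finset α → Finset (Sym2 α) → Prop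
  | single (w : α) : Grows G {w} ∅
  | step {S : Finset α} {T : Finset (Sym2 α)} {v w : α} : Grows G S T → v ∈ S → w ∉ S →
      G.Adj v w → Grows G (insert w S) (insert s(v, w) T)

theorem Grows.mem_of_mem {α : Type*} [DecidableEq α] {G : SimpleGraph α} {S : Finset α} {T : Finset (Sym2 α)}
    (h : Grows G S T) : ∀ ⦃x y⦄, s(x, y) ∈ T → x ∈ S := by
  induction h with
  | single w => simp
  | step h hv hw ha ih =>
    intro x y hxy
    rcases Finset.mem_insert.1 hxy with h | h
    · rcases Sym2.eq_iff.1 h with ⟨rfl, rfl⟩ | ⟨rfl, rfl⟩ <;> simp [hv]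
    · exact Finset.mem_insert.2 (Or.inr (ih h))

theorem Grows.adj {α : Type*} [DecidableEq α] {G : SimpleGraph α} {S : Finset α} {T : Finset (Sym2 α)}
    (h : Grows G S T) : ∀ ⦃x y⦄, s(x, y) ∈ T → G.Adj x y := by
  induction h with
  | single w => simp
  | step h hv hw ha ih =>
    intro x y hxy
    rcases Finset.mem_insert.1 hxy with h | h
    · rcases Sym2.eq_iff.1 h with ⟨rfl, rfl⟩ | ⟨rfl, rfl⟩
      exacts [ha, ha.symm]
    · exact ih h

/-- `A` runs around the tree with vertex set `S` and edge set `T`: it avoids the tree, and it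
crosses every other edge once near each of its ends in `S`, and nowhere else. -/
structure IsContour (Γ : SimpleGraph Plane) (S : Finset Plane) (T : Finset (Sym2 Plane)) (ε : ℝ)
    (A : Set Plane) : Prop where
  isLine : IsLine A
  notMem : ∀ ⦃x y⦄, Γ.Adj x y → x ∉ A
  edge : ∀ ⦃x y⦄, Γ.Adj x y → s(x, y) ∈ T → ∀ z ∈ segment ℝ x y, z ∉ A
  far : ∀ ⦃x y⦄, Γ.Adj x y → s(x, y) ∉ T → ∀ z ∈ A ∩ segment ℝ x y,
    (x ∈ S ∧ dist z x < ε) ∨ (y ∈ S ∧ dist z y < ε)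
  near : ∀ ⦃x y⦄, Γ.Adj x y → s(x, y) ∉ T → x ∈ S →
    ∃ z, A ∩ segment ℝ x y ∩ Metric.ball x ε = {z} ∧ ∃ v, det2 v (y - x) ≠ 0 ∧ StraightAt A z v

/-- The way in which a contour of the tree with edge set `T` meets the curves `B`. -/
structure Meets {ι : Type*} (Γ : SimpleGraph Plane) (T : Finset (Sym2 Plane)) (s : Finset ι)
    (B : ι → Set Plane) (A : Set Plane) : Prop where
  finite : ∀ i ∈ s, (A ∩ B i).Finite
  ncard_le : ∀ i ∈ s, (A ∩ B i).ncard ≤ 2 * ∑ e ∈ T, (B i ∩ edgeSegment e).ncard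
  nonempty : ∀ i ∈ s, ∀ e ∈ T, (B i ∩ edgeSegment e).Nonempty → (A ∩ B i).Nonempty
  edge : ∀ i ∈ s, ∀ ⦃x y⦄, Γ.Adj x y → Disjoint A (B i ∩ segment ℝ x y)
  triple : ∀ i ∈ s, ∀ j ∈ s, i ≠ j → Disjoint A (B i ∩ B j)

theorem IsLine.isCompact {A : Set Plane} (h : IsLine A) : IsCompact A := by
  obtain ⟨p, q, h⟩ := h
  exact IsArcBetween.isCompact h

theorem isCompact_segment (x y : Plane) : IsCompact (segment ℝ x y) := by
  rw [segment_eq_image_lineMap]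
  exact isCompact_Icc.image AffineMap.lineMap_continuous

/-- This allows a finished contour to serve as one of the given curves `B i` when the next contour
is drawn. -/
theorem IsContour.transverse {Γ : SimpleGraph Plane} {S : Finset Plane} {T : Finset (Sym2 Plane)}
    {ε : ℝ} {A : Set Plane} (h : IsContour Γ S T ε A) : Transverse Γ A := by
  have key : ∀ ⦃x y⦄, Γ.Adj x y → s(x, y) ∉ T → ∀ z ∈ A ∩ segment ℝ x y, x ∈ S → dist z x < ε →
      ∃ v, det2 v (y - x) ≠ 0 ∧ StraightAt A z v := by
    intro x y hxy hT z hz hx hd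
    obtain ⟨z', hz', hv⟩ := h.near hxy hT hx
    have : z ∈ ({z'} : Set Plane) := hz' ▸ ⟨hz, hd⟩
    rw [mem_singleton_iff] at this
    rwa [this]
  refine ⟨h.isLine.isCompact, h.notMem, ?_, ?_⟩
  · intro x y hxy
    by_cases hT : s(x, y) ∈ T
    · convert finite_empty
      ext z
      simp only [mem_inter_iff, mem_empty_iff_false, iff_false, not_and]
      exact fun hz hz' => h.edge hxy hT z hz' hz
    · have hxf : (A ∩ segment ℝ x y ∩ {z | x ∈ S ∧ dist z x < ε}).Finite := by
        by_cases hx : x ∈ S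
        · obtain ⟨z, hz, -⟩ := h.near hxy hT hx
          refine (finite_singleton z).subset (hz ▸ ?_)
          exact fun y hy => ⟨hy.1, hy.2.2⟩
        · simp [hx]
      have hyf : (A ∩ segment ℝ x y ∩ {z | y ∈ S ∧ dist z y < ε}).Finite := by
        by_cases hy : y ∈ S
        · obtain ⟨z, hz, -⟩ := h.near hxy.symm (by rwa [Sym2.eq_swap]) hy
          refine (finite_singleton z).subset (hz ▸ ?_)
          rw [segment_symm]
          exact fun y hy => ⟨hy.1, hy.2.2⟩
        · simp [hy]
      refine (hxf.union hyf).subset fun z hz => ?_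
      rcases h.far hxy hT z hz with h | h
      · exact Or.inl ⟨hz, h⟩
      · exact Or.inr ⟨hz, h⟩
  · intro x y hxy z hz
    have hT : s(x, y) ∉ T := fun hT => h.edge hxy hT z hz.2 hz.1
    rcases h.far hxy hT z hz with ⟨h1, h2⟩ | ⟨h1, h2⟩
    · exact key hxy hT z hz h1 h2
    · obtain ⟨v, hv, hs⟩ := key hxy.symm (by rwa [Sym2.eq_swap]) z (by rwa [segment_symm]) h1 h2
      refine ⟨v, ?_, hs⟩
      have : det2 v (x - y) = - det2 v (y - x) := by unfold det2; simp; ring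
      rw [this] at hv
      exact fun h => hv (by simp [h])

theorem IsContour.ncard_le {Γ : SimpleGraph Plane} {S : Finset Plane} {T : Finset (Sym2 Plane)}
    {ε : ℝ} {A : Set Plane} (h : IsContour Γ S T ε A) ⦃x y : Plane⦄ (hxy : Γ.Adj x y)
    (hT : s(x, y) ∉ T) : (A ∩ segment ℝ x y).ncard ≤
      ({x} ∩ S : Set Plane).ncard + ({y} ∩ S : Set Plane).ncard := by
  have key : ∀ ⦃x y⦄, Γ.Adj x y → s(x, y) ∉ T →
      (A ∩ segment ℝ x y ∩ {z | x ∈ S ∧ dist z x < ε}).ncard ≤ ({x} ∩ S : Set Plane).ncard := by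
    intro x y hxy hT
    by_cases hx : x ∈ S
    · obtain ⟨z, hz, -⟩ := h.near hxy hT hx
      have : ({x} ∩ S : Set Plane) = {x} := by simpa using hx
      rw [this, ncard_singleton, ← ncard_singleton z, ← hz]
      refine ncard_le_ncard (fun y hy => ⟨hy.1, hy.2.2⟩) (by rw [hz]; simp)
    · simp [hx]
  have h1 := key hxy hT
  have h2 := key hxy.symm (by rwa [Sym2.eq_swap])
  rw [segment_symm] at h2
  refine le_trans ?_ (add_le_add h1 h2)
  refine le_trans (ncard_le_ncard ?_ ?_) (ncard_union_le _ _)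
  · intro z hz
    rcases h.far hxy hT z hz with h | h
    · exact Or.inl ⟨hz, h⟩
    · exact Or.inr ⟨hz, h⟩
  · have := h.transverse.finite hxy
    exact (this.subset inter_subset_left).union (this.subset inter_subset_left)

theorem IsStraight.finite_support {Γ : SimpleGraph Plane} (h : IsStraight Γ) :
    Γ.support.Finite := by
  have : Γ.support ⊆ ⋃ e ∈ Γ.edgeSet, {x | x ∈ e} := by
    rintro x ⟨y, hxy⟩
    exact mem_biUnion (show s(x, y) ∈ Γ.edgeSet from hxy) (by simp)
  refine (h.finite_edgeSet.biUnion fun e _ => ?_).subset this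
  induction e with
  | h x y =>
    refine (toFinite {x, y}).subset fun z hz => ?_
    simpa using hz

/-- A property that holds eventually for every edge holds eventually for all edges. -/
theorem IsStraight.eventually_all {Γ : SimpleGraph Plane} (h : IsStraight Γ) {l : Filter ℝ}
    {P : Plane → Plane → ℝ → Prop} (hP : ∀ x y, Γ.Adj x y → ∀ᶠ δ in l, P x y δ) :
    ∀ᶠ δ in l, ∀ x y, Γ.Adj x y → P x y δ := by
  have hf : {q : Plane × Plane | Γ.Adj q.1 q.2}.Finite := by
    refine (h.finite_support.prod h.finite_support).subset ?_
    rintro ⟨x, y⟩ hxy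
    exact ⟨⟨y, hxy⟩, ⟨x, hxy.symm⟩⟩
  have := (Filter.eventually_all_finite (l := l) (p := fun q δ => P q.1 q.2 δ) hf).2
    (fun q hq => hP q.1 q.2 hq)
  filter_upwards [this] with δ hδ x y hxy
  exact hδ (x, y) hxy

theorem isCompact_box_image (p a u : Plane) (δ : ℝ) : IsCompact (frame p a u '' box δ) := by
  have : box δ = Icc 0 (1 + δ ^ 2) ×ˢ Icc (-δ) δ := by
    ext x
    rw [mem_prod]
    simp only [box, mem_ofPred_eq, abs_le, mem_Icc, and_assoc]
  rw [this]
  exact (isCompact_Icc.prod isCompact_Icc).image (continuous_frame p a u)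

theorem StraightAt.congr {K K' : Set Plane} {z v : Plane} {F : Set Plane} (h : StraightAt K z v)
    (hF : IsClosed F) (hz : z ∉ F) (hK : ∀ y ∉ F, y ∈ K ↔ y ∈ K') : StraightAt K' z v := by
  filter_upwards [h, hF.isOpen_compl.mem_nhds hz] with y hy hy'
  rw [← hK y hy', hy]

/-- Extending a contour along a new leaf edge. -/
theorem IsContour.exists_step {ι : Type*} {Γ : SimpleGraph Plane} (hΓ : IsStraight Γ)
    {s : Finset ι} {B : ι → Set Plane} (hB : ∀ i ∈ s, Transverse Γ (B i))
    (hBB : ∀ i ∈ s, ∀ j ∈ s, i ≠ j → ∀ x y, Γ.Adj x y → Disjoint (B i ∩ B j) (segment ℝ x y))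
    {ε : ℝ} (hε : 0 < ε) (hε2 : ∀ x y, Γ.Adj x y → 2 * ε ≤ dist x y)
    (hεB : ∀ i ∈ s, ∀ x y, Γ.Adj x y → ∀ z ∈ B i ∩ segment ℝ x y, ε ≤ dist z x)
    {S S' : Finset Plane} {T T' : Finset (Sym2 Plane)} {A : Set Plane} (hA : IsContour Γ S T ε A)
    (hM : Meets Γ T s B A) (hTS : ∀ ⦃x y⦄, s(x, y) ∈ T → x ∈ S) {v w : Plane} (hv : v ∈ S)
    (hw : w ∉ S) (hvw : Γ.Adj v w) (hS' : ∀ x, x ∈ S' ↔ x = w ∨ x ∈ S)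
    (hT' : ∀ e, e ∈ T' ↔ e = s(v, w) ∨ e ∈ T)
    (hsum : ∀ f : Sym2 Plane → ℕ, ∑ e ∈ T', f e = f s(v, w) + ∑ e ∈ T, f e) :
    ∃ A', IsContour Γ S' T' ε A' ∧ Meets Γ T' s B A' := by
  have hvwT : s(v, w) ∉ T := fun h => hw (hTS (Sym2.eq_swap ▸ h))
  obtain ⟨p, hp, u, hdet, hst⟩ := hA.near hvw hvwT hv
  -- A crossing must be near an end in `S`, and `w` is not in `S`.
  have hpA : A ∩ segment ℝ v w = {p} := by
    rw [← hp]
    refine Subset.antisymm (fun z hz => ⟨hz, ?_⟩) inter_subset_left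
    rcases hA.far hvw hvwT z hz with h | h
    · exact h.2
    · exact absurd h.1 hw
  have hpm : p ∈ A ∩ segment ℝ v w ∩ Metric.ball v ε := by rw [hp]; rfl
  have hpd : dist p v < ε := hpm.2
  have hpv : p ≠ v := fun h => hA.notMem hvw (h ▸ hpm.1.1)
  have hpw : p ≠ w := fun h => hA.notMem hvw.symm (h ▸ hpm.1.1)
  have hvw' : v ≠ w := hvw.ne
  -- The rectangle is placed in the frame with origin `p`, first axis `a` from `p` to the new
  -- vertex, and second axis the direction `u` of `A` at `p`. The piece of `A` to be removed is then
  -- its open left side.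
  obtain ⟨a, rfl⟩ : ∃ a, w = p + a := ⟨w - p, by simp⟩
  obtain ⟨τ₀, ⟨hτ0, hτ1⟩, hpτ⟩ : ∃ τ ∈ Icc (0 : ℝ) 1, v + τ • (p + a - v) = p := by
    have := hpm.1.2
    rwa [segment_eq_image'] at this
  have hτ1' : τ₀ < 1 := by
    refine hτ1.lt_of_ne ?_
    rintro rfl
    exact hpw (by simpa using hpτ.symm)
  have hτ0' : 0 < τ₀ := by
    refine hτ0.lt_of_ne ?_
    rintro rfl
    exact hpv (by simpa using hpτ.symm)
  have ha : a = (1 - τ₀) • (p + a - v) := by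
    have : a = (p + a) - (v + τ₀ • (p + a - v)) := by rw [hpτ]; simp
    conv_lhs => rw [this]
    module
  have hne : (1 - τ₀) ≠ 0 := by linarith
  have hav : p + a - v = (1 - τ₀)⁻¹ • a := by
    conv_rhs => rw [ha]
    rw [smul_smul, inv_mul_cancel₀ hne, one_smul]
  have hD : det2 a u ≠ 0 := by
    intro h
    apply hdet
    rw [hav]
    have : det2 u ((1 - τ₀)⁻¹ • a) = - ((1 - τ₀)⁻¹ * det2 a u) := by unfold det2; simp; ring
    rw [this, h]; simp
  have hu : u ≠ 0 := by
    rintro rfl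
    exact hD (by simp [det2])
  have inj := frame_injective hD p
  have hfr : ∀ τ : ℝ, v + τ • (p + a - v) = frame p a u ((τ - τ₀) / (1 - τ₀), 0) := by
    intro τ
    have : v + τ • (p + a - v) = p + (τ - τ₀) • (p + a - v) := by
      calc _ = (v + τ₀ • (p + a - v)) + (τ - τ₀) • (p + a - v) := by module
        _ = _ := by rw [hpτ]
    rw [this, hav]
    simp only [frame]
    rw [smul_smul, zero_smul, add_zero, div_eq_mul_inv]
  have hsegv : ∀ z ∈ segment ℝ v (p + a), ∃ r : ℝ, r ≤ 1 ∧ z = frame p a u (r, 0) := by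
    rw [segment_eq_image']
    rintro _ ⟨τ, ⟨h0, h1⟩, rfl⟩
    refine ⟨_, ?_, hfr τ⟩
    rw [div_le_one (by linarith)]
    linarith
  have hsub : segment ℝ p (p + a) ⊆ segment ℝ v (p + a) :=
    (convex_segment v (p + a)).segment_subset hpm.1.2 (right_mem_segment ℝ _ _)
  have hvp : v ∉ segment ℝ p (p + a) := by
    intro h
    obtain ⟨r, hr, h⟩ := (mem_segment_iff_frame (u := u)).1 h
    have h0 := hfr 0
    rw [zero_smul, add_zero, h] at h0
    have := congrArg Prod.fst (inj h0)
    simp only at this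
    have h2 : (0 - τ₀) / (1 - τ₀) < 0 := div_neg_of_neg_of_pos (by linarith) (by linarith)
    linarith [hr.1]
  -- edges other than the new one
  have hoth : ∀ x y, Γ.Adj x y → s(x, y) ≠ s(v, p + a) → ∀ z ∈ segment ℝ x y,
      z ∈ segment ℝ p (p + a) → z = p + a ∧ (z = x ∨ z = y) := by
    intro x y hxy hne z hz hz'
    obtain ⟨h1, h2⟩ := hΓ.inter hxy hvw hne z hz (hsub hz')
    rcases h2 with h2 | h2
    · exact absurd (h2 ▸ hz') hvp
    · exact ⟨h2, h1⟩
  -- Everything required of the rectangle holds for all small `δ`; finitely many such conditions are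
  -- collected and one `δ` is chosen.
  have ev1 : ∀ᶠ δ in 𝓝[>] (0 : ℝ), ∀ x y, Γ.Adj x y → x ≠ p + a → y ≠ p + a →
      Disjoint (segment ℝ x y) (frame p a u '' box δ) := by
    refine hΓ.eventually_all fun x y hxy => ?_
    by_cases hc : x ≠ p + a ∧ y ≠ p + a
    · have hd : Disjoint (segment ℝ x y) (segment ℝ p (p + a)) := by
        rw [disjoint_left]
        intro z hz hz'
        obtain ⟨h1, h2⟩ := hoth x y hxy (by
          intro h
          rcases Sym2.eq_iff.1 h with h | h
          · exact hc.2 h.2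
          · exact hc.1 h.1) z hz hz'
        rcases h2 with h2 | h2
        · exact hc.1 (h2 ▸ h1)
        · exact hc.2 (h2 ▸ h1)
      filter_upwards [eventually_disjoint_box (u := u) (isCompact_segment x y) hd] with δ hδ _ _
      exact hδ
    · exact Eventually.of_forall fun δ h1 h2 => absurd ⟨h1, h2⟩ hc
  have ev2 : ∀ᶠ δ in 𝓝[>] (0 : ℝ), ∀ x y, Γ.Adj x y → x ≠ p + a → x ∉ frame p a u '' box δ := by
    refine hΓ.eventually_all fun x y hxy => ?_
    by_cases hc : x = p + a
    · exact Eventually.of_forall fun δ h => absurd hc h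
    · have hd : Disjoint {x} (segment ℝ p (p + a)) := by
        rw [disjoint_singleton_left]
        intro hx
        by_cases h : s(x, y) = s(v, p + a)
        · rcases Sym2.eq_iff.1 h with h | h
          · exact hvp (h.1 ▸ hx)
          · exact hc h.1
        · exact hc (hoth x y hxy h x (left_mem_segment ℝ x y) hx).1
      filter_upwards [eventually_disjoint_box (u := u) isCompact_singleton hd] with δ hδ _
      rwa [disjoint_singleton_left] at hδ
  have ev3 : ∀ᶠ δ in 𝓝[>] (0 : ℝ), ∀ x y, Γ.Adj x y → s(x, y) ≠ s(v, p + a) →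
      Disjoint (A ∩ segment ℝ x y) (frame p a u '' box δ) := by
    refine hΓ.eventually_all fun x y hxy => ?_
    by_cases hc : s(x, y) = s(v, p + a)
    · exact Eventually.of_forall fun δ h => absurd hc h
    · have hd : Disjoint (A ∩ segment ℝ x y) (segment ℝ p (p + a)) := by
        rw [disjoint_left]
        intro z hz hz'
        exact hA.notMem hvw.symm ((hoth x y hxy hc z hz.2 hz').1 ▸ hz.1)
      filter_upwards [eventually_disjoint_box (u := u)
        (hA.isLine.isCompact.inter (isCompact_segment x y)) hd] with δ hδ _
      exact hδ
  obtain ⟨N, hN, hNo, hpN⟩ := eventually_nhds_iff.1 hst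
  have ev4 : ∀ᶠ δ in 𝓝[>] (0 : ℝ), Disjoint (A \ N) (frame p a u '' box δ) := by
    refine eventually_disjoint_box (hA.isLine.isCompact.diff hNo) ?_
    rw [disjoint_left]
    rintro z ⟨hzA, hzN⟩ hz
    have : z ∈ ({p} : Set Plane) := hpA ▸ ⟨hzA, hsub hz⟩
    rw [mem_singleton_iff] at this
    exact hzN (this ▸ hpN)
  have ev5 : ∀ᶠ δ in 𝓝[>] (0 : ℝ), ∀ i ∈ s, ∀ x y, Γ.Adj x y → s(x, y) ≠ s(v, p + a) →
      Disjoint (B i ∩ segment ℝ x y) (frame p a u '' box δ) := by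
    refine (eventually_all_finset s).2 fun i hi => hΓ.eventually_all fun x y hxy => ?_
    by_cases hc : s(x, y) = s(v, p + a)
    · exact Eventually.of_forall fun δ h => absurd hc h
    · have hd : Disjoint (B i ∩ segment ℝ x y) (segment ℝ p (p + a)) := by
        rw [disjoint_left]
        intro z hz hz'
        exact (hB i hi).notMem hvw.symm ((hoth x y hxy hc z hz.2 hz').1 ▸ hz.1)
      filter_upwards [eventually_disjoint_box (u := u)
        ((hB i hi).isCompact.inter (isCompact_segment x y)) hd] with δ hδ _
      exact hδ
  have ev6 : ∀ᶠ δ in 𝓝[>] (0 : ℝ), ∀ i ∈ s, ∀ j ∈ s, i ≠ j →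
      Disjoint (B i ∩ B j) (frame p a u '' box δ) := by
    refine (eventually_all_finset s).2 fun i hi => (eventually_all_finset s).2 fun j hj => ?_
    by_cases hij : i = j
    · exact Eventually.of_forall fun δ h => absurd hij h
    · filter_upwards [eventually_disjoint_box (u := u)
        ((hB i hi).isCompact.inter (hB j hj).isCompact)
        ((hBB i hi j hj hij v (p + a) hvw).mono_right hsub)] with δ hδ _
      exact hδ
  -- `p` is within `ε` of `v`, whereas the curves `B i` meet the edge only at distance at least `ε`.
  -- So cutting `A` near `p` loses none of its points on `B i`.
  have hpB : ∀ i ∈ s, p ∉ B i := fun i hi h =>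
    absurd hpd (not_lt.2 (hεB i hi v (p + a) hvw p ⟨h, hpm.1.2⟩))
  have ev7 : ∀ᶠ δ in 𝓝[>] (0 : ℝ), ∀ i ∈ s, ∀ τ : ℝ, |τ| < δ → p + τ • u ∉ B i := by
    refine (eventually_all_finset s).2 fun i hi => ?_
    have hc : Tendsto (fun τ : ℝ => p + τ • u) (𝓝 0) (𝓝 p) := by
      have : Continuous (fun τ : ℝ => p + τ • u) := by fun_prop
      simpa using this.tendsto 0
    obtain ⟨δ₁, hδ₁, h1⟩ := Metric.eventually_nhds_iff.1
      (hc.eventually ((hB i hi).isCompact.isClosed.isOpen_compl.mem_nhds (hpB i hi)))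
    filter_upwards [mem_nhdsWithin_of_mem_nhds (Iio_mem_nhds hδ₁)] with δ hδ τ hτ
    exact h1 (by rw [Real.dist_eq, sub_zero]; exact hτ.trans hδ)
  have ev8 : ∀ᶠ δ in 𝓝[>] (0 : ℝ), ∀ i ∈ s, (B i ∩ frame p a u '' rim δ).Finite ∧
      (B i ∩ frame p a u '' rim δ).ncard ≤ 2 * (B i ∩ segment ℝ p (p + a)).ncard ∧
      ((B i ∩ segment ℝ p (p + a)).Nonempty → (B i ∩ frame p a u '' rim δ).Nonempty) := by
    refine (eventually_all_finset s).2 fun i hi => ?_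
    refine eventually_rim_inter_crossing hD (hB i hi).isCompact (hpB i hi)
      ((hB i hi).notMem hvw.symm)
      (((hB i hi).finite hvw).subset (inter_subset_inter_right _ hsub)) ?_
    intro z hz
    obtain ⟨d, hd, hs⟩ := (hB i hi).straight hvw z ⟨hz.1, hsub hz.2⟩
    refine ⟨d, fun h => hd ?_, hs⟩
    rw [hav]
    have : det2 d ((1 - τ₀)⁻¹ • a) = (1 - τ₀)⁻¹ * det2 d a := by unfold det2; simp; ring
    rw [this, h, mul_zero]
  have ev9 : ∀ᶠ δ in 𝓝[>] (0 : ℝ), ∀ x y, Γ.Adj x y → x = p + a → y ≠ v →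
      ∃ z, frame p a u '' rim δ ∩ segment ℝ (p + a) y = {z} ∧
      dist z (p + a) < ε ∧
      (∃ d, det2 d (y - (p + a)) ≠ 0 ∧ StraightAt (frame p a u '' rim δ) z d) ∧
      z ≠ p - δ • u ∧ z ≠ p + δ • u := by
    refine hΓ.eventually_all fun x y hxy => ?_
    by_cases hc : x = p + a ∧ y ≠ v
    · obtain ⟨rfl, hyv⟩ := hc
      set q := coord (p + a) a u y with hq
      have hy : y = p + a + (q.1 • a + q.2 • u) := by
        have := frame_coord hD (p + a) y
        rw [← hq, frame] at this
        rw [← add_assoc]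
        exact this.symm
      -- Another edge at the new vertex cannot run straight back over the new edge, since distinct
      -- edges of `Γ` meet only in ends.
      have hq0 : q.2 ≠ 0 ∨ 0 < q.1 := by
        by_contra hcon
        push Not at hcon
        obtain ⟨h2, h1⟩ := hcon
        rw [h2, zero_smul, add_zero] at hy
        have h1' : q.1 < 0 := by
          refine h1.lt_of_ne fun h0 => ?_
          rw [h0, zero_smul, add_zero] at hy
          exact hxy.ne hy.symm
        set m := min 1 (-q.1) with hm
        have hm0 : 0 < m := lt_min one_pos (by linarith)
        have hz1 : p + a + (-m) • a ∈ segment ℝ p (p + a) := by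
          rw [mem_segment_iff_frame (u := u)]
          refine ⟨1 - m, ⟨by linarith [min_le_left 1 (-q.1)], by linarith⟩, ?_⟩
          simp only [frame]; module
        have hz2 : p + a + (-m) • a ∈ segment ℝ (p + a) y := by
          rw [segment_eq_image']
          refine ⟨m / (-q.1), ⟨div_nonneg hm0.le (by linarith), ?_⟩, ?_⟩
          · rw [div_le_one (by linarith)]; exact min_le_right _ _
          · simp only
            rw [hy, add_sub_cancel_left, smul_smul]
            have := h1'.ne
            congr 2
            field_simp
        obtain ⟨h3, h4⟩ := hoth _ _ hxy (by
          intro h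
          rcases Sym2.eq_iff.1 h with h | h
          · exact hvw' h.1.symm
          · exact hyv h.2) _ hz2 hz1
        have : (-m) • a = 0 := by simpa using h3
        rcases smul_eq_zero.1 this with h | h
        · linarith
        · exact hpw (by simp [h])
      filter_upwards [eventually_rim_inter_segment hD hy hq0 hε] with δ hδ _ _
      exact hδ
    · exact Eventually.of_forall fun δ h1 h2 => absurd ⟨h1, h2⟩ hc
  obtain ⟨x₀, y₀, hArc⟩ := hA.isLine
  obtain ⟨δ₀, hδ₀, hrep⟩ := hArc.replace hu hst
  have ev10 : ∀ᶠ δ in 𝓝[>] (0 : ℝ), δ < δ₀ := mem_nhdsWithin_of_mem_nhds (Iio_mem_nhds hδ₀)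
  obtain ⟨δ, hδ, e1, e2, e3, e4, e5, e6, e7, e8, e9, e10⟩ := (eventually_mem_nhdsWithin.and
    (ev1.and (ev2.and (ev3.and (ev4.and (ev5.and (ev6.and (ev7.and (ev8.and
      (ev9.and ev10)))))))))).exists
  rw [mem_Ioi] at hδ
  clear ev1 ev2 ev3 ev4 ev5 ev6 ev7 ev8 ev9 ev10
  set R := frame p a u '' rim δ with hR
  set F := frame p a u '' box δ with hF
  have hRF : R ⊆ F := image_mono rim_subset_box
  set cut : Set Plane := {z | ∃ τ : ℝ, |τ| < δ ∧ z = p + τ • u} with hcut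
  have hcutF : cut ⊆ F := by
    rintro _ ⟨τ, hτ, rfl⟩
    exact ⟨(0, τ), ⟨le_rfl, by positivity, hτ.le⟩, (add_smul_eq_frame p a u τ).symm⟩
  -- Inside the rectangle `A` lies in `N`, where it is the straight line through `p`; this line
  -- meets the rim only at the two corners on the left.
  have hAR : A ∩ R ⊆ {p - δ • u, p + δ • u} := by
    rintro z ⟨hzA, hzR⟩
    have hzN : z ∈ N := by
      by_contra h
      exact disjoint_left.1 e4 ⟨hzA, h⟩ (hRF hzR)
    obtain ⟨τ, rfl⟩ := (hN z hzN).1 hzA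
    obtain ⟨x, hx, hx'⟩ := hzR
    rw [add_smul_eq_frame p a u] at hx'
    have := inj hx'
    subst this
    rcases hx with ⟨h, -, -⟩ | ⟨h, -⟩
    · rcases (abs_eq hδ.le).1 h with h | h <;> simp only at h
      · right; simp [h]
      · left; simp [h, sub_eq_add_neg]
    · simp only at h
      nlinarith
  have hline := hrep δ hδ e10 R (isArcBetween_rim hD hδ) hAR
  have hRvw : ∀ z ∈ segment ℝ v (p + a), z ∉ R := by
    rintro z hz ⟨x, hx, rfl⟩
    obtain ⟨r, hr, h⟩ := hsegv _ hz
    have := inj h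
    subst this
    rcases hx with ⟨h, -, -⟩ | ⟨h, -⟩
    · simp only [abs_zero] at h
      exact hδ.ne h
    · simp only at h
      nlinarith
  have hout : ∀ z ∉ F, z ∈ A ↔ z ∈ A \ cut ∪ R := by
    intro z hz
    constructor
    · exact fun h => Or.inl ⟨h, fun h' => hz (hcutF h')⟩
    · rintro (h | h)
      · exact h.1
      · exact absurd (hRF h) hz
  have hFc : IsClosed F := (isCompact_box_image p a u δ).isClosed
  have hARc : ∀ z ∈ A, z ∉ F → z ∈ A \ cut ∪ R := fun z hz hzF => (hout z hzF).1 hz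
  -- the edges at the new vertex
  have hnew : ∀ y, Γ.Adj (p + a) y → y ≠ v → ∃ z, (A \ cut ∪ R) ∩ segment ℝ (p + a) y =
      insert z (A ∩ segment ℝ (p + a) y) ∧ dist z (p + a) < ε ∧
      ∃ d, det2 d (y - (p + a)) ≠ 0 ∧ StraightAt (A \ cut ∪ R) z d := by
    intro y hy hyv
    obtain ⟨z, hz, hzd, ⟨d, hd, hs⟩, hz1, hz2⟩ := e9 _ y hy rfl hyv
    have hzR : z ∈ R ∩ segment ℝ (p + a) y := by rw [hz]; rfl
    refine ⟨z, ?_, hzd, d, hd, ?_⟩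
    · ext t
      constructor
      · rintro ⟨ht | ht, ht'⟩
        · exact Or.inr ⟨ht.1, ht'⟩
        · left
          have : t ∈ ({z} : Set Plane) := hz ▸ ⟨ht, ht'⟩
          exact this
      · rintro (rfl | ht)
        · exact ⟨Or.inr hzR.1, hzR.2⟩
        · refine ⟨hARc t ht.1 (disjoint_left.1 (e3 _ _ hy ?_) ht), ht.2⟩
          intro h
          rcases Sym2.eq_iff.1 h with h | h
          · exact hvw' h.1.symm
          · exact hyv h.2
    · refine hs.congr hA.isLine.isCompact.isClosed ?_ ?_
      · intro hzA
        rcases hAR ⟨hzA, hzR.1⟩ with h | h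
        · exact hz1 h
        · exact hz2 h
      · intro t ht
        constructor
        · exact fun h => Or.inr h
        · rintro (h | h)
          · exact absurd h.1 ht
          · exact h
  refine ⟨A \ cut ∪ R, ⟨hline, ?_, ?_, ?_, ?_⟩, ⟨?_, ?_, ?_, ?_, ?_⟩⟩
  · intro x y hxy
    by_cases hx : x = p + a
    · rintro (h | h)
      · exact hA.notMem hxy h.1
      · exact hRvw x (hx ▸ right_mem_segment ℝ _ _) h
    · exact fun h => hA.notMem hxy ((hout x (e2 x y hxy hx)).2 h)
  · intro x y hxy hT z hz
    rcases (hT' _).1 hT with h | h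
    · have hz' : z ∈ segment ℝ v (p + a) := by
        rwa [← edgeSegment_mk, h] at hz
      rintro (h | h)
      · have : z ∈ ({p} : Set Plane) := hpA ▸ ⟨h.1, hz'⟩
        rw [mem_singleton_iff] at this
        exact h.2 ⟨0, by simpa using hδ, by simp [this]⟩
      · exact hRvw z hz' h
    · have hx := hTS h
      have hy := hTS (Sym2.eq_swap ▸ h)
      have := disjoint_left.1 (e1 x y hxy (fun h => hw (h ▸ hx)) (fun h => hw (h ▸ hy))) hz
      exact fun h' => hA.edge hxy h z hz ((hout z this).2 h')
  · have key : ∀ y, Γ.Adj (p + a) y → y ≠ v → s(p + a, y) ∉ T' →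
        ∀ z ∈ (A \ cut ∪ R) ∩ segment ℝ (p + a) y,
        (p + a ∈ S' ∧ dist z (p + a) < ε) ∨ (y ∈ S' ∧ dist z y < ε) := by
      intro y hxy hyv hT z hz
      obtain ⟨z', h1, h2, -⟩ := hnew y hxy hyv
      rw [h1] at hz
      rcases hz with rfl | hz
      · exact Or.inl ⟨(hS' _).2 (Or.inl rfl), h2⟩
      · rcases hA.far hxy (fun h => hT ((hT' _).2 (Or.inr h))) z hz with h | h
        · exact absurd h.1 hw
        · exact Or.inr ⟨(hS' _).2 (Or.inr h.1), h.2⟩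
    intro x y hxy hT z hz
    have hTo : s(x, y) ∉ T := fun h => hT ((hT' _).2 (Or.inr h))
    by_cases hx : x = p + a
    · subst hx
      refine key y hxy ?_ hT z hz
      rintro rfl
      exact hT ((hT' _).2 (Or.inl Sym2.eq_swap))
    by_cases hy : y = p + a
    · subst hy
      have := key x hxy.symm ?_ (by rwa [Sym2.eq_swap]) z (by rwa [segment_symm])
      · exact this.symm
      · rintro rfl
        exact hT ((hT' _).2 (Or.inl rfl))
    have hzF := disjoint_left.1 (e1 x y hxy hx hy) hz.2
    rcases hA.far hxy hTo z ⟨(hout z hzF).2 hz.1, hz.2⟩ with h | h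
    · exact Or.inl ⟨(hS' _).2 (Or.inr h.1), h.2⟩
    · exact Or.inr ⟨(hS' _).2 (Or.inr h.1), h.2⟩
  · intro x y hxy hT hxS
    have hTo : s(x, y) ∉ T := fun h => hT ((hT' _).2 (Or.inr h))
    have hTn : s(x, y) ≠ s(v, p + a) := fun h => hT ((hT' _).2 (Or.inl h))
    by_cases hx : x = p + a
    · subst hx
      obtain ⟨z', h1, h2, h3⟩ := hnew y hxy (by rintro rfl; exact hTn Sym2.eq_swap)
      refine ⟨z', ?_, h3⟩
      rw [h1]
      ext z
      constructor
      · rintro ⟨rfl | hz, hzd⟩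
        · rfl
        -- An old crossing on this edge is within `ε` of the other end `y`, hence not within `ε` of
        -- the new vertex, as the edge has length at least `2 * ε`.
        · exfalso
          rcases hA.far hxy hTo z hz with h | h
          · exact hw h.1
          · have g1 := hε2 _ _ hxy
            have g2 := dist_triangle_left (p + a) y z
            rw [Metric.mem_ball] at hzd
            linarith [h.2]
      · rintro rfl
        exact ⟨mem_insert _ _, h2⟩
    have hxS' : x ∈ S := ((hS' x).1 hxS).resolve_left hx
    obtain ⟨z, hz, d, hd, hs⟩ := hA.near hxy hTo hxS'
    have hzm : z ∈ A ∩ segment ℝ x y ∩ Metric.ball x ε := by rw [hz]; rfl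
    have hzF : z ∉ F := disjoint_left.1 (e3 x y hxy hTn) hzm.1
    refine ⟨z, ?_, d, hd, hs.congr hFc hzF hout⟩
    rw [← hz]
    by_cases hy : y = p + a
    · subst hy
      obtain ⟨z', h1, h2, -⟩ := hnew x hxy.symm (by rintro rfl; exact hTn rfl)
      rw [segment_symm, h1]
      ext t
      constructor
      · rintro ⟨rfl | ht, htd⟩
        · exfalso
          have g1 := hε2 _ _ hxy
          have g2 := dist_triangle_left x (p + a) t
          rw [Metric.mem_ball] at htd
          linarith
        · exact ⟨ht, htd⟩
      · rintro ⟨ht, htd⟩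
        exact ⟨Or.inr ht, htd⟩
    · ext t
      constructor
      · rintro ⟨⟨h1, h2⟩, h3⟩
        exact ⟨⟨(hout t (disjoint_left.1 (e1 x y hxy hx hy) h2)).2 h1, h2⟩, h3⟩
      · rintro ⟨⟨h1, h2⟩, h3⟩
        exact ⟨⟨(hout t (disjoint_left.1 (e1 x y hxy hx hy) h2)).1 h1, h2⟩, h3⟩
  · intro i hi
    refine ((hM.finite i hi).union (e8 i hi).1).subset ?_
    rintro z ⟨h | h, hz⟩
    · exact Or.inl ⟨h.1, hz⟩
    · exact Or.inr ⟨hz, h⟩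
  · intro i hi
    have hs1 : (A \ cut ∪ R) ∩ B i ⊆ (A ∩ B i) ∪ (B i ∩ R) := by
      rintro z ⟨h | h, hz⟩
      · exact Or.inl ⟨h.1, hz⟩
      · exact Or.inr ⟨hz, h⟩
    have h1 := ncard_le_ncard hs1 ((hM.finite i hi).union (e8 i hi).1)
    have h2 := ncard_union_le (A ∩ B i) (B i ∩ R)
    have h3 := hM.ncard_le i hi
    have h4 := (e8 i hi).2.1
    have h5 : (B i ∩ segment ℝ p (p + a)).ncard ≤ (B i ∩ segment ℝ v (p + a)).ncard :=
      ncard_le_ncard (inter_subset_inter_right _ hsub) ((hB i hi).finite hvw)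
    rw [hsum, edgeSegment_mk, mul_add]
    omega
  · intro i hi e he hne
    rcases (hT' e).1 he with rfl | he
    · obtain ⟨z, hzB, hz⟩ := hne
      have hd := hεB i hi v (p + a) hvw z ⟨hzB, hz⟩
      -- A point of `B i` on the edge has distance at least `ε` from `v`, so it lies beyond `p`, in
      -- the part enclosed by the rectangle.
      have hz' : z ∈ segment ℝ p (p + a) := by
        rw [edgeSegment_mk, segment_eq_image'] at hz
        obtain ⟨τ, ⟨h0, h1⟩, rfl⟩ := hz
        rw [mem_segment_iff_frame (u := u)]
        refine ⟨_, ⟨?_, ?_⟩, hfr τ⟩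
        · refine div_nonneg ?_ (by linarith)
          have hpd' : dist p v = τ₀ * ‖p + a - v‖ := by
            conv_lhs => rw [← hpτ]
            rw [dist_eq_norm, add_sub_cancel_left, norm_smul, Real.norm_of_nonneg hτ0]
          simp only at hd
          rw [dist_eq_norm, add_sub_cancel_left, norm_smul, Real.norm_of_nonneg h0] at hd
          rw [hpd'] at hpd
          have : 0 < ‖p + a - v‖ := norm_pos_iff.2 (sub_ne_zero.2 hvw'.symm)
          have := lt_of_mul_lt_mul_right (hpd.trans_le hd) this.le
          linarith
        · rw [div_le_one (by linarith)]
          linarith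
      obtain ⟨t, ht1, ht2⟩ := (e8 i hi).2.2 ⟨z, hzB, hz'⟩
      exact ⟨t, Or.inr ht2, ht1⟩
    · obtain ⟨z, hzA, hzB⟩ := hM.nonempty i hi e he hne
      refine ⟨z, Or.inl ⟨hzA, ?_⟩, hzB⟩
      rintro ⟨τ, hτ, rfl⟩
      exact e7 i hi τ hτ hzB
  · intro i hi x y hxy
    rw [disjoint_left]
    rintro z (hz | hz) hz'
    · exact disjoint_left.1 (hM.edge i hi hxy) hz.1 hz'
    · by_cases h : s(x, y) = s(v, p + a)
      · refine hRvw z ?_ hz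
        rw [← edgeSegment_mk, ← h]
        exact hz'.2
      · exact disjoint_left.1 (e5 i hi x y hxy h) hz' (hRF hz)
  · intro i hi j hj hij
    rw [disjoint_left]
    rintro z (hz | hz) hz'
    · exact disjoint_left.1 (hM.triple i hi j hj hij) hz.1 hz'
    · exact disjoint_left.1 (e6 i hi j hj hij) hz' (hRF hz)

theorem eventually_disjoint_short_segment {K : Set Plane} (hK : IsClosed K) {w : Plane}
    (hw : w ∉ K) (c : Plane) :
    ∀ᶠ η in 𝓝[>] (0 : ℝ), Disjoint K (segment ℝ (w + η • c) w) := by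
  obtain ⟨ρ, hρ, h⟩ := Metric.isOpen_iff.1 hK.isOpen_compl w hw
  have hc : Tendsto (fun η : ℝ => w + η • c) (𝓝[>] 0) (𝓝 w) := by
    have : Continuous (fun η : ℝ => w + η • c) := by fun_prop
    simpa using (this.tendsto 0).mono_left nhdsWithin_le_nhds
  filter_upwards [hc.eventually (Metric.ball_mem_nhds w hρ)] with η hη
  rw [disjoint_right]
  intro z hz
  exact h ((convex_ball w ρ).segment_subset hη (Metric.mem_ball_self hρ) hz)

/-- All but finitely many slopes are suitable. The first coordinate 1 makes `c` independent of the
vertical vector, which serves as the second axis in `IsContour.exists_start`. -/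
theorem exists_direction {Y : Set Plane} (hY : Y.Finite) (w : Plane) (hw : w ∉ Y) :
    ∃ c : Plane, c 0 = 1 ∧ ∀ y ∈ Y, ∀ τ : ℝ, y ≠ w + τ • c := by
  obtain ⟨k, hk⟩ := (hY.image fun y => (y 1 - w 1) / (y 0 - w 0)).infinite_compl.nonempty
  refine ⟨!₂[1, k], rfl, ?_⟩
  rintro y hy τ rfl
  have hτ : τ ≠ 0 := by
    rintro rfl
    exact hw (by simpa using hy)
  refine hk ⟨_, hy, ?_⟩
  simp [hτ]

/-- The contour of a single vertex. -/
theorem IsContour.exists_start {ι : Type*} {Γ : SimpleGraph Plane} (hΓ : IsStraight Γ)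
    {s : Finset ι} {B : ι → Set Plane} (hB : ∀ i ∈ s, Transverse Γ (B i))
    {ε : ℝ} (hε : 0 < ε) {w : Plane} (hw : w ∈ Γ.support) :
    ∃ A, IsContour Γ {w} ∅ ε A ∧ Meets Γ ∅ s B A := by
  obtain ⟨y₀, hy₀⟩ := hw
  have hY : {y | Γ.Adj w y}.Finite :=
    hΓ.finite_support.subset fun y hy => ⟨w, hy.symm⟩
  -- A short auxiliary segment from `w + η • c` to `w`, parallel to no edge at `w`, takes the place
  -- of the leaf edge; the rim around it is the initial contour.
  obtain ⟨c, hc0, hc⟩ := exists_direction hY w (by simp)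
  have ev1 : ∀ᶠ η in 𝓝[>] (0 : ℝ), ∀ x y, Γ.Adj x y → x ≠ w → y ≠ w →
      Disjoint (segment ℝ x y) (segment ℝ (w + η • c) w) := by
    refine hΓ.eventually_all fun x y hxy => ?_
    by_cases h : x ≠ w ∧ y ≠ w
    · have hw : w ∉ segment ℝ x y := by
        intro hw
        have := (hΓ.inter hxy hy₀ (by
          intro h'
          rcases Sym2.eq_iff.1 h' with h' | h'
          · exact h.1 h'.1
          · exact h.2 h'.2) w hw (left_mem_segment ℝ _ _)).1
        rcases this with h' | h'
        · exact h.1 h'.symm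
        · exact h.2 h'.symm
      filter_upwards [eventually_disjoint_short_segment (isCompact_segment x y).isClosed hw c]
        with η hη _ _
      exact hη
    · exact Eventually.of_forall fun δ h1 h2 => absurd ⟨h1, h2⟩ h
  have ev2 : ∀ᶠ η in 𝓝[>] (0 : ℝ), ∀ x y, Γ.Adj x y → x ≠ w →
      Disjoint {x} (segment ℝ (w + η • c) w) := by
    refine hΓ.eventually_all fun x y hxy => ?_
    by_cases h : x = w
    · exact Eventually.of_forall fun δ h' => absurd h h'
    · filter_upwards [eventually_disjoint_short_segment (isClosed_singleton (x := x))
        (w := w) (fun h' => h h'.symm) c] with η hη _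
      exact hη
  have ev3 : ∀ᶠ η in 𝓝[>] (0 : ℝ), ∀ i ∈ s, Disjoint (B i) (segment ℝ (w + η • c) w) :=
    (eventually_all_finset s).2 fun i hi =>
      eventually_disjoint_short_segment (hB i hi).isCompact.isClosed ((hB i hi).notMem hy₀) c
  obtain ⟨η, hη, h1, h2, h3⟩ := (eventually_mem_nhdsWithin.and (ev1.and (ev2.and ev3))).exists
  rw [mem_Ioi] at hη
  clear ev1 ev2 ev3
  obtain ⟨p, hp⟩ : ∃ p, p = w + η • c := ⟨_, rfl⟩
  obtain ⟨a, ha⟩ : ∃ a : Plane, a = -(η • c) := ⟨_, rfl⟩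
  have hpa : p + a = w := by rw [hp, ha]; simp
  obtain ⟨u, hu⟩ : ∃ u : Plane, u = !₂[0, 1] := ⟨_, rfl⟩
  have hD : det2 a u ≠ 0 := by
    rw [ha, hu]
    simp [det2, hc0, hη.ne']
  rw [← hp] at h1 h2 h3
  subst hpa
  have ev1 : ∀ᶠ δ in 𝓝[>] (0 : ℝ), ∀ x y, Γ.Adj x y → x ≠ p + a → y ≠ p + a →
      Disjoint (segment ℝ x y) (frame p a u '' box δ) := by
    refine hΓ.eventually_all fun x y hxy => ?_
    by_cases h : x ≠ p + a ∧ y ≠ p + a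
    · filter_upwards [eventually_disjoint_box (u := u) (isCompact_segment x y)
        (h1 x y hxy h.1 h.2)] with δ hδ _ _
      exact hδ
    · exact Eventually.of_forall fun δ h1 h2 => absurd ⟨h1, h2⟩ h
  have ev2 : ∀ᶠ δ in 𝓝[>] (0 : ℝ), ∀ x y, Γ.Adj x y → x ≠ p + a →
      Disjoint {x} (frame p a u '' box δ) := by
    refine hΓ.eventually_all fun x y hxy => ?_
    by_cases h : x = p + a
    · exact Eventually.of_forall fun δ h' => absurd h h'
    · filter_upwards [eventually_disjoint_box (u := u) isCompact_singleton (h2 x y hxy h)]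
        with δ hδ _
      exact hδ
  have ev3 : ∀ᶠ δ in 𝓝[>] (0 : ℝ), ∀ i ∈ s, Disjoint (B i) (frame p a u '' box δ) :=
    (eventually_all_finset s).2 fun i hi =>
      eventually_disjoint_box (hB i hi).isCompact (h3 i hi)
  have ev4 : ∀ᶠ δ in 𝓝[>] (0 : ℝ), ∀ x y, Γ.Adj x y → x = p + a →
      ∃ z, frame p a u '' rim δ ∩ segment ℝ (p + a) y = {z} ∧
      dist z (p + a) < ε ∧
      (∃ d, det2 d (y - (p + a)) ≠ 0 ∧ StraightAt (frame p a u '' rim δ) z d) ∧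
      z ≠ p - δ • u ∧ z ≠ p + δ • u := by
    refine hΓ.eventually_all fun x y hxy => ?_
    by_cases h : x = p + a
    · subst h
      set q := coord (p + a) a u y with hq
      have hy : y = p + a + (q.1 • a + q.2 • u) := by
        have := frame_coord hD (p + a) y
        rw [← hq, frame] at this
        rw [← add_assoc]
        exact this.symm
      have hq0 : q.2 ≠ 0 ∨ 0 < q.1 := by
        left
        intro h2
        have hqa : q.1 • a = (-(q.1 * η)) • c := by rw [ha]; module
        rw [h2, zero_smul, add_zero, hqa] at hy
        exact hc y hxy _ hy
      filter_upwards [eventually_rim_inter_segment hD hy hq0 hε] with δ hδ _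
      exact hδ
    · exact Eventually.of_forall fun δ h' => absurd h' h
  obtain ⟨δ, hδ, e1, e2, e3, e4⟩ :=
    (eventually_mem_nhdsWithin.and (ev1.and (ev2.and (ev3.and ev4)))).exists
  rw [mem_Ioi] at hδ
  have hRF : frame p a u '' rim δ ⊆ frame p a u '' box δ := image_mono rim_subset_box
  have hBR : ∀ i ∈ s, frame p a u '' rim δ ∩ B i = ∅ := fun i hi =>
    ((e3 i hi).symm.mono_left hRF).inter_eq
  refine ⟨frame p a u '' rim δ, ⟨⟨_, _, isArcBetween_rim hD hδ⟩, ?_, by simp, ?_, ?_⟩,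
    ⟨?_, ?_, by simp, ?_, ?_⟩⟩
  · intro x y hxy hx
    by_cases h : x = p + a
    · obtain ⟨⟨r, t⟩, hr, hr'⟩ := hx
      have e : p + a = frame p a u (1, 0) := by simp [frame]
      rw [h, e] at hr'
      have := frame_injective hD p hr'
      rw [this] at hr
      rcases hr with ⟨h, -⟩ | ⟨h, -⟩
      · simp only [abs_zero] at h; exact hδ.ne h
      · simp only at h; nlinarith
    · exact disjoint_left.1 (e2 x y hxy h) rfl (hRF hx)
  · intro x y hxy _ z hz
    by_cases hx : x = p + a
    · subst hx
      obtain ⟨z', h, hd, -⟩ := e4 _ y hxy rfl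
      rw [h, mem_singleton_iff] at hz
      subst hz
      exact Or.inl ⟨by simp, hd⟩
    by_cases hy : y = p + a
    · subst hy
      obtain ⟨z', h, hd, -⟩ := e4 _ x hxy.symm rfl
      rw [segment_symm, h, mem_singleton_iff] at hz
      subst hz
      exact Or.inr ⟨by simp, hd⟩
    exact absurd (hRF hz.1) (disjoint_left.1 (e1 x y hxy hx hy) hz.2)
  · intro x y hxy _ hx
    rw [Finset.mem_singleton] at hx
    subst hx
    obtain ⟨z, h, hd, hs, -⟩ := e4 _ y hxy rfl
    refine ⟨z, ?_, hs⟩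
    rw [h]
    ext t
    constructor
    · exact fun h => h.1
    · rintro rfl
      exact ⟨rfl, hd⟩
  · intro i hi
    rw [hBR i hi]; exact finite_empty
  · intro i hi
    rw [hBR i hi]; simp
  · intro i hi x y hxy
    exact (e3 i hi).symm.mono hRF inter_subset_left
  · intro i hi j hj hij
    exact (e3 i hi).symm.mono hRF inter_subset_left

/-- The contour of a tree, in general position to given curves. -/
theorem IsContour.exists_of_grows {ι : Type*} {Γ : SimpleGraph Plane} (hΓ : IsStraight Γ)
    {s : Finset ι} {B : ι → Set Plane} (hB : ∀ i ∈ s, Transverse Γ (B i))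
    (hBB : ∀ i ∈ s, ∀ j ∈ s, i ≠ j → ∀ x y, Γ.Adj x y → Disjoint (B i ∩ B j) (segment ℝ x y))
    {ε : ℝ} (hε : 0 < ε) (hε2 : ∀ x y, Γ.Adj x y → 2 * ε ≤ dist x y)
    (hεB : ∀ i ∈ s, ∀ x y, Γ.Adj x y → ∀ z ∈ B i ∩ segment ℝ x y, ε ≤ dist z x)
    {S : Finset Plane} {T : Finset (Sym2 Plane)} (hST : Grows Γ S T)
    (hS : ∀ x ∈ S, x ∈ Γ.support) :
    ∃ A, IsContour Γ S T ε A ∧ Meets Γ T s B A := by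
  induction hST with
  | single w => exact IsContour.exists_start hΓ hB hε (hS w (by simp))
  | @step S T v w h hv hw hvw ih =>
    obtain ⟨A, hA, hM⟩ := ih fun x hx => hS x (Finset.mem_insert.2 (Or.inr hx))
    refine hA.exists_step hΓ hB hBB hε hε2 hεB hM h.mem_of_mem hv hw hvw
      (fun _ => Finset.mem_insert) (fun _ => Finset.mem_insert)
      (fun f => Finset.sum_insert fun h' => hw (h.mem_of_mem (Sym2.eq_swap ▸ h')))

/-! ### Contours of several trees and the number of their common points. -/

/-- The number of ends of the edge `e` in `S`. -/
noncomputable def endsIn (S : Finset Plane) (e : Sym2 Plane) : ℕ := ({x | x ∈ e} ∩ S : Set Plane).ncard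

theorem IsContour.ncard_inter_edgeSegment_le {Γ : SimpleGraph Plane} {S : Finset Plane}
    {T : Finset (Sym2 Plane)} {ε : ℝ} {A : Set Plane} (h : IsContour Γ S T ε A) {e : Sym2 Plane}
    (he : e ∈ Γ.edgeSet) (hT : e ∉ T) : (A ∩ edgeSegment e).ncard ≤ endsIn S e := by
  induction e with
  | h x y =>
    have hne : x ≠ y := SimpleGraph.Adj.ne he
    refine (h.ncard_le he hT).trans ?_
    rw [← ncard_union_eq]
    · refine ncard_le_ncard ?_ (S.finite_toSet.inter_of_right _)
      rintro z (⟨hz, hz'⟩ | ⟨hz, hz'⟩) <;> rw [mem_singleton_iff] at hz <;> subst hz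
      · exact ⟨Sym2.mem_mk_left _ _, hz'⟩
      · exact ⟨Sym2.mem_mk_right _ _, hz'⟩
    · exact (disjoint_singleton.2 hne).mono inter_subset_left inter_subset_left

theorem IsContour.inter_edgeSegment_eq_empty {Γ : SimpleGraph Plane} {S : Finset Plane}
    {T : Finset (Sym2 Plane)} {ε : ℝ} {A : Set Plane} (h : IsContour Γ S T ε A) {e : Sym2 Plane}
    (he : e ∈ Γ.edgeSet) (hT : e ∈ T) : A ∩ edgeSegment e = ∅ := by
  induction e with
  | h x y =>
    ext z
    simp only [mem_inter_iff, mem_empty_iff_false, iff_false, not_and]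
    exact fun h1 h2 => h.edge he hT z h2 h1

/-- At this scale a new contour crosses edges closer to the ends than any earlier curve does, and
its crossings near the two ends of an edge are separate. -/
theorem exists_scale {ι : Type*} {Γ : SimpleGraph Plane} (hΓ : IsStraight Γ) {s : Finset ι}
    {B : ι → Set Plane} (hB : ∀ i ∈ s, Transverse Γ (B i)) :
    ∃ ε > 0, (∀ x y, Γ.Adj x y → 2 * ε ≤ dist x y) ∧
      ∀ i ∈ s, ∀ x y, Γ.Adj x y → ∀ z ∈ B i ∩ segment ℝ x y, ε ≤ dist z x := by
  have ev1 : ∀ᶠ ε in 𝓝[>] (0 : ℝ), ∀ x y, Γ.Adj x y → 2 * ε ≤ dist x y := by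
    refine hΓ.eventually_all fun x y hxy => ?_
    filter_upwards [eventually_mul_lt 2 (dist_pos.2 hxy.ne)] with ε hε
    linarith
  have ev2 : ∀ᶠ ε in 𝓝[>] (0 : ℝ), ∀ i ∈ s, ∀ x y, Γ.Adj x y → ∀ z ∈ B i ∩ segment ℝ x y,
      ε ≤ dist z x := by
    refine (eventually_all_finset s).2 fun i hi => hΓ.eventually_all fun x y hxy => ?_
    refine (eventually_all_finite ((hB i hi).finite hxy)).2 fun z hz => ?_
    have hzx : 0 < dist z x := dist_pos.2 fun h => (hB i hi).notMem hxy (h ▸ hz.1)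
    filter_upwards [eventually_mul_lt 1 hzx] with ε hε
    linarith
  obtain ⟨ε, h0, h1, h2⟩ := (eventually_mem_nhdsWithin.and (ev1.and ev2)).exists
  exact ⟨ε, h0, h1, h2⟩

/-- An edge of one tree that leaves another tree. -/
def Leaves (S : Finset Plane) (T T' : Finset (Sym2 Plane)) : Prop :=
  ∃ e ∈ T', e ∉ T ∧ ∃ x ∈ e, x ∈ S

/-- The later contour `A` meets `B i` at most twice per crossing of `B i` with an edge of `T'`. As a
contour, `B i` avoids the edges of `T` and crosses any other edge at most once per end in `S`. -/
theorem IsContour.meets_leaving {ι : Type*} {Γ : SimpleGraph Plane} {S S' : Finset Plane}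
    {T T' : Finset (Sym2 Plane)} {ε : ℝ} {s : Finset ι} {B : ι → Set Plane} {A : Set Plane} {i : ι}
    (hi : i ∈ s) (h : IsContour Γ S T ε (B i)) (hT' : Grows Γ S' T') (hM : Meets Γ T' s B A) :
    (A ∩ B i).ncard ≤ 2 * ∑ e ∈ T' \ T, endsIn S e ∧
      (Leaves S T T' → (A ∩ B i).Nonempty) := by
  have hedge : ∀ e ∈ T', e ∈ Γ.edgeSet := by
    intro e he
    induction e with
    | h x y => exact hT'.adj he
  constructor
  · refine (hM.ncard_le i hi).trans ?_
    refine Nat.mul_le_mul_left _ ?_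
    rw [← Finset.sum_sdiff (Finset.inter_subset_left : T' ∩ T ⊆ T'), Finset.sdiff_inter_self_left]
    rw [Finset.sum_eq_zero (s := T' ∩ T), add_zero]
    · refine Finset.sum_le_sum fun e he => ?_
      rw [Finset.mem_sdiff] at he
      exact h.ncard_inter_edgeSegment_le (hedge e he.1) he.2
    · intro e he
      rw [Finset.mem_inter] at he
      rw [h.inter_edgeSegment_eq_empty (hedge e he.1) he.2, ncard_empty]
  · rintro ⟨e, he, heT, x, hx, hxS⟩
    refine hM.nonempty i hi e he ?_
    obtain ⟨y, rfl⟩ := hx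
    obtain ⟨z, hz, -⟩ := h.near (hT'.adj he) heT hxS
    have : z ∈ B i ∩ segment ℝ x y ∩ Metric.ball x ε := by rw [hz]; rfl
    exact ⟨z, this.1⟩

/-- Contours of finitely many trees, in general position. -/
theorem exists_contours {ι : Type*} [DecidableEq ι] {Γ : SimpleGraph Plane} (hΓ : IsStraight Γ)
    {S : ι → Finset Plane} {T : ι → Finset (Sym2 Plane)} (hST : ∀ i, Grows Γ (S i) (T i))
    (hS : ∀ i, ∀ x ∈ S i, x ∈ Γ.support) (s : Finset ι) :
    ∃ A : ι → Set Plane, (∀ i ∈ s, ∃ ε, IsContour Γ (S i) (T i) ε (A i)) ∧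
      (∀ i ∈ s, ∀ j ∈ s, i ≠ j → (A i ∩ A j).Finite ∧
        ((A i ∩ A j).ncard ≤ 2 * ∑ e ∈ T i \ T j, endsIn (S j) e ∨
          (A i ∩ A j).ncard ≤ 2 * ∑ e ∈ T j \ T i, endsIn (S i) e) ∧
        (Leaves (S i) (T i) (T j) → Leaves (S j) (T j) (T i) → (A i ∩ A j).Nonempty) ∧
        ∀ x y, Γ.Adj x y → Disjoint (A i ∩ A j) (segment ℝ x y)) ∧
      ∀ i ∈ s, ∀ j ∈ s, ∀ k ∈ s, i ≠ j → i ≠ k → j ≠ k → Disjoint (A i) (A j ∩ A k) := by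
  induction s using Finset.induction_on with
  | empty => exact ⟨fun _ => ∅, by simp⟩
  | insert l s hl ih =>
    obtain ⟨A, h1, h2, h3⟩ := ih
    have hB : ∀ i ∈ s, Transverse Γ (A i) := fun i hi => (h1 i hi).choose_spec.transverse
    obtain ⟨ε, hε, hε1, hε2⟩ := exists_scale hΓ hB
    -- The bound for a pair refers to the edges of whichever tree has its contour drawn later, hence
    -- the disjunction.
    obtain ⟨A', hA', hM⟩ := IsContour.exists_of_grows hΓ hB
      (fun i hi j hj hij => (h2 i hi j hj hij).2.2.2) hε hε1 hε2 (hST l) (hS l)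
    have hne : ∀ i ∈ s, i ≠ l := fun i hi h => hl (h ▸ hi)
    have hedge : ∀ i ∈ s, ∀ x y, Γ.Adj x y → Disjoint (A' ∩ A i) (segment ℝ x y) := by
      intro i hi x y hxy
      rw [disjoint_left]
      rintro z ⟨hz1, hz2⟩ hz
      exact disjoint_left.1 (hM.edge i hi hxy) hz1 ⟨hz2, hz⟩
    refine ⟨Function.update A l A', ?_, ?_, ?_⟩
    · intro i hi
      rcases Finset.mem_insert.1 hi with rfl | hi
      · exact ⟨ε, by simpa using hA'⟩
      · rw [Function.update_of_ne (hne i hi)]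
        exact h1 i hi
    · intro i hi₀ j hj₀ hij
      rcases Finset.mem_insert.1 hi₀ with rfl | hi <;> rcases Finset.mem_insert.1 hj₀ with rfl | hj
      · exact absurd rfl hij
      · obtain ⟨ε', hj'⟩ := h1 j hj
        obtain ⟨g1, g2⟩ := hj'.meets_leaving hj (hST i) hM
        rw [Function.update_self, Function.update_of_ne (hne j hj)]
        exact ⟨hM.finite j hj, Or.inl g1, fun _ => g2, hedge j hj⟩
      · obtain ⟨ε', hi'⟩ := h1 i hi
        obtain ⟨g1, g2⟩ := hi'.meets_leaving hi (hST j) hM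
        rw [Function.update_self, Function.update_of_ne (hne i hi), inter_comm]
        exact ⟨hM.finite i hi, Or.inr g1, fun h _ => g2 h, hedge i hi⟩
      · rw [Function.update_of_ne (hne i hi), Function.update_of_ne (hne j hj)]
        exact h2 i hi j hj hij
    · have key : ∀ i ∈ s, ∀ j ∈ s, i ≠ j → A' ∩ (A i ∩ A j) = ∅ :=
        fun i hi j hj hij => (hM.triple i hi j hj hij).inter_eq
      intro i hi₀ j hj₀ k hk₀ hij hik hjk
      rw [disjoint_iff_inter_eq_empty]
      rcases Finset.mem_insert.1 hi₀ with rfl | hi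
      · have hj' := (Finset.mem_insert.1 hj₀).resolve_left (Ne.symm hij)
        have hk' := (Finset.mem_insert.1 hk₀).resolve_left (Ne.symm hik)
        rw [Function.update_self, Function.update_of_ne (hne j hj'),
          Function.update_of_ne (hne k hk')]
        exact key j hj' k hk' hjk
      rw [Function.update_of_ne (hne i hi)]
      rcases Finset.mem_insert.1 hj₀ with rfl | hj
      · have hk' := (Finset.mem_insert.1 hk₀).resolve_left (Ne.symm hjk)
        rw [Function.update_self, Function.update_of_ne (hne k hk'), inter_left_comm]
        exact key i hi k hk' hik
      rw [Function.update_of_ne (hne j hj)]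
      rcases Finset.mem_insert.1 hk₀ with rfl | hk
      · rw [Function.update_self, ← inter_assoc, inter_comm]
        exact key i hi j hj hij
      rw [Function.update_of_ne (hne k hk)]
      exact (h3 i hi j hj k hk hij hik hjk).inter_eq

/-! ### Subtrees of bounded degree in a connected set. -/

theorem SimpleGraph.Walk.IsPath.edge_at_start_unique {α : Type*} {G : SimpleGraph α}
    {a b : α} {p : G.Walk a b} (hp : p.IsPath) {e e' : Sym2 α} (he : e ∈ p.edges) (he' : e' ∈ p.edges) (ha : a ∈ e) (ha' : a ∈ e') :
    e = e' := by
  cases p with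
  | nil => simp at he
  | @cons _ c _ hadj q =>
    have hq := ((SimpleGraph.Walk.cons_isPath_iff _ _).1 hp).2
    have key : ∀ f ∈ (SimpleGraph.Walk.cons hadj q).edges, a ∈ f → f = s(a, c) := by
      intro f hf haf
      rw [SimpleGraph.Walk.edges_cons, List.mem_cons] at hf
      refine hf.resolve_right fun hf => hq ?_
      obtain ⟨y, rfl⟩ := haf
      exact q.fst_mem_support_of_mem_edges hf
    rw [key e he ha, key e' he' ha']

section Trees

variable {α : Type*} [DecidableEq α] {G : SimpleGraph α}

theorem Grows.nonempty {S : Finset α} {T : Finset (Sym2 α)} (h : Grows G S T) : S.Nonempty := by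
  induction h with
  | single w => simp
  | step => simp

theorem Grows.append_path {a b : α} (p : G.Walk a b) (hp : p.IsPath) {S : Finset α}
    {T : Finset (Sym2 α)} (h : Grows G S T) (ha : a ∈ S) (hS : ∀ x ∈ p.support, x ≠ a → x ∉ S) :
    Grows G (S ∪ p.support.toFinset) (T ∪ p.edges.toFinset) := by
  induction p generalizing S T with
  | nil =>
    convert h using 1
    · ext x; simp; rintro rfl; exact ha
    · simp
  | @cons a c b hadj q ih =>
    rw [SimpleGraph.Walk.cons_isPath_iff] at hp
    have hc : c ∉ S := hS c (by simp) (by rintro rfl; exact hp.2 (by simp))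
    have := ih hp.1 (h.step ha hc hadj) (by simp) ?_
    · convert this using 1
      · ext x
        simp only [SimpleGraph.Walk.support_cons, List.toFinset_cons, Finset.mem_union,
          Finset.mem_insert, List.mem_toFinset]
        constructor
        · rintro (h | rfl | h)
          · exact Or.inl (Or.inr h)
          · exact Or.inl (Or.inr ha)
          · exact Or.inr h
        · rintro ((rfl | h) | h)
          · exact Or.inr (Or.inr (by simp))
          · exact Or.inl h
          · exact Or.inr (Or.inr h)
      · ext e
        simp only [SimpleGraph.Walk.edges_cons, List.toFinset_cons, Finset.mem_union,
          Finset.mem_insert]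
        tauto
    · intro x hx hxc hxS
      rcases Finset.mem_insert.1 hxS with h | h
      · exact hxc h
      · exact hS x (by simp [hx]) (by rintro rfl; exact hp.2 hx) h

theorem SimpleGraph.Walk.IsPath.exists_last_exit {a b : α} (p : G.Walk a b) (hp : p.IsPath)
    {S : Finset α} (h : ∃ x ∈ p.support, x ∈ S) :
    ∃ c ∈ S, ∃ q : G.Walk c b, q.IsPath ∧ (∀ x ∈ q.support, x ∈ p.support) ∧
      ∀ x ∈ q.support, x ≠ c → x ∉ S := by
  induction p with
  | @nil a =>
    obtain ⟨x, hx, hxS⟩ := h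
    simp only [SimpleGraph.Walk.support_nil, List.mem_singleton] at hx
    subst hx
    exact ⟨x, hxS, .nil, by simp, by simp, by simp⟩
  | @cons a c b hadj q ih =>
    have hq := ((SimpleGraph.Walk.cons_isPath_iff _ _).1 hp).1
    by_cases hc : ∃ x ∈ q.support, x ∈ S
    · obtain ⟨c', hc', q', h1, h2, h3⟩ := ih hq hc
      exact ⟨c', hc', q', h1, fun x hx => by simp [h2 x hx], h3⟩
    · push Not at hc
      obtain ⟨x, hx, hxS⟩ := h
      rw [SimpleGraph.Walk.support_cons, List.mem_cons] at hx
      rcases hx with rfl | hx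
      · refine ⟨x, hxS, .cons hadj q, hp, fun _ => id, fun y hy hyx => ?_⟩
        rw [SimpleGraph.Walk.support_cons, List.mem_cons] at hy
        exact hc y (hy.resolve_left hyx)
      · exact absurd hxS (hc x hx)

theorem SimpleGraph.Walk.IsPath.card_edges_at_le {a b : α} {p : G.Walk a b} (hp : p.IsPath)
    (v : α) : (p.edges.toFinset.filter (v ∈ ·)).card ≤ 2 := by
  induction p with
  | nil => simp
  | @cons a c b hadj q ih =>
    obtain ⟨hq, ha⟩ := (SimpleGraph.Walk.cons_isPath_iff _ _).1 hp
    rw [SimpleGraph.Walk.edges_cons, List.toFinset_cons, Finset.filter_insert]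
    split_ifs with hv
    · refine (Finset.card_insert_le _ _).trans ?_
      have : (q.edges.toFinset.filter (v ∈ ·)).card ≤ 1 := by
        rw [Finset.card_le_one]
        intro e he e' he'
        simp only [Finset.mem_filter, List.mem_toFinset] at he he'
        rcases Sym2.mem_iff.1 hv with rfl | rfl
        · obtain ⟨y, rfl⟩ := he.2
          exact absurd (q.fst_mem_support_of_mem_edges he.1) ha
        · exact hq.edge_at_start_unique he.1 he'.1 he.2 he'.2
      omega
    · exact ih hq

/-- A connected set contains a subtree through given vertices, of degree at most twice their
number. -/
theorem exists_grows_of_connected {C : Set α} (hC : (G.induce C).Connected) (L : Finset α)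
    (hL : ∀ x ∈ L, x ∈ C) :
    ∃ S T, Grows G S T ∧ L ⊆ S ∧ (∀ x ∈ S, x ∈ C) ∧
      ∀ v, (T.filter (v ∈ ·)).card ≤ 2 * L.card := by
  induction L using Finset.induction_on with
  | empty =>
    obtain ⟨x⟩ := hC.nonempty
    exact ⟨{x.1}, ∅, .single _, by simp, by simp, by simp⟩
  | insert b L hb ih =>
    obtain ⟨S, T, h, hLS, hS, hdeg⟩ := ih fun x hx => hL x (Finset.mem_insert_of_mem hx)
    rw [Finset.card_insert_of_notMem hb]
    by_cases hbS : b ∈ S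
    · refine ⟨S, T, h, Finset.insert_subset hbS hLS, hS, fun v => (hdeg v).trans (by omega)⟩
    obtain ⟨a, ha⟩ := h.nonempty
    obtain ⟨p, hp⟩ := (hC.preconnected ⟨a, hS a ha⟩
      ⟨b, hL b (Finset.mem_insert_self _ _)⟩).exists_isPath
    set p' := p.map (SimpleGraph.Embedding.induce (G := G) C).toHom with hp'
    have hp'p : p'.IsPath := hp.map
      (SimpleGraph.Embedding.induce (G := G) C).injective
    have hsup : ∀ x ∈ p'.support, x ∈ C := by
      intro x hx
      rw [hp', SimpleGraph.Walk.support_map, List.mem_map] at hx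
      obtain ⟨y, -, rfl⟩ := hx
      exact y.2
    -- Only the part of the path after its last vertex in `S` is added. It meets the tree in its
    -- first vertex only and contributes at most two edges at any vertex.
    obtain ⟨c, hc, q, hq, hqp, hqS⟩ := hp'p.exists_last_exit p' ⟨a, p'.start_mem_support, ha⟩
    refine ⟨_, _, h.append_path q hq hc hqS, ?_, ?_, ?_⟩
    · refine Finset.insert_subset ?_ (hLS.trans Finset.subset_union_left)
      exact Finset.mem_union_right _ (List.mem_toFinset.2 q.end_mem_support)
    · intro x hx
      rcases Finset.mem_union.1 hx with hx | hx
      · exact hS x hx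
      · exact hsup x (hqp x (List.mem_toFinset.1 hx))
    · intro v
      rw [Finset.filter_union]
      refine (Finset.card_union_le _ _).trans ?_
      have := hq.card_edges_at_le v
      have := hdeg v
      omega

end Trees

/-! ### Shortest polygonal paths and straight drawings. -/

/-- Two points are adjacent if their segment lies in `U`. -/
def segmentGraph (U : Set Plane) : SimpleGraph Plane where
  Adj x y := x ≠ y ∧ segment ℝ x y ⊆ U
  symm := ⟨fun x y h => ⟨h.1.symm, segment_symm ℝ x y ▸ h.2⟩⟩
  loopless := ⟨fun _ h => h.1 rfl⟩

theorem segmentGraph.exists_walk {U : Set Plane} {x y : Plane} (h : segment ℝ x y ⊆ U) :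
    ∃ p : (segmentGraph U).Walk x y, p.length ≤ 1 := by
  by_cases hxy : x = y
  · subst hxy
    exact ⟨.nil, by simp⟩
  · exact ⟨.cons (show (segmentGraph U).Adj x y from ⟨hxy, h⟩) .nil, by simp⟩

/-- The two segments leave `m` in the same direction, so the longer one contains both `x` and `y`.
-/
theorem segment_subset_union_of_mem {x y m z : Plane} (hx : z ∈ segment ℝ x m)
    (hy : z ∈ segment ℝ m y) (hz : z ≠ m) : segment ℝ x y ⊆ segment ℝ x m ∪ segment ℝ m y := by
  rw [segment_symm ℝ x m, segment_eq_image'] at hx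
  rw [segment_eq_image'] at hy
  obtain ⟨s, ⟨hs0, hs1⟩, rfl⟩ := hx
  obtain ⟨t, ⟨ht0, ht1⟩, h⟩ := hy
  simp only [add_right_inj] at h
  have hs : 0 < s := hs0.lt_of_ne (by rintro rfl; simp at hz)
  have hx : x - m = (t / s) • (y - m) := by
    rw [div_eq_inv_mul, mul_smul, h, smul_smul, inv_mul_cancel₀ hs.ne', one_smul]
  set c := t / s with hc
  have hc0 : 0 ≤ c := div_nonneg ht0 hs0
  rw [segment_eq_image']
  rintro _ ⟨r, ⟨hr0, hr1⟩, rfl⟩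
  have e : x + r • (y - x) = m + ((1 - r) * c + r) • (y - m) := by
    calc x + r • (y - x) = m + ((1 - r) • (x - m) + r • (y - m)) := by module
      _ = _ := by rw [hx]; module
  simp only
  rw [e]
  have hd0 : 0 ≤ (1 - r) * c + r := by have := mul_nonneg (sub_nonneg.2 hr1) hc0; linarith
  rcases le_or_gt ((1 - r) * c + r) 1 with h1 | h1
  · right
    rw [segment_eq_image']
    exact ⟨_, ⟨hd0, h1⟩, rfl⟩
  · left
    have hc1 : 1 < c := by by_contra hcon; push Not at hcon; nlinarith
    rw [segment_symm, segment_eq_image']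
    refine ⟨((1 - r) * c + r) / c, ⟨div_nonneg hd0 hc0, ?_⟩, ?_⟩
    · rw [div_le_one (by linarith)]
      nlinarith
    · simp only
      rw [hx, smul_smul, div_mul_cancel₀ _ (by linarith)]

section Shortest

variable {U : Set Plane} {a b : Plane} {p : (segmentGraph U).Walk a b}

/-- Replacing the portion of `p` between its vertices `k` and `l` by `q` cannot give a shorter walk.
-/
theorem le_add_length_of_shortest (hp : p.length = (segmentGraph U).dist a b) {k l : ℕ}
    (hl : l ≤ p.length) (q : (segmentGraph U).Walk (p.getVert k) (p.getVert l)) :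
    l ≤ k + q.length := by
  have := SimpleGraph.dist_le (((p.take k).append q).append (p.drop l))
  rw [← hp, SimpleGraph.Walk.length_append, SimpleGraph.Walk.length_append,
    SimpleGraph.Walk.take_length, SimpleGraph.Walk.drop_length] at this
  have := min_le_left k p.length
  omega

/-- A polygonal path with the fewest vertices in a given set does not intersect itself. -/
theorem eq_getVert_of_shortest (hp : p.length = (segmentGraph U).dist a b) {i j : ℕ} (hij : i < j)
    (hj : j < p.length) {z : Plane} (hzi : z ∈ segment ℝ (p.getVert i) (p.getVert (i + 1)))
    (hzj : z ∈ segment ℝ (p.getVert j) (p.getVert (j + 1))) :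
    j = i + 1 ∧ z = p.getVert (i + 1) := by
  have hUi := (p.adj_getVert_succ (hij.trans hj)).2
  have hUj := (p.adj_getVert_succ hj).2
  have h1 : segment ℝ (p.getVert i) z ⊆ U :=
    ((convex_segment _ _).segment_subset (left_mem_segment ℝ _ _) hzi).trans hUi
  have h2 : segment ℝ z (p.getVert (j + 1)) ⊆ U :=
    ((convex_segment _ _).segment_subset hzj (right_mem_segment ℝ _ _)).trans hUj
  obtain ⟨q1, hq1⟩ := segmentGraph.exists_walk h1
  obtain ⟨q2, hq2⟩ := segmentGraph.exists_walk h2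
  -- The detour through `z` uses at most two segments, so the segments numbered `i` and `j` are
  -- consecutive.
  have h3 := le_add_length_of_shortest hp (show j + 1 ≤ p.length from hj) (q1.append q2)
  rw [SimpleGraph.Walk.length_append] at h3
  have hji : j = i + 1 := by omega
  subst hji
  refine ⟨rfl, ?_⟩
  by_contra hz
  -- If `z` is not their common end, the two segments overlap and one segment can replace them.
  have h4 := (segment_subset_union_of_mem hzi hzj hz).trans (union_subset hUi hUj)
  obtain ⟨q, hq⟩ := segmentGraph.exists_walk h4
  have := le_add_length_of_shortest hp (show i + 1 + 1 ≤ p.length from hj) q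
  omega

theorem eq_or_eq_of_shortest (hp : p.length = (segmentGraph U).dist a b) {i j : ℕ} (hij : i ≠ j)
    (hi : i < p.length) (hj : j < p.length) {z : Plane}
    (hzi : z ∈ segment ℝ (p.getVert i) (p.getVert (i + 1)))
    (hzj : z ∈ segment ℝ (p.getVert j) (p.getVert (j + 1))) :
    z = p.getVert i ∨ z = p.getVert (i + 1) := by
  rcases hij.lt_or_gt with h | h
  · exact Or.inr (eq_getVert_of_shortest hp h hj hzi hzj).2
  · obtain ⟨h1, h2⟩ := eq_getVert_of_shortest hp h hi hzj hzi
    left; rw [h1]; exact h2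

theorem getVert_of_mem_segment (hp : p.length = (segmentGraph U).dist a b) {i m : ℕ}
    (hi : i < p.length) (hm : m ≤ p.length)
    (hz : p.getVert m ∈ segment ℝ (p.getVert i) (p.getVert (i + 1))) :
    p.getVert m = p.getVert i ∨ p.getVert m = p.getVert (i + 1) := by
  rcases hm.lt_or_eq with h | h
  · by_cases hmi : i = m
    · left; rw [hmi]
    · exact eq_or_eq_of_shortest hp hmi hi h hz (left_mem_segment ℝ _ _)
  · obtain ⟨k, rfl⟩ : ∃ k, m = k + 1 := ⟨m - 1, by omega⟩
    by_cases hmi : i = k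
    · right; rw [hmi]
    · exact eq_or_eq_of_shortest hp hmi hi (by omega) hz (right_mem_segment ℝ _ _)

end Shortest

theorem segment_subset_of_mem_edges {U : Set Plane} {a b x y : Plane}
    {p : (segmentGraph U).Walk a b} (h : s(x, y) ∈ p.edges) : segment ℝ x y ⊆ U :=
  (show (segmentGraph U).Adj x y from p.adj_of_mem_edges h).2

/-- In each `U j` take a polygonal path with the fewest segments. It does not cross itself, by
minimality, and paths for different `j` meet only in ends because the sets `U j` do. -/
theorem exists_straight_of_sets {J : Type*} [Finite J] (U : J → Set Plane) (a b : J → Plane)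
    (hab : ∀ j, a j ≠ b j) (hr : ∀ j, (segmentGraph (U j)).Reachable (a j) (b j))
    (hU : ∀ j k, j ≠ k → ∀ z ∈ U j, z ∈ U k → (z = a j ∨ z = b j) ∧ (z = a k ∨ z = b k)) :
    ∃ Γ : SimpleGraph Plane, IsStraight Γ ∧ ∃ p : ∀ j, Γ.Walk (a j) (b j),
      (∀ j, (p j).IsPath) ∧ (∀ j, ∀ x ∈ (p j).support, x ∈ U j) ∧
      ∀ j k, j ≠ k → ∀ e ∈ (p j).edges, e ∉ (p k).edges := by
  choose p hpp hp using fun j => (hr j).exists_path_of_dist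
  let Γ : SimpleGraph Plane := SimpleGraph.fromEdgeSet {e | ∃ j, e ∈ (p j).edges}
  have hadj : ∀ {x y}, Γ.Adj x y → ∃ j, s(x, y) ∈ (p j).edges := fun h =>
    ((SimpleGraph.fromEdgeSet_adj _).1 h).1
  have hmem : ∀ j e, e ∈ (p j).edges → e ∈ Γ.edgeSet := by
    intro j e he
    rw [SimpleGraph.edgeSet_fromEdgeSet]
    exact ⟨⟨j, he⟩, (segmentGraph (U j)).not_isDiag_of_mem_edgeSet ((p j).edges_subset_edgeSet he)⟩
  have hsame : ∀ j x y x' y', s(x, y) ∈ (p j).edges → s(x', y') ∈ (p j).edges →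
      s(x, y) ≠ s(x', y') → ∀ z ∈ segment ℝ x y, z ∈ segment ℝ x' y' → z = x ∨ z = y := by
    intro j x y x' y' h h' hne z hz hz'
    obtain ⟨i, hi, hi'⟩ := (p j).mk_mem_edges_iff_exists.1 h
    obtain ⟨k, hk, hk'⟩ := (p j).mk_mem_edges_iff_exists.1 h'
    have hik : i ≠ k := by
      rintro rfl
      exact hne (hi'.symm.trans hk')
    rw [← edgeSegment_mk, ← hi'] at hz
    rw [← edgeSegment_mk, ← hk'] at hz'
    have := eq_or_eq_of_shortest (hp j) hik hi hk hz hz'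
    rw [← Sym2.mem_iff, hi'] at this
    exact Sym2.mem_iff.1 this
  have hend : ∀ j x y, s(x, y) ∈ (p j).edges → ∀ z ∈ segment ℝ x y, z = a j ∨ z = b j →
      z = x ∨ z = y := by
    intro j x y h z hz hab
    obtain ⟨i, hi, hi'⟩ := (p j).mk_mem_edges_iff_exists.1 h
    obtain ⟨m, hm, rfl⟩ : ∃ m ≤ (p j).length, (p j).getVert m = z := by
      rcases hab with rfl | rfl
      · exact ⟨0, by simp, by simp⟩
      · exact ⟨(p j).length, le_rfl, by simp⟩
    rw [← edgeSegment_mk, ← hi'] at hz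
    have := getVert_of_mem_segment (hp j) hi hm hz
    rw [← Sym2.mem_iff, hi'] at this
    exact Sym2.mem_iff.1 this
  refine ⟨Γ, ⟨?_, ?_⟩, fun j => (p j).transfer Γ (hmem j), ?_, ?_, ?_⟩
  · have : Γ.edgeSet ⊆ ⋃ j, {e | e ∈ (p j).edges} := by
      intro e he
      induction e with
      | h x y => exact mem_iUnion.2 (hadj he)
    exact (finite_iUnion fun j => (p j).edges.finite_toSet).subset this
  · intro x y x' y' h h' hne z hz hz'
    obtain ⟨j, hj⟩ := hadj h
    obtain ⟨k, hk⟩ := hadj h'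
    by_cases hjk : j = k
    · subst hjk
      exact ⟨hsame j _ _ _ _ hj hk hne z hz hz', hsame j _ _ _ _ hk hj hne.symm z hz' hz⟩
    · obtain ⟨h1, h2⟩ := hU j k hjk z (segment_subset_of_mem_edges hj hz)
        (segment_subset_of_mem_edges hk hz')
      exact ⟨hend j x y hj z hz h1, hend k x' y' hk z hz' h2⟩
  · exact fun j => (hpp j).transfer _
  · intro j x hx
    rw [SimpleGraph.Walk.support_transfer] at hx
    have hnil : ¬ (p j).Nil := SimpleGraph.Walk.not_nil_of_ne (hab j)
    obtain ⟨e, he, hxe⟩ := (SimpleGraph.Walk.mem_support_iff_exists_mem_edges_of_not_nil hnil).1 hx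
    obtain ⟨y, rfl⟩ := hxe
    exact segment_subset_of_mem_edges he (left_mem_segment ℝ _ _)
  · intro j k hjk e he he'
    rw [SimpleGraph.Walk.edges_transfer] at he he'
    induction e with
    | h x y =>
      -- The midpoint of a shared edge would be an end of the path for `j`, hence an end of that
      -- edge, which is absurd.
      have hm : midpoint ℝ x y ∈ segment ℝ x y := midpoint_mem_segment x y
      have hne : x ≠ y := ((p j).adj_of_mem_edges he).1
      have h1 := hU j k hjk _ (segment_subset_of_mem_edges he hm)
        (segment_subset_of_mem_edges he' hm)
      rcases hend j x y he _ hm h1.1 with h | h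
      · exact hne (by simpa using h)
      · exact hne (by simpa [eq_comm] using h)

/-! ### From arbitrary arcs to thin sets meeting only at vertices. -/

/-- `M` runs from the last point of the arc on the circle about `p` to the first later point on the
circle about `q`. -/
theorem exists_middle_arc {A : Set Plane} {p q : Plane} {r : ℝ} (hA : IsArcBetween A p q)
    (hr : 0 < r) (hpq : 2 * r < dist p q) :
    ∃ x y M, M ⊆ A ∧ IsCompact M ∧ IsPreconnected M ∧ x ∈ M ∧ y ∈ M ∧ dist x p = r ∧
      dist y q = r ∧ ∀ z ∈ M, r ≤ dist z p ∧ r ≤ dist z q := by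
  obtain ⟨g, gc, -, rfl, rfl, rfl⟩ := hA.exists_real
  have hcp : Continuous fun t => dist (g t) (g 0) := by fun_prop
  have hcq : Continuous fun t => dist (g t) (g 1) := by fun_prop
  have hp1 : r < dist (g 1) (g 0) := by rw [dist_comm]; linarith
  obtain ⟨s, ⟨hs, hsr⟩, hsmax⟩ := (isCompact_Icc.inter_right
    (isClosed_eq hcp continuous_const) : IsCompact (Icc (0 : ℝ) 1 ∩ {t | dist (g t) (g 0) = r}))
    |>.exists_isGreatest (by
      obtain ⟨t, ht, h⟩ := intermediate_value_Icc zero_le_one hcp.continuousOn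
        (show r ∈ Icc (dist (g 0) (g 0)) (dist (g 1) (g 0)) from ⟨by simp [hr.le], hp1.le⟩)
      exact ⟨t, ht, h⟩)
  have hsr' : dist (g s) (g 0) = r := hsr
  have hgt : ∀ t ∈ Icc s 1, r ≤ dist (g t) (g 0) := by
    intro t ht
    by_contra hlt
    push Not at hlt
    obtain ⟨t', ht', h⟩ := intermediate_value_Icc ht.2 hcp.continuousOn
      (show r ∈ Icc (dist (g t) (g 0)) (dist (g 1) (g 0)) from ⟨hlt.le, hp1.le⟩)
    have h1 : t' ≤ s := hsmax ⟨⟨hs.1.trans (ht.1.trans ht'.1), ht'.2⟩, h⟩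
    have : t = s := le_antisymm (ht'.1.trans h1) ht.1
    rw [this, hsr'] at hlt
    exact lt_irrefl _ hlt
  have hqs : r < dist (g s) (g 1) := by
    have := dist_triangle_left (g 0) (g 1) (g s)
    linarith
  obtain ⟨t, ⟨ht, htr⟩, htmin⟩ := (isCompact_Icc.inter_right
    (isClosed_eq hcq continuous_const) : IsCompact (Icc s 1 ∩ {t | dist (g t) (g 1) = r}))
    |>.exists_isLeast (by
      obtain ⟨t, ht, h⟩ := intermediate_value_Icc' hs.2 hcq.continuousOn
        (show r ∈ Icc (dist (g 1) (g 1)) (dist (g s) (g 1)) from ⟨by simp [hr.le], hqs.le⟩)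
      exact ⟨t, ht, h⟩)
  refine ⟨g s, g t, g '' Icc s t, image_mono (Icc_subset_Icc hs.1 ht.2),
    isCompact_Icc.image gc, isPreconnected_Icc.image _ gc.continuousOn,
    ⟨s, ⟨le_rfl, ht.1⟩, rfl⟩, ⟨t, ⟨ht.1, le_rfl⟩, rfl⟩, hsr', htr, ?_⟩
  rintro _ ⟨t', ht', rfl⟩
  refine ⟨hgt t' ⟨ht'.1, ht'.2.trans ht.2⟩, ?_⟩
  by_contra hlt
  push Not at hlt
  obtain ⟨t'', ht'', h⟩ := intermediate_value_Icc' ht'.1 hcq.continuousOn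
    (show r ∈ Icc (dist (g t') (g 1)) (dist (g s) (g 1)) from ⟨hlt.le, hqs.le⟩)
  have h1 : t ≤ t'' := htmin ⟨⟨ht''.1, ht''.2.trans (ht'.2.trans ht.2)⟩, h⟩
  have : t' = t := le_antisymm ht'.2 (h1.trans ht''.2)
  have htr' : dist (g t) (g 1) = r := htr
  rw [this, htr'] at hlt
  exact lt_irrefl _ hlt

theorem eventually_disjoint_thickening {K C : Set Plane} (hK : IsCompact K) (hC : IsClosed C)
    (h : Disjoint K C) :
    ∀ᶠ ε in 𝓝[>] (0 : ℝ), Disjoint (Metric.thickening ε K) (Metric.thickening ε C) := by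
  obtain ⟨δ, hδ, hd⟩ := h.exists_thickenings hK hC
  filter_upwards [mem_nhdsWithin_of_mem_nhds (Iio_mem_nhds hδ)] with ε hε
  exact hd.mono (Metric.thickening_mono (le_of_lt hε) _) (Metric.thickening_mono (le_of_lt hε) _)

theorem infinite_sphere_plane (c : Plane) {ρ : ℝ} (hρ : 0 < ρ) : (Metric.sphere c ρ).Infinite := by
  have hi : (Icc (0 : ℝ) 1).Infinite := Icc_infinite zero_lt_one
  refine (hi.image (f := fun t => c + ρ • (!₂[t, √(1 - t ^ 2)] : Plane)) ?_).mono ?_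
  · intro s _ t _ h
    simp only [add_right_inj] at h
    have := congrArg (fun z : Plane => z 0) h
    simpa [hρ.ne'] using this
  · rintro _ ⟨t, ht, rfl⟩
    have h1 : 0 ≤ 1 - t ^ 2 := by nlinarith [ht.1, ht.2]
    simp only [mem_sphere_iff_norm, add_sub_cancel_left, norm_smul, Real.norm_of_nonneg hρ.le]
    rw [EuclideanSpace.norm_eq]
    simp [Real.sq_sqrt h1]

theorem exists_injective_sphere {W : Type*} [Finite W] (c : Plane) {ρ : ℝ} (hρ : 0 < ρ)
    {Z : Set Plane} (hZ : Z.Finite) :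
    ∃ f : W → Plane, Function.Injective f ∧ ∀ w, dist (f w) c = ρ ∧ f w ∉ Z := by
  have hi := (infinite_sphere_plane c hρ).sdiff hZ
  have : Infinite (Metric.sphere c ρ \ Z : Set Plane) := hi.to_subtype
  obtain ⟨n, ⟨e⟩⟩ := Finite.exists_equiv_fin W
  let h := Infinite.natEmbedding (Metric.sphere c ρ \ Z : Set Plane)
  refine ⟨fun w => h (e w), fun x y hxy => ?_, fun w => ⟨(h (e w)).2.1, (h (e w)).2.2⟩⟩
  exact e.injective (Fin.val_injective (h.injective (Subtype.val_injective hxy)))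

/-- Two segments from `c` with a second common point have the same direction. -/
theorem smul_eq_smul_of_mem_segments {c x y z : Plane} (hx : z ∈ segment ℝ c x)
    (hy : z ∈ segment ℝ c y) (hz : z ≠ c) : ‖y - c‖ • (x - c) = ‖x - c‖ • (y - c) := by
  rw [segment_eq_image'] at hx hy
  obtain ⟨s, ⟨hs0, hs1⟩, rfl⟩ := hx
  obtain ⟨t, ⟨ht0, ht1⟩, h⟩ := hy
  simp only [add_right_inj] at h
  have hs : 0 < s := hs0.lt_of_ne (by rintro rfl; simp at hz)
  have hn : t * ‖y - c‖ = s * ‖x - c‖ := by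
    have := congrArg norm h
    rwa [norm_smul, norm_smul, Real.norm_of_nonneg hs0, Real.norm_of_nonneg ht0] at this
  have hx : x - c = (t / s) • (y - c) := by
    rw [div_eq_inv_mul, mul_smul, h, smul_smul, inv_mul_cancel₀ hs.ne', one_smul]
  rw [hx, norm_smul, smul_smul, Real.norm_of_nonneg (div_nonneg ht0 hs0), mul_comm]

theorem dist_le_of_mem_segment {c x z : Plane} (h : z ∈ segment ℝ c x) : dist z c ≤ dist x c := by
  have : segment ℝ c x ⊆ Metric.closedBall c (dist x c) :=
    (convex_closedBall c _).segment_subset (Metric.mem_closedBall_self dist_nonneg)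
      (Metric.mem_closedBall.2 le_rfl)
  exact this h

theorem eq_of_mem_segment_of_dist_le {c x z : Plane} (h : z ∈ segment ℝ c x)
    (hd : dist x c ≤ dist z c) : z = x := by
  rw [segment_eq_image'] at h
  obtain ⟨s, ⟨hs0, hs1⟩, rfl⟩ := h
  by_cases hxc : x = c
  · simp [hxc]
  simp only [dist_eq_norm, add_sub_cancel_left, norm_smul, Real.norm_of_nonneg hs0] at hd
  have : 0 < ‖x - c‖ := norm_pos_iff.2 (sub_ne_zero.2 hxc)
  have : s = 1 := by nlinarith
  simp [this]

/-- A point of `M` is joined to all nearby points by segments in a ball inside `U`; preconnectedness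
spreads this over `M`. -/
theorem reachable_thickening {M U : Set Plane} (hM : IsPreconnected M) {ε : ℝ} (hε : 0 < ε)
    (hU : Metric.thickening ε M ⊆ U) {x y : Plane} (hx : x ∈ M) (hy : y ∈ M) :
    (segmentGraph U).Reachable x y := by
  refine hM.induction₂ (fun x y => (segmentGraph U).Reachable x y) ?_
    (fun x y z _ _ _ => SimpleGraph.Reachable.trans) (fun x y _ _ => SimpleGraph.Reachable.symm)
    hx hy
  intro x hx
  filter_upwards [mem_nhdsWithin_of_mem_nhds (Metric.ball_mem_nhds x hε)] with y hy
  have : segment ℝ x y ⊆ U :=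
    ((convex_ball x ε).segment_subset (Metric.mem_ball_self hε) hy).trans
      ((Metric.ball_subset_thickening hx ε).trans hU)
  exact (segmentGraph.exists_walk this).choose.reachable

/-- The arcs of a plane drawing can be replaced by thin sets that are connected by polygonal
paths, with any number of additional segments issuing from every vertex. -/
theorem exists_sets_of_arcs {V E W : Type*} [Finite V] [Finite E] [Finite W] {pt : V → Plane}
    (hpt : Function.Injective pt) {c : E → Bool → V} (hc : ∀ e, c e true ≠ c e false)
    {α : E → Set Plane} (hα : ∀ e, IsArcBetween (α e) (pt (c e true)) (pt (c e false)))
    (hend : ∀ e v, pt v ∈ α e → ∃ i, v = c e i)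
    (hdisj : ∀ e f, e ≠ f → ∀ z ∈ α e, z ∈ α f → z ∈ range pt) :
    ∃ (U : E ⊕ (W × V) → Set Plane) (tip : W × V → Plane), (∀ k v, tip k ≠ pt v) ∧
      (∀ e, (segmentGraph (U (.inl e))).Reachable (pt (c e true)) (pt (c e false))) ∧
      (∀ k, (segmentGraph (U (.inr k))).Reachable (pt k.2) (tip k)) ∧
      (∀ e f, e ≠ f → ∀ z ∈ U (.inl e), z ∈ U (.inl f) →
        (∃ i, z = pt (c e i)) ∧ ∃ i, z = pt (c f i)) ∧
      (∀ e k, ∀ z ∈ U (.inl e), z ∈ U (.inr k) → (∃ i, z = pt (c e i)) ∧ z = pt k.2) ∧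
      ∀ k k', k ≠ k' → ∀ z ∈ U (.inr k), z ∈ U (.inr k') → z = pt k.2 ∧ z = pt k'.2 := by
  -- the radius of the discs
  have ev1 : ∀ᶠ r in 𝓝[>] (0 : ℝ), ∀ v v', v ≠ v' → 2 * r < dist (pt v) (pt v') := by
    refine eventually_all.2 fun v => eventually_all.2 fun v' => ?_
    by_cases h : v = v'
    · exact Eventually.of_forall fun r h' => absurd h h'
    · filter_upwards [eventually_mul_lt 2 (dist_pos.2 (hpt.ne h))] with r hr _
      linarith
  have ev2 : ∀ᶠ r in 𝓝[>] (0 : ℝ), ∀ e v, (∀ i, v ≠ c e i) → ∀ z ∈ α e, r ≤ dist z (pt v) := by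
    refine eventually_all.2 fun e => eventually_all.2 fun v => ?_
    by_cases h : ∀ i, v ≠ c e i
    · have hv : pt v ∈ (α e)ᶜ := fun h' => (hend e v h').elim h
      obtain ⟨ρ, hρ, hb⟩ := Metric.isOpen_iff.1 (hα e).isCompact.isClosed.isOpen_compl _ hv
      filter_upwards [eventually_mul_lt 1 hρ] with r hr _ z hz
      by_contra hlt
      push Not at hlt
      exact hb (Metric.mem_ball.2 (by linarith)) hz
    · exact Eventually.of_forall fun r h' => absurd h' h
  obtain ⟨r, hr, hr1, hr2⟩ := (eventually_mem_nhdsWithin.and (ev1.and ev2)).exists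
  rw [mem_Ioi] at hr
  clear ev1 ev2
  -- the middle parts of the arcs
  have hmid : ∀ e, ∃ (x : Bool → Plane) (M : Set Plane), M ⊆ α e ∧ IsCompact M ∧
      IsPreconnected M ∧ (∀ i, x i ∈ M ∧ dist (x i) (pt (c e i)) = r) ∧
      ∀ z ∈ M, ∀ i, r ≤ dist z (pt (c e i)) := by
    intro e
    obtain ⟨x, y, M, h1, h2, h3, h4, h5, h6, h7, h8⟩ := exists_middle_arc (hα e) hr
      (hr1 _ _ (hc e))
    refine ⟨fun i => if i then x else y, M, h1, h2, h3, ?_, ?_⟩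
    · rintro (_ | _) <;> simp [h4, h5, h6, h7]
    · rintro z hz (_ | _)
      exacts [(h8 z hz).2, (h8 z hz).1]
  choose x M hMα hMc hMp hx hMr using hmid
  have hMr' : ∀ e, ∀ z ∈ M e, ∀ v, r ≤ dist z (pt v) := by
    intro e z hz v
    by_cases h : ∃ i, v = c e i
    · obtain ⟨i, rfl⟩ := h
      exact hMr e z hz i
    · push Not at h
      exact hr2 e v h z (hMα e hz)
  have hMM : ∀ e f, e ≠ f → Disjoint (M e) (M f) := by
    intro e f hef
    rw [disjoint_left]
    intro z hz hz'
    obtain ⟨v, rfl⟩ := hdisj e f hef z (hMα e hz) (hMα f hz')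
    have := hMr' e _ hz v
    rw [dist_self] at this
    linarith
  have hMs : ∀ e f, e ≠ f → ∀ i, Disjoint (M e) (segment ℝ (pt (c f i)) (x f i)) := by
    intro e f hef i
    rw [disjoint_left]
    intro z hz hz'
    have := eq_of_mem_segment_of_dist_le hz' ((hx f i).2.trans_le (hMr' e z hz _))
    exact disjoint_left.1 (hMM e f hef) hz (this ▸ (hx f i).1)
  have ev1 : ∀ᶠ ε in 𝓝[>] (0 : ℝ), ∀ e f, e ≠ f →
      Disjoint (Metric.thickening ε (M e)) (Metric.thickening ε (M f)) := by
    refine eventually_all.2 fun e => eventually_all.2 fun f => ?_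
    by_cases h : e = f
    · exact Eventually.of_forall fun r h' => absurd h h'
    · filter_upwards [eventually_disjoint_thickening (hMc e) (hMc f).isClosed (hMM e f h)]
        with ε hε _
      exact hε
  have ev2 : ∀ᶠ ε in 𝓝[>] (0 : ℝ), ∀ e f, e ≠ f → ∀ i,
      Disjoint (Metric.thickening ε (M e))
        (Metric.thickening ε (segment ℝ (pt (c f i)) (x f i))) := by
    refine eventually_all.2 fun e => eventually_all.2 fun f => ?_
    by_cases h : e = f
    · exact Eventually.of_forall fun r h' => absurd h h'
    · filter_upwards [eventually_all.2 fun i => eventually_disjoint_thickening (hMc e)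
        (isCompact_segment _ _).isClosed (hMs e f h i)] with ε hε _
      exact hε
  -- The middle parts avoid the open discs of radius `r`, so with `2 * ε < r` their thickenings stay
  -- away from the discs of radius `r / 2`, which contain the additional segments.
  obtain ⟨ε, hε, hε1, hε2, hε3⟩ := (eventually_mem_nhdsWithin.and
    (ev1.and (ev2.and (eventually_mul_lt 2 hr)))).exists
  rw [mem_Ioi] at hε
  clear ev1 ev2
  -- the additional segments
  have hbad : ∀ v, {z | ∃ e i, z = midpoint ℝ (pt v) (x e i)}.Finite := by
    intro v
    refine (finite_range fun q : E × Bool => midpoint ℝ (pt v) (x q.1 q.2)).subset ?_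
    rintro _ ⟨e, i, rfl⟩
    exact ⟨(e, i), rfl⟩
  -- Spokes have length `r` and whiskers length `r / 2`. A whisker in the direction of a spoke would
  -- end at its midpoint, so avoiding the midpoints gives the whiskers new directions.
  choose tip htip htip' using fun v => exists_injective_sphere (W := W) (pt v) (half_pos hr) (hbad v)
  have hsame : ∀ v v' z, dist z (pt v) ≤ r → dist z (pt v') ≤ r → v = v' := by
    intro v v' z h h'
    by_contra hne
    have := hr1 v v' hne
    have := dist_triangle_left (pt v) (pt v') z
    linarith
  have hspoke : ∀ e i, ∀ z ∈ segment ℝ (pt (c e i)) (x e i), dist z (pt (c e i)) ≤ r :=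
    fun e i z hz => (dist_le_of_mem_segment hz).trans (hx e i).2.le
  have hwhisk : ∀ v w, ∀ z ∈ segment ℝ (pt v) (tip v w), dist z (pt v) ≤ r / 2 :=
    fun v w z hz => (dist_le_of_mem_segment hz).trans (htip' v w).1.le
  refine ⟨Sum.elim (fun e => (⋃ i, segment ℝ (pt (c e i)) (x e i)) ∪ Metric.thickening ε (M e))
    (fun k => segment ℝ (pt k.2) (tip k.2 k.1)), fun k => tip k.2 k.1, ?_, ?_, ?_, ?_, ?_, ?_⟩
  · rintro ⟨w, v⟩ v' h
    simp only at h
    have h1 := (htip' v w).1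
    have h2 := hsame v v' (tip v w) (by linarith) (by rw [h, dist_self]; exact hr.le)
    subst h2
    rw [h, dist_self] at h1
    linarith
  · intro e
    have hs : ∀ i, (segmentGraph ((⋃ i, segment ℝ (pt (c e i)) (x e i)) ∪
        Metric.thickening ε (M e))).Reachable (pt (c e i)) (x e i) := fun i =>
      (segmentGraph.exists_walk (subset_union_of_subset_left
        (subset_iUnion (fun i => segment ℝ (pt (c e i)) (x e i)) i) _)).choose.reachable
    exact (hs true).trans ((reachable_thickening (hMp e) hε subset_union_right
      (hx e true).1 (hx e false).1).trans (hs false).symm)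
  · exact fun k => (segmentGraph.exists_walk subset_rfl).choose.reachable
  · intro e f hef z hz hz'
    simp only [Sum.elim_inl, mem_union, mem_iUnion] at hz hz'
    rcases hz with ⟨i, hz⟩ | hz <;> rcases hz' with ⟨j, hz'⟩ | hz'
    · have hij := hsame _ _ z (hspoke e i z hz) (hspoke f j z hz')
      -- Two spokes with a further common point have the same direction and the same length `r`, so
      -- they end in the same point of `M e` and `M f`, which are disjoint.
      have : z = pt (c e i) := by
        by_contra hne
        have h1 := smul_eq_smul_of_mem_segments hz (hij ▸ hz') hne
        have h2 := (hx f j).2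
        rw [← hij] at h2
        rw [← dist_eq_norm, ← dist_eq_norm, h2, (hx e i).2] at h1
        have h3 := sub_left_injective (smul_right_injective _ hr.ne' h1)
        exact disjoint_left.1 (hMM e f hef) (hx e i).1 (h3 ▸ (hx f j).1)
      exact ⟨⟨i, this⟩, ⟨j, hij ▸ this⟩⟩
    · exact absurd (Metric.self_subset_thickening hε _ hz)
        (disjoint_left.1 (hε2 f e hef.symm i) hz')
    · exact absurd (Metric.self_subset_thickening hε _ hz')
        (disjoint_left.1 (hε2 e f hef j) hz)
    · exact absurd hz' (disjoint_left.1 (hε1 e f hef) hz)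
  · rintro e ⟨w, v⟩ z hz hz'
    simp only [Sum.elim_inl, Sum.elim_inr, mem_union, mem_iUnion] at hz hz'
    have h0 := hwhisk v w z hz'
    rcases hz with ⟨i, hz⟩ | hz
    · have hij := hsame _ _ z (hspoke e i z hz) (show dist z (pt v) ≤ r by linarith)
      subst hij
      have : z = pt (c e i) := by
        by_contra hne
        have h1 := smul_eq_smul_of_mem_segments hz hz' hne
        rw [← dist_eq_norm, ← dist_eq_norm, (htip' _ w).1, (hx e i).2] at h1
        refine (htip' (c e i) w).2 ⟨e, i, ?_⟩
        rw [midpoint_eq_smul_add]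
        have h3 : tip (c e i) w - pt (c e i) = (1 / 2 : ℝ) • (x e i - pt (c e i)) := by
          refine smul_right_injective _ hr.ne' ?_
          simp only
          rw [← h1, smul_smul]
          congr 1
          ring
        rw [sub_eq_iff_eq_add] at h3
        rw [h3, invOf_eq_inv]
        module
      exact ⟨⟨i, this⟩, this⟩
    · exfalso
      obtain ⟨y, hy, hzy⟩ := Metric.mem_thickening_iff.1 hz
      have h1 := hMr' e y hy v
      have h2 := dist_triangle_left y (pt v) z
      linarith
  · rintro ⟨w, v⟩ ⟨w', v'⟩ hne z hz hz'
    simp only [Sum.elim_inr] at hz hz'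
    have h0 := hwhisk v w z hz
    have h0' := hwhisk v' w' z hz'
    have hij := hsame v v' z (by linarith) (by linarith)
    subst hij
    have : z = pt v := by
      by_contra hzv
      have h1 := smul_eq_smul_of_mem_segments hz hz' hzv
      rw [← dist_eq_norm, ← dist_eq_norm, (htip' _ w).1, (htip' _ w').1] at h1
      have h3 := sub_left_injective (smul_right_injective _ (half_pos hr).ne' h1)
      exact hne (by rw [htip v h3])
    exact ⟨this, this⟩

/-! ### Networks: the polygonal drawing with whiskers, and lifted trees. -/

namespace Multigraph

/-- The curves at the vertex `v`: the edges of `G` at `v`, and one whisker for every element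
of `W`. -/
def Inc (G : Multigraph) (W : Type) (v : G.V) : G.toSimpleGraph.edgeSet ⊕ (W × G.V) → Prop :=
  Sum.elim (fun e => v ∈ e.1) (fun k => v = k.2)

/-- A straight drawing of a subdivision of `G` with additional paths (whiskers) issuing from
the vertices, one at every vertex for every element of `W`. -/
structure Network (G : Multigraph) (W : Type) where
  graph : SimpleGraph Plane
  straight : IsStraight graph
  pt : G.V → Plane
  pt_injective : Function.Injective pt
  verts : G.toSimpleGraph.edgeSet ⊕ (W × G.V) → Finset Plane
  edges : G.toSimpleGraph.edgeSet ⊕ (W × G.V) → Finset (Sym2 Plane)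
  exists_path_edge : ∀ v w (h : s(v, w) ∈ G.toSimpleGraph.edgeSet),
    ∃ q : graph.Walk (pt v) (pt w), q.IsPath ∧ q.support.toFinset = verts (.inl ⟨s(v, w), h⟩) ∧
      q.edges.toFinset = edges (.inl ⟨s(v, w), h⟩)
  exists_path_whisker : ∀ k : W × G.V, ∃ t, t ≠ pt k.2 ∧ ∃ q : graph.Walk (pt k.2) t,
    q.IsPath ∧ q.support.toFinset = verts (.inr k) ∧ q.edges.toFinset = edges (.inr k)
  overlap : ∀ j k, j ≠ k → ∀ x ∈ verts j, x ∈ verts k → ∃ v, G.Inc W v j ∧ G.Inc W v k ∧ x = pt v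
  edges_disjoint : ∀ j k, j ≠ k → ∀ e ∈ edges j, e ∉ edges k

theorem exists_isPath_of_eq {Γ : SimpleGraph Plane} {a b x y : Plane} (p : Γ.Walk a b)
    (hp : p.IsPath) (hx : a = x) (hy : b = y) : ∃ q : Γ.Walk x y, q.IsPath ∧
      q.support.toFinset = p.support.toFinset ∧ q.edges.toFinset = p.edges.toFinset := by
  subst hx hy
  exact ⟨p, hp, rfl, rfl⟩

theorem exists_network {G : Multigraph} (D : PlaneDrawing G) (W : Type) [Finite W] :
    Nonempty (Network G W) := by
  have hE : ∀ e : G.toSimpleGraph.edgeSet, ∃ v : Bool → G.V, e.1 = s(v true, v false) := by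
    rintro ⟨e, he⟩
    induction e with
    | h v w => exact ⟨fun i => if i then v else w, rfl⟩
  choose c hc using hE
  have hadj : ∀ e, G.mult (c e true) (c e false) ≠ 0 := fun e => by
    have := e.2
    rw [hc e] at this
    exact this
  have hne : ∀ e, c e true ≠ c e false := fun e h => hadj e (h ▸ G.loopless _)
  -- From each class of parallel edges only the arc with index 0 is kept; connectedness of vertex
  -- sets does not depend on the others.
  obtain ⟨U, tip, h1, h2, h3, h4, h5, h6⟩ := exists_sets_of_arcs (W := W) D.point_injective hne
    (α := fun e => D.arc (c e true) (c e false) 0)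
    (fun e => D.isArcBetween _ _ _ (Nat.pos_of_ne_zero (hadj e)))
    (fun e v hv => by
      rcases D.eq_end_of_mem _ _ _ _ (Nat.pos_of_ne_zero (hadj e)) hv with h | h
      exacts [⟨true, h⟩, ⟨false, h⟩])
    (fun e f hef z hz hz' => by
      refine D.mem_range_of_mem _ _ _ _ _ _ (Nat.pos_of_ne_zero (hadj e))
        (Nat.pos_of_ne_zero (hadj f)) ?_ z hz hz'
      intro h
      rw [← hc, ← hc] at h
      exact hef (Subtype.ext (congrArg Prod.fst h)))
  have hce : ∀ e i, c e i ∈ e.1 := by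
    rintro e (_ | _) <;> rw [hc e] <;> simp
  have hbool : ∀ e z, (∃ i, z = D.point (c e i)) →
      z = D.point (c e true) ∨ z = D.point (c e false) := by
    rintro e z ⟨_ | _, h⟩
    exacts [Or.inr h, Or.inl h]
  obtain ⟨Γ, hΓ, p, hp, hpU, hpe⟩ := exists_straight_of_sets U
    (Sum.elim (fun e => D.point (c e true)) (fun k => D.point k.2))
    (Sum.elim (fun e => D.point (c e false)) tip)
    (by
      rintro (e | k)
      · exact fun h => hne e (D.point_injective h)
      · exact fun h => h1 k k.2 h.symm)
    (by rintro (e | k); exacts [h2 e, h3 k])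
    (by
      rintro (e | k) (e' | k') hjk z hz hz'
      · obtain ⟨g1, g2⟩ := h4 e e' (fun h => hjk (h ▸ rfl)) z hz hz'
        exact ⟨hbool e z g1, hbool e' z g2⟩
      · obtain ⟨g1, g2⟩ := h5 e k' z hz hz'
        exact ⟨hbool e z g1, Or.inl g2⟩
      · obtain ⟨g1, g2⟩ := h5 e' k z hz' hz
        exact ⟨Or.inl g2, hbool e' z g1⟩
      · obtain ⟨g1, g2⟩ := h6 k k' (fun h => hjk (h ▸ rfl)) z hz hz'
        exact ⟨Or.inl g1, Or.inl g2⟩)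
  refine ⟨⟨Γ, hΓ, D.point, D.point_injective, fun j => (p j).support.toFinset,
    fun j => (p j).edges.toFinset, ?_, ?_, ?_, ?_⟩⟩
  · intro v w h
    have he := hc ⟨s(v, w), h⟩
    rcases Sym2.eq_iff.1 he with ⟨hv, hw⟩ | ⟨hv, hw⟩
    · exact exists_isPath_of_eq (p (.inl ⟨s(v, w), h⟩)) (hp _) (congrArg D.point hv.symm)
        (congrArg D.point hw.symm)
    · obtain ⟨q, hq, hqs, hqe⟩ := exists_isPath_of_eq (p (.inl ⟨s(v, w), h⟩)).reverse
        (hp _).reverse (congrArg D.point hv.symm) (congrArg D.point hw.symm)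
      exact ⟨q, hq, by rw [hqs, SimpleGraph.Walk.support_reverse, List.toFinset_reverse],
        by rw [hqe, SimpleGraph.Walk.edges_reverse, List.toFinset_reverse]⟩
  · exact fun k => ⟨tip k, h1 k k.2, p (.inr k), hp _, rfl, rfl⟩
  · intro j k hjk x hx hx'
    have hx := hpU j x (List.mem_toFinset.1 hx)
    have hx' := hpU k x (List.mem_toFinset.1 hx')
    rcases j with e | k' <;> rcases k with e' | k
    · obtain ⟨⟨i, g1⟩, i', g2⟩ := h4 e e' (fun h => hjk (h ▸ rfl)) x hx hx'
      have := D.point_injective (g1.symm.trans g2)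
      exact ⟨c e i, hce e i, (this ▸ hce e' i' : c e i ∈ e'.1), g1⟩
    · obtain ⟨⟨i, g1⟩, g2⟩ := h5 e k x hx hx'
      have := D.point_injective (g1.symm.trans g2)
      exact ⟨c e i, hce e i, this, g1⟩
    · obtain ⟨⟨i, g1⟩, g2⟩ := h5 e' k' x hx' hx
      have := D.point_injective (g1.symm.trans g2)
      exact ⟨c e' i, this, hce e' i, g1⟩
    · obtain ⟨g1, g2⟩ := h6 k' k (fun h => hjk (h ▸ rfl)) x hx hx'
      have := D.point_injective (g1.symm.trans g2)
      exact ⟨k'.2, rfl, this, g1⟩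
  · intro j k hjk e he he'
    exact hpe j k hjk e (List.mem_toFinset.1 he) (List.mem_toFinset.1 he')

namespace Network

variable {G : Multigraph} {W : Type} (N : Network G W)

theorem exists_path (v : G.V) {j : G.toSimpleGraph.edgeSet ⊕ (W × G.V)} (h : G.Inc W v j) :
    ∃ t, t ≠ N.pt v ∧ ∃ q : N.graph.Walk (N.pt v) t, q.IsPath ∧
      q.support.toFinset = N.verts j ∧ q.edges.toFinset = N.edges j := by
  rcases j with ⟨e, he⟩ | k
  · obtain ⟨w, rfl⟩ : v ∈ e := h
    obtain ⟨q, hq⟩ := N.exists_path_edge v w he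
    exact ⟨N.pt w, fun h => (show G.toSimpleGraph.Adj v w from he).ne (N.pt_injective h).symm, q, hq⟩
  · obtain rfl : v = k.2 := h
    exact N.exists_path_whisker k

theorem exists_inc (j : G.toSimpleGraph.edgeSet ⊕ (W × G.V)) : ∃ v, G.Inc W v j := by
  rcases j with ⟨e, he⟩ | k
  · induction e with
    | h v w => exact ⟨v, Sym2.mem_mk_left v w⟩
  · exact ⟨k.2, rfl⟩

theorem pt_mem_verts {v : G.V} {j : G.toSimpleGraph.edgeSet ⊕ (W × G.V)} (h : G.Inc W v j) :
    N.pt v ∈ N.verts j := by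
  obtain ⟨t, -, q, -, hq, -⟩ := N.exists_path v h
  rw [← hq]
  simp

theorem exists_edge_at {v : G.V} {j : G.toSimpleGraph.edgeSet ⊕ (W × G.V)} (h : G.Inc W v j) :
    ∃ e ∈ N.edges j, N.pt v ∈ e := by
  obtain ⟨t, ht, q, -, -, hq⟩ := N.exists_path v h
  have hnil : ¬ q.Nil := SimpleGraph.Walk.not_nil_of_ne ht.symm
  obtain ⟨e, he, hve⟩ :=
    (SimpleGraph.Walk.mem_support_iff_exists_mem_edges_of_not_nil hnil).1 q.start_mem_support
  exact ⟨e, by rw [← hq]; simpa using he, hve⟩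

theorem edge_at_unique {v : G.V} {j : G.toSimpleGraph.edgeSet ⊕ (W × G.V)} (h : G.Inc W v j)
    {e e' : Sym2 Plane} (he : e ∈ N.edges j) (he' : e' ∈ N.edges j) (hv : N.pt v ∈ e)
    (hv' : N.pt v ∈ e') : e = e' := by
  obtain ⟨t, ht, q, hqp, -, hq⟩ := N.exists_path v h
  rw [← hq, List.mem_toFinset] at he he'
  exact hqp.edge_at_start_unique he he' hv hv'

theorem mem_verts_of_mem {j : G.toSimpleGraph.edgeSet ⊕ (W × G.V)} {e : Sym2 Plane}
    (he : e ∈ N.edges j) {x : Plane} (hx : x ∈ e) : x ∈ N.verts j := by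
  obtain ⟨v, hv⟩ := exists_inc j
  obtain ⟨t, ht, q, -, hs, hq⟩ := N.exists_path v hv
  rw [← hq, List.mem_toFinset] at he
  rw [← hs, List.mem_toFinset]
  obtain ⟨y, rfl⟩ := hx
  exact q.fst_mem_support_of_mem_edges he

theorem mem_support_of_mem {j : G.toSimpleGraph.edgeSet ⊕ (W × G.V)} {x : Plane}
    (hx : x ∈ N.verts j) : x ∈ N.graph.support := by
  obtain ⟨v, hv⟩ := exists_inc j
  obtain ⟨t, ht, q, -, hs, hq⟩ := N.exists_path v hv
  rw [← hs, List.mem_toFinset] at hx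
  have hnil : ¬ q.Nil := SimpleGraph.Walk.not_nil_of_ne ht.symm
  obtain ⟨e, he, hxe⟩ := (SimpleGraph.Walk.mem_support_iff_exists_mem_edges_of_not_nil hnil).1 hx
  obtain ⟨y, rfl⟩ := hxe
  exact ⟨y, q.adj_of_mem_edges he⟩

/-- The curves of the tree with vertex set `S` and edge set `T`, with whiskers labelled `i`. -/
def Uses (i : W) (S : Finset G.V) (T : Finset (Sym2 G.V)) :
    G.toSimpleGraph.edgeSet ⊕ (W × G.V) → Prop :=
  Sum.elim (fun e => e.1 ∈ T) (fun k => k.1 = i ∧ k.2 ∈ S)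

open Classical in
theorem mem_of_uses {i : W} {S : Finset G.V} {T : Finset (Sym2 G.V)}
    (h : Grows G.toSimpleGraph S T) {j : G.toSimpleGraph.edgeSet ⊕ (W × G.V)} (hj : Uses i S T j)
    {v : G.V} (hv : G.Inc W v j) : v ∈ S := by
  rcases j with ⟨e, he⟩ | k
  · obtain ⟨w, rfl⟩ : v ∈ e := hv
    exact h.mem_of_mem hj
  · obtain rfl : v = k.2 := hv
    exact hj.2

open Classical in
/-- A tree of `G`, with its whiskers, is a tree of the drawing. -/
theorem exists_lift (i : W) {S : Finset G.V} {T : Finset (Sym2 G.V)}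
    (h : Grows G.toSimpleGraph S T) :
    ∃ (S' : Finset Plane) (T' : Finset (Sym2 Plane)), Grows N.graph S' T' ∧
      (∀ x, x ∈ S' ↔ ∃ j, Uses i S T j ∧ x ∈ N.verts j) ∧
      ∀ e, e ∈ T' ↔ ∃ j, Uses i S T j ∧ e ∈ N.edges j := by
  induction h with
  | single w =>
    obtain ⟨t, ht, q, hq, hqs, hqe⟩ := N.exists_path_whisker (i, w)
    have hiff : ∀ j : G.toSimpleGraph.edgeSet ⊕ (W × G.V), Uses i {w} ∅ j ↔ j = .inr (i, w) := by
      rintro (e | ⟨i', w'⟩) <;> simp [Uses]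
    refine ⟨_, _, (Grows.single (N.pt w)).append_path q hq (by simp) (by simp), ?_, ?_⟩
    · intro x
      simp only [hiff, exists_eq_left]
      rw [← hqs]
      simp only [Finset.mem_union, Finset.mem_singleton]
      constructor
      · rintro (rfl | h)
        · simp
        · exact h
      · exact Or.inr
    · intro x
      simp only [hiff, exists_eq_left]
      rw [← hqe]
      simp
  | @step S T v w h hv hw hvw ih =>
    obtain ⟨S', T', hg, hS', hT'⟩ := ih
    obtain ⟨q₁, hq₁, hq₁s, hq₁e⟩ := N.exists_path_edge v w hvw
    obtain ⟨t, ht, q₂, hq₂, hq₂s, hq₂e⟩ := N.exists_path_whisker (i, w)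
    have hiff : ∀ j : G.toSimpleGraph.edgeSet ⊕ (W × G.V),
        Uses i (insert w S) (insert s(v, w) T) j ↔
          (Uses i S T j ∨ j = .inl ⟨s(v, w), hvw⟩) ∨ j = .inr (i, w) := by
      rintro (e | ⟨i', w'⟩)
      · simp [Uses, Subtype.ext_iff, or_comm]
      · simp only [Uses, Sum.elim_inr, Finset.mem_insert, reduceCtorEq, or_false, Sum.inr.injEq,
          Prod.mk.injEq]
        tauto
    have hvS' : N.pt v ∈ S' := (hS' _).2 ⟨.inr (i, v), ⟨rfl, hv⟩, N.pt_mem_verts rfl⟩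
    -- Different curves of the network meet only in points of common vertices, so the new path meets
    -- the old tree only in `N.pt v`.
    have g1 := hg.append_path q₁ hq₁ hvS' (by
      intro x hx hxv hxS
      rw [← List.mem_toFinset, hq₁s] at hx
      obtain ⟨j, hj, hxj⟩ := (hS' x).1 hxS
      have hne : Sum.inl ⟨s(v, w), hvw⟩ ≠ j := by
        rintro rfl
        have hj' : s(v, w) ∈ T := hj
        rw [Sym2.eq_swap] at hj'
        exact hw (h.mem_of_mem hj')
      obtain ⟨v', h1, h2, rfl⟩ := N.overlap _ _ hne x hx hxj
      have hv' := mem_of_uses h hj h2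
      rcases Sym2.mem_iff.1 (show v' ∈ s(v, w) from h1) with rfl | rfl
      · exact hxv rfl
      · exact hw hv')
    have g2 := g1.append_path q₂ hq₂ (by simp) (by
      intro x hx hxw hxS
      rw [← List.mem_toFinset, hq₂s] at hx
      have : ∃ j, j ≠ Sum.inr (i, w) ∧ x ∈ N.verts j := by
        rcases Finset.mem_union.1 hxS with hxS | hxS
        · obtain ⟨j, hj, hxj⟩ := (hS' x).1 hxS
          exact ⟨j, by rintro rfl; exact hw hj.2, hxj⟩
        · rw [hq₁s] at hxS
          exact ⟨_, by simp, hxS⟩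
      obtain ⟨j, hj, hxj⟩ := this
      obtain ⟨v', h1, h2, rfl⟩ := N.overlap _ _ hj x hxj hx
      exact hxw (congrArg N.pt h2))
    refine ⟨_, _, g2, ?_, ?_⟩
    · intro x
      simp only [hiff, or_and_right, exists_or, exists_eq_left, Finset.mem_union, hS', hq₁s, hq₂s]
    · intro x
      simp only [hiff, or_and_right, exists_or, exists_eq_left, Finset.mem_union, hT', hq₁e, hq₂e]

variable {i i' : W} {S S' : Finset G.V} {T T' : Finset (Sym2 G.V)} {SΓ SΓ' : Finset Plane}
  {TΓ TΓ' : Finset (Sym2 Plane)}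

/-- The first edge of the whisker labelled `i'` at `v` lies in the second tree but not in the first,
whose whiskers carry the label `i`. This is the purpose of the whiskers: two trees that share a
vertex always leave each other there. -/
theorem leaves (hi : i ≠ i') (hS : ∀ x, x ∈ SΓ ↔ ∃ j, Uses i S T j ∧ x ∈ N.verts j)
    (hT : ∀ e, e ∈ TΓ ↔ ∃ j, Uses i S T j ∧ e ∈ N.edges j)
    (hT' : ∀ e, e ∈ TΓ' ↔ ∃ j, Uses i' S' T' j ∧ e ∈ N.edges j) {v : G.V} (hv : v ∈ S)
    (hv' : v ∈ S') : Leaves SΓ TΓ TΓ' := by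
  obtain ⟨e, he, hve⟩ := N.exists_edge_at (v := v) (j := .inr (i', v)) rfl
  refine ⟨e, (hT' e).2 ⟨_, show Uses i' S' T' (.inr (i', v)) from ⟨rfl, hv'⟩, he⟩, ?_, N.pt v, hve,
    (hS _).2 ⟨.inr (i, v), ⟨rfl, hv⟩, N.pt_mem_verts rfl⟩⟩
  intro h
  obtain ⟨j, hj, hej⟩ := (hT e).1 h
  by_cases hji : j = .inr (i', v)
  · subst hji
    exact hi hj.1.symm
  · exact N.edges_disjoint j _ hji e hej he

-- The sum counts pairs of an edge and one of its ends in the first tree. Such an end is `N.pt v`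
-- with `v` in both `S` and `S'`, and the edge is the only one at that point on its curve. The curve
-- is either one of at most `D` tree edges at `v`, or the whisker labelled `i'`, which is encoded by
-- `none`.
open Classical in
theorem sum_endsIn_le (hg : Grows G.toSimpleGraph S T) (hg' : Grows G.toSimpleGraph S' T')
    (hS : ∀ x, x ∈ SΓ ↔ ∃ j, Uses i S T j ∧ x ∈ N.verts j)
    (hT : ∀ e, e ∈ TΓ ↔ ∃ j, Uses i S T j ∧ e ∈ N.edges j)
    (hT' : ∀ e, e ∈ TΓ' ↔ ∃ j, Uses i' S' T' j ∧ e ∈ N.edges j) {D : ℕ}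
    (hD : ∀ v, (T'.filter (v ∈ ·)).card ≤ D) :
    ∑ e ∈ TΓ' \ TΓ, endsIn SΓ e ≤ (S ∩ S').card * (D + 1) := by
  have h1 : ∀ e, endsIn SΓ e = (SΓ.filter (· ∈ e)).card := by
    intro e
    rw [endsIn, ← ncard_coe_finset]
    congr 1
    ext x
    simp [and_comm]
  simp_rw [h1]
  rw [← Finset.card_sigma]
  set Q : Finset (Σ _ : G.V, Option (Sym2 G.V)) := (S ∩ S').sigma fun v =>
    insert none ((T'.filter (v ∈ ·)).image some)
  have hQ : Q.card ≤ (S ∩ S').card * (D + 1) := by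
    rw [Finset.card_sigma]
    refine Finset.sum_le_card_nsmul _ _ _ fun v _ => ?_
    exact (Finset.card_insert_le _ _).trans (Nat.succ_le_succ (Finset.card_image_le.trans (hD v)))
  refine le_trans ?_ hQ
  let idx : G.toSimpleGraph.edgeSet ⊕ (W × G.V) → Option (Sym2 G.V) :=
    Sum.elim (fun e => some e.1) (fun _ => none)
  refine Finset.card_le_card_of_forall_subsingleton
    (fun a b => a.2 = N.pt b.1 ∧ ∃ j, Uses i' S' T' j ∧ G.Inc W b.1 j ∧ a.1 ∈ N.edges j ∧
      b.2 = idx j) ?_ ?_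
  · rintro ⟨e, x⟩ hex
    simp only [Finset.mem_sigma, Finset.mem_sdiff, Finset.mem_filter] at hex
    obtain ⟨⟨heT', heT⟩, hxS, hxe⟩ := hex
    obtain ⟨j', hj', hej'⟩ := (hT' e).1 heT'
    obtain ⟨j, hj, hxj⟩ := (hS x).1 hxS
    have hne : j ≠ j' := by
      rintro rfl
      exact heT ((hT e).2 ⟨j, hj, hej'⟩)
    obtain ⟨v, hv, hv', rfl⟩ := N.overlap j j' hne x hxj (N.mem_verts_of_mem hej' hxe)
    refine ⟨⟨v, idx j'⟩, ?_, rfl, j', hj', hv', hej', rfl⟩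
    simp only [Q, Finset.mem_sigma, Finset.mem_inter]
    refine ⟨⟨mem_of_uses hg hj hv, mem_of_uses hg' hj' hv'⟩, ?_⟩
    rcases j' with e' | k
    · refine Finset.mem_insert_of_mem (Finset.mem_image_of_mem _ ?_)
      exact Finset.mem_filter.2 ⟨hj', hv'⟩
    · exact Finset.mem_insert_self _ _
  · rintro ⟨v, o⟩ -
    rintro ⟨e₁, x₁⟩ ⟨hm₁, hx₁, j₁, hj₁, hv₁, he₁, ho₁⟩ ⟨e₂, x₂⟩ ⟨hm₂, hx₂, j₂, hj₂, hv₂, he₂, ho₂⟩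
    simp only at hx₁ hx₂ he₁ he₂ hv₁ hv₂ ho₁ ho₂
    subst hx₁ hx₂
    have hj : j₁ = j₂ := by
      rw [ho₁] at ho₂
      rcases j₁ with f₁ | ⟨l₁, v₁⟩ <;> rcases j₂ with f₂ | ⟨l₂, v₂⟩
      · simpa [idx, Subtype.ext_iff] using ho₂
      · simp [idx] at ho₂
      · simp [idx] at ho₂
      · obtain rfl : v = v₁ := hv₁
        obtain rfl : v = v₂ := hv₂
        have e : l₁ = l₂ := hj₁.1.trans hj₂.1.symm
        rw [e]
    subst hj
    simp only [Finset.mem_sigma, Finset.mem_filter] at hm₁ hm₂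
    have := N.edge_at_unique hv₁ he₁ he₂ hm₁.2.2 hm₂.2.2
    rw [this]

end Network

end Multigraph

/-! ### Intersection graphs of connected sets as string graphs. -/

theorem IsLine.infinite {A : Set Plane} (h : IsLine A) : A.Infinite := by
  obtain ⟨p, q, f, -, hf, rfl, -⟩ := h
  have : Infinite unitInterval := (Icc_infinite zero_lt_one).to_subtype
  exact infinite_range_of_injective hf

open Classical in
/-- A finite family of lines with finite pairwise intersections, no three of which have a common
point, as a string graph. -/
theorem mem_upToMultiplicity_of_lines {H : Multigraph} {d : ℕ} (A : H.V → Set Plane)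
    (hA : ∀ i, IsLine (A i)) (hfin : ∀ i j, i ≠ j → (A i ∩ A j).Finite)
    (htriple : ∀ i j k, i ≠ j → i ≠ k → j ≠ k → Disjoint (A i) (A j ∩ A k))
    (hmult : ∀ i j, i ≠ j → (H.mult i j ≠ 0 ↔ (A i ∩ A j).Nonempty))
    (hd : ∀ i, ∑ j ∈ Finset.univ.filter (i ≠ ·), (A i ∩ A j).ncard ≤ d) :
    H ∈ UpToMultiplicity (StringGraphs d) := by
  classical
  let H' : Multigraph :=
    { V := H.V
      mult := fun i j => if i ≠ j then (A i ∩ A j).ncard else 0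
      mult_symm := fun i j => by simp only [inter_comm, ne_comm]
      loopless := fun i => by simp }
  have hm : ∀ i j, i ≠ j → H'.mult i j = (A i ∩ A j).ncard := fun i j h => if_pos h
  refine ⟨H', ⟨⟨A, hA, fun x => ?_, ?_, fun i j hij => ?_⟩, fun i => ?_⟩, ⟨⟨Equiv.refl _, ?_⟩⟩⟩
  · rw [← (toFinite _).cast_ncard_eq, Nat.cast_le_ofNat, ← not_lt, two_lt_ncard_iff]
    rintro ⟨i, j, k, hi, hj, hk, hij, hik, hjk⟩
    exact disjoint_left.1 (htriple i j k hij hik hjk) hi ⟨hj, hk⟩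
  · intro i j hij
    by_contra hne
    have h := hfin i j hne
    rw [hij, inter_self] at h
    exact (hA j).infinite h
  · rw [hm i j hij, (hfin i j hij).cast_ncard_eq]
  · refine le_trans (le_of_eq ?_) (hd i)
    rw [Finset.sum_filter]
    rfl
  · intro i j
    change H'.mult i j ≠ 0 ↔ H.mult i j ≠ 0
    by_cases hij : i = j
    · subst hij
      simp [H.loopless, H'.loopless]
    · rw [hm i j hij, hmult i j hij, Ne, ncard_eq_zero (hfin i j hij), nonempty_iff_ne_empty]

theorem boundedIntersectionGraphs_subset (d : ℕ) :
    BoundedIntersectionGraphs d PlanarGraphs ⊆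
      UpToMultiplicity (StringGraphs (2 * (2 * d + 1) * d)) := by
  classical
  rintro H ⟨⟨G, ⟨D⟩, C, hC, -, hmult⟩, hdeg⟩
  -- Only vertices shared with another set matter. Each of them is counted by the edge-degree of
  -- `i`, so there are at most `d`.
  let L : H.V → Finset G.V := fun i => Finset.univ.filter fun v => v ∈ C i ∧ ∃ j, i ≠ j ∧ v ∈ C j
  have hL : ∀ i, (L i).card ≤ d := by
    intro i
    refine le_trans ?_ (hdeg i)
    have hsub : L i ⊆ (Finset.univ.filter (i ≠ ·)).biUnion fun j => (C i ∩ C j).toFinset := by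
      intro v hv
      obtain ⟨-, hvi, j, hij, hvj⟩ := Finset.mem_filter.1 hv
      exact Finset.mem_biUnion.2 ⟨j, by simpa using hij, by simp [hvi, hvj]⟩
    refine (Finset.card_le_card hsub).trans (Finset.card_biUnion_le.trans ?_)
    refine (Finset.sum_le_sum fun j hj => ?_).trans
      (Finset.sum_le_sum_of_subset (Finset.filter_subset _ _))
    rw [hmult i j (Finset.mem_filter.1 hj).2, ncard_eq_toFinset_card']
  have htree := fun i => exists_grows_of_connected (hC i) (L i)
    fun v hv => (Finset.mem_filter.1 hv).2.1
  choose S T hST hLS hSC hT using htree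
  obtain ⟨N⟩ := Multigraph.exists_network D H.V
  choose SΓ TΓ hg hSΓ hTΓ using fun i => N.exists_lift i (hST i)
  obtain ⟨A, hA, hpair, htriple⟩ := exists_contours N.straight hg (fun i x hx => by
    obtain ⟨j, -, hj⟩ := (hSΓ i x).1 hx
    exact N.mem_support_of_mem hj) Finset.univ
  have hline : ∀ i, IsLine (A i) := fun i => by
    obtain ⟨ε, hε⟩ := hA i (Finset.mem_univ _)
    exact hε.isLine
  have hbound : ∀ i j, i ≠ j → (A i ∩ A j).ncard ≤ 2 * (2 * d + 1) * H.mult i j := by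
    have hsum : ∀ i j, i ≠ j →
        ∑ e ∈ TΓ j \ TΓ i, endsIn (SΓ i) e ≤ H.mult i j * (2 * d + 1) := by
      intro i j hij
      refine (N.sum_endsIn_le (hST i) (hST j) (hSΓ i) (hTΓ i) (hTΓ j) (D := 2 * d)
        fun v => ?_).trans (Nat.mul_le_mul_right _ ?_)
      · have := hT j v
        have := hL j
        omega
      · rw [hmult i j hij, ← ncard_coe_finset]
        refine ncard_le_ncard ?_ (toFinite _)
        intro v hv
        rw [Finset.coe_inter] at hv
        exact ⟨hSC i v hv.1, hSC j v hv.2⟩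
    intro i j hij
    have h1 := hsum i j hij
    have h2 := hsum j i hij.symm
    rw [H.mult_symm j i] at h2
    have e : 2 * (2 * d + 1) * H.mult i j = 2 * (H.mult i j * (2 * d + 1)) := by ring
    -- The bound is symmetric in `i` and `j`, so the order of drawing does not matter.
    rcases (hpair i (Finset.mem_univ _) j (Finset.mem_univ _) hij).2.1 with h | h <;> omega
  have hfin : ∀ i j, i ≠ j → (A i ∩ A j).Finite := fun i j hij =>
    (hpair i (Finset.mem_univ _) j (Finset.mem_univ _) hij).1
  refine mem_upToMultiplicity_of_lines A hline hfin (fun i j k => htriple i (Finset.mem_univ _) j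
    (Finset.mem_univ _) k (Finset.mem_univ _)) (fun i j hij => ⟨fun h => ?_, fun h h0 => ?_⟩)
    fun i => ?_
  · rw [hmult i j hij] at h
    obtain ⟨v, hvi, hvj⟩ := nonempty_of_ncard_ne_zero h
    have h1 : v ∈ S i := hLS i (Finset.mem_filter.2 ⟨Finset.mem_univ _, hvi, j, hij, hvj⟩)
    have h2 : v ∈ S j := hLS j (Finset.mem_filter.2 ⟨Finset.mem_univ _, hvj, i, hij.symm, hvi⟩)
    exact (hpair i (Finset.mem_univ _) j (Finset.mem_univ _) hij).2.2.1
      (N.leaves hij (hSΓ i) (hTΓ i) (hTΓ j) h1 h2)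
      (N.leaves hij.symm (hSΓ j) (hTΓ j) (hTΓ i) h2 h1)
  · have := hbound i j hij
    rw [h0, mul_zero, Nat.le_zero, ncard_eq_zero (hfin i j hij)] at this
    exact h.ne_empty this
  · refine (Finset.sum_le_sum fun j hj => hbound i j (Finset.mem_filter.1 hj).2).trans ?_
    rw [← Finset.mul_sum]
    exact Nat.mul_le_mul_left _
      ((Finset.sum_le_sum_of_subset (Finset.filter_subset _ _)).trans (hdeg i))

/-! ### String graphs as intersection graphs: planarization of the lines. -/

theorem eq_of_consecutive {α : Type*} [LinearOrder α] {P : α → Prop} {a b a' b' r : α}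
    (ha : P a) (hb : P b) (ha' : P a') (hb' : P b') (h : ∀ x ∈ Icc a b, P x → x = a ∨ x = b)
    (h' : ∀ x ∈ Icc a' b', P x → x = a' ∨ x = b') (hr : r ∈ Icc a b) (hr' : r ∈ Icc a' b')
    (hP : ¬ P r) : a = a' ∧ b = b' := by
  have lt : ∀ {x}, x ≤ r → P x → x < r := fun hx hPx => hx.lt_of_ne (by rintro rfl; exact hP hPx)
  have gt : ∀ {x}, r ≤ x → P x → r < x := fun hx hPx => hx.lt_of_ne (by rintro rfl; exact hP hPx)
  have h1 := lt hr.1 ha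
  have h2 := lt hr'.1 ha'
  have h3 := gt hr.2 hb
  have h4 := gt hr'.2 hb'
  constructor
  · rcases le_total a a' with hle | hle
    · exact ((h a' ⟨hle, (h2.trans h3).le⟩ ha').resolve_right (h2.trans h3).ne).symm
    · exact (h' a ⟨hle, (h1.trans h4).le⟩ ha).resolve_right (h1.trans h4).ne
  · rcases le_total b b' with hle | hle
    · exact (h' b ⟨(h2.trans h3).le, hle⟩ hb).resolve_left (h2.trans h3).ne'
    · exact ((h b' ⟨(h1.trans h4).le, hle⟩ hb').resolve_left (h1.trans h4).ne').symm

theorem reachable_of_consecutive {α V : Type*} [LinearOrder α] {G : SimpleGraph V} {P : Set α}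
    (hP : P.Finite) (p : ∀ x ∈ P, V)
    (h : ∀ x (hx : x ∈ P) y (hy : y ∈ P), x < y → (∀ z ∈ Icc x y, z ∈ P → z = x ∨ z = y) →
      G.Adj (p x hx) (p y hy)) {s : α} (hs : s ∈ P) {t : α} (ht : t ∈ P) (hst : s ≤ t) :
    G.Reachable (p s hs) (p t ht) := by
  have := hP.to_subtype
  suffices H : ∀ t : P, s ≤ t.1 → G.Reachable (p s hs) (p t.1 t.2) from H ⟨t, ht⟩ hst
  intro t
  induction t using WellFoundedLT.induction with
  | ind t ih =>
    intro hst
    rcases hst.eq_or_lt with heq | hlt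
    · obtain ⟨t, ht⟩ := t
      obtain rfl : s = t := heq
      rfl
    · obtain ⟨m, ⟨hmP, hmt⟩, hm⟩ := exists_max_image {x | x ∈ P ∧ x < t.1} id
        (hP.subset fun _ hx => hx.1) ⟨s, hs, hlt⟩
      refine (ih ⟨m, hmP⟩ hmt (hm s ⟨hs, hlt⟩)).trans (h m hmP t.1 t.2 hmt ?_).reachable
      intro z hz hzP
      rcases hz.2.eq_or_lt with h1 | h1
      · exact Or.inr h1
      · exact Or.inl ((hm z ⟨hzP, h1⟩).antisymm hz.1)

section Planarization

variable {ι : Type} (f : ι → unitInterval → Plane) (X : Set Plane)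

/-- `A` is an arc of one of the curves `f i`, with ends `u` and `v` and with no point of `X` in
its interior. -/
def IsPiece (u v : Plane) (A : Set Plane) : Prop :=
  ∃ i s t, s ≠ t ∧ f i s = u ∧ f i t = v ∧ A = f i '' uIcc s t ∧
    ∀ r ∈ uIcc s t, f i r ∈ X → r = s ∨ r = t

variable {f X}

theorem isPiece_comm {u v : Plane} {A : Set Plane} : IsPiece f X u v A ↔ IsPiece f X v u A := by
  have : ∀ {u v}, IsPiece f X u v A → IsPiece f X v u A := by
    rintro u v ⟨i, s, t, hst, hs, ht, hA, h⟩
    exact ⟨i, t, s, hst.symm, ht, hs, by rw [uIcc_comm, hA],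
      fun r hr hX => (h r (uIcc_comm s t ▸ hr) hX).symm⟩
  exact ⟨this, this⟩

theorem IsPiece.isArcBetween {u v : Plane} {A : Set Plane} (h : IsPiece f X u v A)
    (hc : ∀ i, Continuous (f i)) (hi : ∀ i, Function.Injective (f i)) : IsArcBetween A u v := by
  obtain ⟨i, s, t, hst, rfl, rfl, rfl, -⟩ := h
  rcases hst.lt_or_gt with h | h
  · rw [uIcc_of_le h.le]
    exact isArcBetween_image_unitInterval (hc i) (hi i) h
  · rw [uIcc_of_ge h.le]
    exact (isArcBetween_image_unitInterval (hc i) (hi i) h).symm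

theorem IsPiece.eq_end_of_mem {u v w : Plane} {A : Set Plane} (h : IsPiece f X u v A)
    (hw : w ∈ X) (hwA : w ∈ A) : w = u ∨ w = v := by
  obtain ⟨i, s, t, hst, rfl, rfl, rfl, hX⟩ := h
  obtain ⟨r, hr, rfl⟩ := hwA
  rcases hX r hr hw with rfl | rfl
  exacts [Or.inl rfl, Or.inr rfl]

/-- Different curves meet only in `X`. On a single curve, two pieces with a common point outside `X`
lie between the same consecutive points of `X`, hence have the same ends. -/
theorem IsPiece.mem_of_mem {u v u' v' : Plane} {A A' : Set Plane} (h : IsPiece f X u v A)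
    (h' : IsPiece f X u' v' A') (hi : ∀ i, Function.Injective (f i))
    (hX : ∀ i j, i ≠ j → range (f i) ∩ range (f j) ⊆ X) (hu : u ∈ X) (hv : v ∈ X) (hu' : u' ∈ X)
    (hv' : v' ∈ X) (hne : s(u, v) ≠ s(u', v')) {x : Plane} (hx : x ∈ A) (hx' : x ∈ A') :
    x ∈ X := by
  obtain ⟨i, s, t, hst, rfl, rfl, rfl, hb⟩ := h
  obtain ⟨j, s', t', hst', rfl, rfl, rfl, hb'⟩ := h'
  obtain ⟨r, hr, rfl⟩ := hx
  obtain ⟨r', hr', hrr⟩ := hx'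
  by_cases hij : i = j
  · subst hij
    obtain rfl := hi i hrr
    by_contra hrX
    refine hne ?_
    have key : ∀ {a b a' b' : unitInterval}, a ≤ b → a' ≤ b' → f i a ∈ X → f i b ∈ X →
        f i a' ∈ X → f i b' ∈ X → (∀ x ∈ Icc a b, f i x ∈ X → x = a ∨ x = b) →
        (∀ x ∈ Icc a' b', f i x ∈ X → x = a' ∨ x = b') → r' ∈ Icc a b → r' ∈ Icc a' b' →
        s(f i a, f i b) = s(f i a', f i b') := by
      intro a b a' b' _ _ h1 h2 h3 h4 h5 h6 h7 h8
      obtain ⟨rfl, rfl⟩ := eq_of_consecutive (P := fun x => f i x ∈ X) h1 h2 h3 h4 h5 h6 h7 h8 hrX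
      rfl
    rcases le_total s t with h1 | h1 <;> rcases le_total s' t' with h2 | h2
    · rw [uIcc_of_le h1] at hr hb
      rw [uIcc_of_le h2] at hr' hb'
      exact key h1 h2 hu hv hu' hv' hb hb' hr hr'
    · rw [uIcc_of_le h1] at hr hb
      rw [uIcc_of_ge h2] at hr' hb'
      rw [Sym2.eq_swap (a := f i s')]
      exact key h1 h2 hu hv hv' hu' hb (fun x hx hX => (hb' x hx hX).symm) hr hr'
    · rw [uIcc_of_ge h1] at hr hb
      rw [uIcc_of_le h2] at hr' hb'
      rw [Sym2.eq_swap (a := f i s)]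
      exact key h1 h2 hv hu hu' hv' (fun x hx hX => (hb x hx hX).symm) hb' hr hr'
    · rw [uIcc_of_ge h1] at hr hb
      rw [uIcc_of_ge h2] at hr' hb'
      rw [Sym2.eq_swap (a := f i s), Sym2.eq_swap (a := f i s')]
      exact key h1 h2 hv hu hv' hu' (fun x hx hX => (hb x hx hX).symm)
        (fun x hx hX => (hb' x hx hX).symm) hr hr'
  · exact hX i j hij ⟨⟨r, rfl⟩, ⟨r', hrr⟩⟩

variable (f X)

open Classical in
/-- The plane graph with vertex set `X` into which `X` divides the curves `f i`. -/
noncomputable def planarization [Finite X] (hi : ∀ i, Function.Injective (f i)) : Multigraph where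
  V := X
  fintypeV := Fintype.ofFinite X
  mult u v := if ∃ A, IsPiece f X u v A then 1 else 0
  mult_symm u v := by simp only [isPiece_comm (u := (u : Plane))]
  loopless v := by
    refine if_neg ?_
    rintro ⟨A, i, s, t, hst, hs, ht, -⟩
    exact hst (hi i (hs.trans ht.symm))

variable {f X}

theorem planarization_mem_planarGraphs [Finite X] (hc : ∀ i, Continuous (f i))
    (hi : ∀ i, Function.Injective (f i)) (hX : ∀ i j, i ≠ j → range (f i) ∩ range (f j) ⊆ X) :
    planarization f X hi ∈ PlanarGraphs := by
  classical
  -- Several curves may contain a piece with ends `u` and `v`; `Classical.epsilon` selects one of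
  -- them, the same for both orders of the ends since the two predicates agree.
  have hmult : ∀ u v k, k < (planarization f X hi).mult u v → k = 0 ∧
      IsPiece f X u.1 v.1 (Classical.epsilon (IsPiece f X u.1 v.1)) := by
    intro u v k hk
    by_cases h : ∃ A, IsPiece f X u.1 v.1 A
    · have : (planarization f X hi).mult u v = 1 := if_pos h
      exact ⟨by omega, Classical.epsilon_spec h⟩
    · have : (planarization f X hi).mult u v = 0 := if_neg h
      omega
  refine ⟨⟨Subtype.val, fun u v _ => Classical.epsilon (IsPiece f X u.1 v.1),
    Subtype.val_injective, ?_, ?_, ?_, ?_⟩⟩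
  · intro u v k
    congr 1
    ext A
    exact isPiece_comm
  · intro u v k hk
    exact (hmult u v k hk).2.isArcBetween hc hi
  · intro u v k w hk hw
    exact ((hmult u v k hk).2.eq_end_of_mem w.2 hw).imp Subtype.ext Subtype.ext
  · intro u v k u' v' k' hk hk' hne x hx hx'
    obtain ⟨rfl, h⟩ := hmult u v k hk
    obtain ⟨rfl, h'⟩ := hmult u' v' k' hk'
    suffices hxX : x ∈ X from ⟨⟨x, hxX⟩, rfl⟩
    refine h.mem_of_mem h' hi hX u.2 v.2 u'.2 v'.2 (fun heq => hne ?_) hx hx'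
    have := Sym2.map.injective Subtype.val_injective (a₁ := s(u, v)) (a₂ := s(u', v')) heq
    exact congrArg (·, 0) this

/-- Consecutive points of `X` along `f i` are adjacent, so walking along the curve joins any two of
them. -/
theorem planarization_isConnectedSet [Finite X] (hi : ∀ i, Function.Injective (f i)) (i : ι)
    (hne : (range (f i) ∩ X).Nonempty) :
    (planarization f X hi).IsConnectedSet {v : X | v.1 ∈ range (f i)} := by
  set C : Set (planarization f X hi).V := {v : X | v.1 ∈ range (f i)}
  have hP : (f i ⁻¹' X).Finite := (toFinite X).preimage (hi i).injOn
  let p : ∀ s ∈ f i ⁻¹' X, C := fun s hs => ⟨⟨f i s, hs⟩, s, rfl⟩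
  have key := fun s hs t ht hst => reachable_of_consecutive
    (G := (planarization f X hi).toSimpleGraph.induce C) hP p (fun x hx y hy hxy h => by
      have hA : ∃ A, IsPiece f X (f i x) (f i y) A :=
        ⟨_, i, x, y, hxy.ne, rfl, rfl, rfl, by rwa [uIcc_of_le hxy.le]⟩
      have h1 : (planarization f X hi).mult ⟨f i x, hx⟩ ⟨f i y, hy⟩ = 1 := if_pos hA
      exact h1.trans_ne one_ne_zero) (s := s) hs (t := t) ht hst
  obtain ⟨_, ⟨s₀, rfl⟩, hs₀⟩ := hne
  have : Nonempty C := ⟨p s₀ hs₀⟩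
  refine ⟨?_⟩
  rintro ⟨⟨u, hu⟩, s, rfl : f i s = u⟩ ⟨⟨v, hv⟩, t, rfl : f i t = v⟩
  rcases le_total s t with h | h
  · exact key s hu t hv h
  · exact (key t hv s hu h).symm

end Planarization

theorem stringGraphs_subset (d : ℕ) :
    StringGraphs d ⊆ BoundedIntersectionGraphs d PlanarGraphs := by
  rintro H ⟨⟨L, hL, -, -, hmult⟩, hdeg⟩
  refine ⟨?_, hdeg⟩
  choose _ _ f hc hi hf _ _ using hL
  have hfin : ∀ i j, i ≠ j → (L i ∩ L j).Finite := fun i j hij => by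
    rw [← encard_ne_top_iff, hmult i j hij]
    exact ENat.natCast_ne_top _
  -- A line is infinite but has only finitely many points on the other lines. The private points
  -- make the vertex sets nonempty and pairwise distinct, even for lines that meet no other line.
  have hprivate : ∀ i, ∃ p ∈ L i, ∀ j, i ≠ j → p ∉ L j := by
    intro i
    have hline : IsLine (L i) := ⟨_, _, f i, hc i, hi i, hf i, rfl, rfl⟩
    obtain ⟨p, hp, hp'⟩ := (hline.infinite.sdiff (finite_iUnion fun j : {j // i ≠ j} =>
      hfin i j.1 j.2)).nonempty
    exact ⟨p, hp, fun j hij hj => hp' (mem_iUnion.2 ⟨⟨j, hij⟩, hp, hj⟩)⟩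
  choose p hpL hp using hprivate
  set X : Set Plane := (⋃ k : {k : H.V × H.V // k.1 ≠ k.2}, L k.1.1 ∩ L k.1.2) ∪ range p
  have hXfin : X.Finite := (finite_iUnion fun k => hfin _ _ k.2).union (finite_range p)
  have hX : ∀ i j, i ≠ j → L i ∩ L j ⊆ X := fun i j hij x hx =>
    Or.inl (mem_iUnion.2 ⟨⟨(i, j), hij⟩, hx⟩)
  have hpX : ∀ i, p i ∈ X := fun i => Or.inr ⟨i, rfl⟩
  have := hXfin.to_subtype
  have hXf : ∀ i j, i ≠ j → range (f i) ∩ range (f j) ⊆ X := fun i j hij => by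
    rw [hf, hf]
    exact hX i j hij
  refine ⟨planarization f X hi, planarization_mem_planarGraphs hc hi hXf,
    fun i => {v : X | v.1 ∈ range (f i)}, fun i => planarization_isConnectedSet hi i
      ⟨p i, by rw [hf]; exact hpL i, hpX i⟩, ?_, ?_⟩
  · intro i j hij
    by_contra hne
    have h : (⟨p i, hpX i⟩ : X) ∈ {v : X | v.1 ∈ range (f i)} := by
      rw [mem_ofPred_eq, hf]
      exact hpL i
    have hij : {v : X | v.1 ∈ range (f i)} = {v : X | v.1 ∈ range (f j)} := hij
    rw [hij, mem_ofPred_eq, hf] at h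
    exact hp i j hne h
  · intro i j hij
    have h : ((↑) : X → Plane) '' ({v : X | v.1 ∈ range (f i)} ∩ {v : X | v.1 ∈ range (f j)}) =
        L i ∩ L j := by
      rw [← hf i, ← hf j]
      ext x
      constructor
      · rintro ⟨v, hv, rfl⟩
        exact hv
      · exact fun hx => ⟨⟨x, hXf i j hij hx⟩, hx, rfl⟩
    have h2 := ncard_image_of_injective ({v : X | v.1 ∈ range (f i)} ∩
      {v : X | v.1 ∈ range (f j)}) Subtype.val_injective
    rw [h, ncard_def, hmult i j hij] at h2
    exact h2

end StringGraphs

theorem mainTheorem6 :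
    ∃ c : ℕ, ∀ d : ℕ,
      StringGraphs d ⊆ BoundedIntersectionGraphs d PlanarGraphs ∧
      ∃ d' : ℕ, d' ≤ c * d ^ 2 ∧
        BoundedIntersectionGraphs d PlanarGraphs ⊆ UpToMultiplicity (StringGraphs d') := by
  -- The constant 6 comes from `4 * d ^ 2 + 2 * d ≤ 6 * d ^ 2`.
  refine ⟨6, fun d => ⟨stringGraphs_subset d, 2 * (2 * d + 1) * d, ?_,
    boundedIntersectionGraphs_subset d⟩⟩
  rcases Nat.eq_zero_or_pos d with rfl | h
  · simp
  · nlinarith
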